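/- **Setting.** Let $D\subset\mathbb R^d$ be a bounded convex domain (nonempty and open; its boundary is then Lipschitz), let $\mathscr L$ be Lebesgue measure on the compact set $\bar D$, and let $\delta>0$. Let $\mathscr M^+(\cdot)$, $\mathscr M(\cdot)$, $\mathscr M(\cdot;\mathbb R^d)$ denote the finite non-negative, signed, and $\mathbb R^d$-valued Borel measures on a compact space, with weak$^*$ convergence in duality with continuous functions on that space. Let $r:\mathbb R\to\mathbb R$ be non-negative and convex with $r(0)=0$, and let $r^\infty(y)=\sup_{s>0} r(sy)/s$ be its recession function; assume linear growth, i.e. $r^\infty(1),r^\infty(-1)\in(0,\infty)$. *Continuity equation.* Let $\mu_A,\mu_B\in\mathscr M^+(\bar D)$. A triple $(\mu,\nu,\zeta)\in\mathscr M^+([0,1]\times\bar D)\times\mathscr M([0,1]\times\bar D;\mathbb R^d)\times\mathscr M([0,1]\times\bar D)$ belongs to $\mathcal{CE}[0,1]$ with boundary values $\mu_A,\mu_B$ if (i) there are a weak$^*$-continuous map $t\mapsto\mu_t\in\mathscr M^+(\bar D)$ and Borel measurable maps $t\mapsto\nu_t\in\mathscr M(\bar D;\mathbb R^d)$, $t\mapsto\zeta_t\in\mathscr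 M(\bar D)$, defined on $[0,1]$, with $\int_0^1|\nu_t|(\bar D)\,dt<\infty$ and $\int_0^1|\zeta_t|(\bar D)\,dt<\infty$, such that $\int\eta\,d\mu=\int_0^1\int_{\bar D}\eta(t,x)\,d\mu_t(x)\,dt$ for all $\eta\in L^1(\mu)$, and likewise for $\nu$ and $\zeta$; (ii) for every $\eta\in C^1([0,1]\times\bar D)$ (the restriction of a $C^1$ function on $\mathbb R\times\mathbb R^d$), $$0=\int_0^1\Big[\int_{\bar D}\partial_t\eta\,d\mu_t+\int_{\bar D}\nabla\eta\cdot d\nu_t+\int_{\bar D}\eta\,d\zeta_t\Big]dt-\int_{\bar D}\eta(1,x)\,d\mu_B(x)+\int_{\bar D}\eta(0,x)\,d\mu_A(x).$$ *Energy.* Let $\Phi(u,m)=|m|^2/u$ if $u>0$, $\Phi(0,0)=0$, and $\Phi=+\infty$ otherwise. For $(\mu_t,\nu_t,\zeta_t)\in\mathscr M^+(\bar D)\times\mathscr M(\bar D;\mathbb R^d)\times\mathscr M(\bar D)$ write the Lebesgue decompositions $\mu_t=u_t\mathscr L+\mu_t^\perp$, $\nu_t=m_t\mathscr L+\nu_t^\perp$,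 $\zeta_t=z_t\mathscr L+\zeta_t^\perp$, put $\mathscr L_t^\perp=\mu_t^\perp+|\nu_t^\perp|+|\zeta_t^\perp|$, and let $u_t^\perp,m_t^\perp,z_t^\perp$ be the densities of $\mu_t^\perp,\nu_t^\perp,\zeta_t^\perp$ with respect to $\mathscr L_t^\perp$. Put $$\mathcal D_\delta[\mu_t,\nu_t,\zeta_t]=\int_{\bar D}\Phi(u_t,m_t)\,d\mathscr L+\int_{\bar D}\Phi(u_t^\perp,m_t^\perp)\,d\mathscr L_t^\perp+\frac1\delta\Big(\int_{\bar D}r(z_t)\,d\mathscr L+\int_{\bar D}r^\infty(z_t^\perp)\,d\mathscr L_t^\perp\Big)^2$$ (here $r^\infty(z)=|z|$ whenever $r(s)/|s|\to1$ as $|s|\to\infty$, e.g. for $r=|\cdot|$ or a Huber function), and $\mathcal E_\delta(\mu,\nu,\zeta)=\int_0^1\mathcal D_\delta[\mu_t,\nu_t,\zeta_t]\,dt$ for $(\mu,\nu,\zeta)\in\mathcal{CE}[0,1]$. **Proposition (compactness).** Let $(\mu^n,\nu^n,\zeta^n)_{n\in\mathbb N}$ be a sequence in $\mathcal{CE}[0,1]$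 with boundary values $\mu_A$ and $\mu_B$ (the same for all $n$) and $\sup_n\mathcal E_\delta(\mu^n,\nu^n,\zeta^n)\le C$ for some $C<\infty$. Then there are a subsequence (again indexed by $n$) and a triple $(\mu,\nu,\zeta)\in\mathcal{CE}[0,1]$ with boundary values $\mu_A,\mu_B$ such that $\mu^n_t\rightharpoonup^*\mu_t$ in $\mathscr M^+(\bar D)$ for every $t\in[0,1]$, $\nu^n\rightharpoonup^*\nu$ in $\mathscr M([0,1]\times\bar D;\mathbb R^d)$, $\zeta^n\rightharpoonup^*\zeta$ in $\mathscr M([0,1]\times\bar D)$, and $$\int_0^1\mathcal D_\delta[\mu_t,\nu_t,\zeta_t]\,dt\le\liminf_{n\to\infty}\int_0^1\mathcal D_\delta[\mu^n_t,\nu^n_t,\zeta^n_t]\,dt .$$ -/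

import Mathlib

open MeasureTheory Set Filter Topology
open scoped ENNReal unitInterval

namespace SourceTransport

noncomputable section

/-- The ambient space `ℝ^d` with its Euclidean structure. -/
abbrev Vec (d : ℕ) : Type := EuclideanSpace ℝ (Fin d)

/-- A bounded convex domain of `ℝ^d` (a nonempty open bounded convex set). The boundary of such a
set is automatically Lipschitz. -/
structure IsBoundedConvexDomain {d : ℕ} (D : Set (Vec d)) : Prop where
  isOpen : IsOpen D
  nonempty : D.Nonempty
  convex : Convex ℝ D
  isBounded : Bornology.IsBounded D

/-- The closed domain `D̄`, as a (compact) space. -/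
abbrev Cl {d : ℕ} (D : Set (Vec d)) : Type := ↥(closure D)

/-- Lebesgue measure on `D̄`. -/
def leb {d : ℕ} (D : Set (Vec d)) : Measure (Cl D) := Measure.comap Subtype.val volume

/-- The space-time cylinder `[0,1] × D̄`. -/
abbrev Cyl {d : ℕ} (D : Set (Vec d)) : Type := I × Cl D

/-- Mass `μ ∈ M⁺([0,1] × D̄)`, momentum `ν ∈ M([0,1] × D̄; ℝ^d)`, source `ζ ∈ M([0,1] × D̄)`. -/
structure Triple {d : ℕ} (D : Set (Vec d)) where
  mass : FiniteMeasure (Cyl D)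
  momentum : VectorMeasure (Cyl D) (Vec d)
  source : SignedMeasure (Cyl D)

/-- Families `t ↦ μ_t ∈ M⁺(D̄)`, `t ↦ ν_t ∈ M(D̄; ℝ^d)`, `t ↦ ζ_t ∈ M(D̄)`, `t ∈ [0,1]`. -/
structure Curve {d : ℕ} (D : Set (Vec d)) where
  mass : I → FiniteMeasure (Cl D)
  momentum : I → VectorMeasure (Cl D) (Vec d)
  source : I → SignedMeasure (Cl D)

/-- `c` disintegrates the space-time measures `T` with respect to Lebesgue measure in time.
The topology of `FiniteMeasure (Cl D)` is the weak-* topology, as `D̄` is compact. -/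
structure IsDisintegration {d : ℕ} {D : Set (Vec d)} (T : Triple D) (c : Curve D) : Prop where
  continuous_mass : Continuous c.mass
  measurable_momentum : ∀ B : Set (Cl D), MeasurableSet B → Measurable fun t => c.momentum t B
  finite_momentum : ∫⁻ t, (c.momentum t).variation univ < ∞
  measurable_source : ∀ B : Set (Cl D), MeasurableSet B → Measurable fun t => c.source t B
  finite_source : ∫⁻ t, (c.source t).variation univ < ∞
  mass_eq : ∀ η : Cyl D → ℝ, Integrable η (T.mass : Measure (Cyl D)) →
    ∫ p, η p ∂(T.mass : Measure (Cyl D)) =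
      ∫ t : I, ∫ x, η (t, x) ∂(c.mass t : Measure (Cl D))
  momentum_eq : ∀ η : Cyl D → ℝ, T.momentum.Integrable η →
    ∫ᵛ p, η p ∂•T.momentum = ∫ t : I, ∫ᵛ x, η (t, x) ∂•(c.momentum t)
  source_eq : ∀ η : Cyl D → ℝ, T.source.Integrable η →
    ∫ᵛ p, η p ∂•T.source = ∫ t : I, ∫ᵛ x, η (t, x) ∂•(c.source t)

/-- The triple `T`, with disintegration `c`, is a weak solution of `∂_t μ + div ν = ζ` with boundary
values `μ_0 = μA` and `μ_1 = μB`. The test functions are the restrictions to `[0,1] × D̄` of `C^1`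
functions on `ℝ × ℝ^d`; they need not vanish on the boundary of the cylinder. -/
structure IsWeakSolution {d : ℕ} {D : Set (Vec d)} (μA μB : FiniteMeasure (Cl D))
    (T : Triple D) (c : Curve D) : Prop where
  disintegration : IsDisintegration T c
  equation : ∀ η : ℝ × Vec d → ℝ, ContDiff ℝ 1 η →
    0 = (∫ t : I,
          ((∫ x : Cl D, deriv (fun s : ℝ => η (s, (x : Vec d))) (t : ℝ)
              ∂(c.mass t : Measure (Cl D)))
            + (∫ᵛ x : Cl D, gradient (fun y : Vec d => η ((t : ℝ), y)) (x : Vec d)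
                ∂[innerSL ℝ; c.momentum t])
            + (∫ᵛ x : Cl D, η ((t : ℝ), (x : Vec d)) ∂•(c.source t))))
        - (∫ x : Cl D, η (1, (x : Vec d)) ∂(μB : Measure (Cl D)))
        + (∫ x : Cl D, η (0, (x : Vec d)) ∂(μA : Measure (Cl D)))

/-- The transport integrand: `Φ(ρ, m) = |m|² / ρ` if `ρ > 0`, `0` if `(ρ, m) = 0`, `+∞` otherwise. -/
def Phi {d : ℕ} (ρ : ℝ) (m : Vec d) : ℝ≥0∞ :=
  open Classical in
  if 0 < ρ then ENNReal.ofReal (‖m‖ ^ 2 / ρ) else if ρ = 0 ∧ m = 0 then 0 else ∞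

/-- The recession function `r^∞(y) = sup_{s > 0} r(s y) / s`. -/
def recession (r : ℝ → ℝ) (y : ℝ) : ℝ≥0∞ :=
  ⨆ (s : ℝ) (_ : 0 < s), ENNReal.ofReal (r (s * y) / s)

/-- Source penalties: non-negative, convex, vanishing at `0`, with linear growth on both sides. -/
structure IsSourcePenalty (r : ℝ → ℝ) : Prop where
  nonneg : ∀ s, 0 ≤ r s
  convex : ConvexOn ℝ univ r
  zero : r 0 = 0
  growth_pos : 0 < recession r 1 ∧ recession r 1 < ∞
  growth_neg : 0 < recession r (-1) ∧ recession r (-1) < ∞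

section Decomposition

variable {d : ℕ} {X : Type*} [MeasurableSpace X]

/-- The density of the absolutely continuous part of an `ℝ^d`-valued measure with respect to `l`,
computed coordinate by coordinate. -/
def vecDensity (ν : VectorMeasure X (Vec d)) (l : Measure X) (x : X) : Vec d :=
  WithLp.toLp 2 fun i =>
    SignedMeasure.rnDeriv
      (ν.mapRange (EuclideanSpace.proj (𝕜 := ℝ) i).toLinearMap.toAddMonoidHom
        (EuclideanSpace.proj (𝕜 := ℝ) i).continuous) l x

/-- The singular part `ν^⊥ = ν - m l` of an `ℝ^d`-valued measure with respect to `l`. -/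
def vecSingularPart (ν : VectorMeasure X (Vec d)) (l : Measure X) : VectorMeasure X (Vec d) :=
  ν - l.withDensityᵥ (vecDensity ν l)

/-- The measure `l^⊥ = μ^⊥ + |ν^⊥| + |ζ^⊥|`. -/
def perp (l : Measure X) (μ : FiniteMeasure X) (ν : VectorMeasure X (Vec d))
    (ζ : SignedMeasure X) : Measure X :=
  (μ : Measure X).singularPart l + (vecSingularPart ν l).variation + (ζ.singularPart l).variation

/-- `∫ Φ(u, m) dl + ∫ Φ(u^⊥, m^⊥) dl^⊥`. -/
def transportAction (l : Measure X) (μ : FiniteMeasure X) (ν : VectorMeasure X (Vec d))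
    (ζ : SignedMeasure X) : ℝ≥0∞ :=
  ∫⁻ x, Phi ((μ : Measure X).rnDeriv l x).toReal (vecDensity ν l x) ∂l
  + ∫⁻ x, Phi (((μ : Measure X).singularPart l).rnDeriv (perp l μ ν ζ) x).toReal
      (vecDensity (vecSingularPart ν l) (perp l μ ν ζ) x) ∂(perp l μ ν ζ)

/-- `(∫ r(z) dl + ∫ r^∞(z^⊥) dl^⊥)²`. The integrand `r^∞(z^⊥)` is `|z^⊥|` if `r(s)/|s| → 1`
as `|s| → ∞`, see `recession_eq_abs`. -/
def sourceAction (r : ℝ → ℝ) (l : Measure X) (μ : FiniteMeasure X) (ν : VectorMeasure X (Vec d))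
    (ζ : SignedMeasure X) : ℝ≥0∞ :=
  (∫⁻ x, ENNReal.ofReal (r (ζ.rnDeriv l x)) ∂l
  + ∫⁻ x, recession r ((ζ.singularPart l).rnDeriv (perp l μ ν ζ) x) ∂(perp l μ ν ζ)) ^ 2

/-- The energy density `D_δ[μ, ν, ζ]`, relative to the reference measure `l`. -/
def energyDensity (δ : ℝ) (r : ℝ → ℝ) (l : Measure X) (μ : FiniteMeasure X)
    (ν : VectorMeasure X (Vec d)) (ζ : SignedMeasure X) : ℝ≥0∞ :=
  transportAction l μ ν ζ + ENNReal.ofReal (1 / δ) * sourceAction r l μ ν ζ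

end Decomposition

/-- The path energy `∫₀¹ D_δ[μ_t, ν_t, ζ_t] dt`. For a solution of the continuity equation this is
the energy `E_δ` of the space-time triple: disintegrations are unique up to null sets of times. -/
def pathEnergy {d : ℕ} {D : Set (Vec d)} (δ : ℝ) (r : ℝ → ℝ) (c : Curve D) : ℝ≥0∞ :=
  ∫⁻ t : I, energyDensity δ r (leb D) (c.mass t) (c.momentum t) (c.source t)

/-- For a convex penalty with `r 0 = 0` and `r(s)/|s| → 1` at `±∞`, the recession function is the
absolute value. -/
theorem recession_eq_abs {r : ℝ → ℝ} (hc : ConvexOn ℝ univ r) (h0 : r 0 = 0)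
    (hp : Tendsto (fun s : ℝ => r s / s) atTop (𝓝 1))
    (hn : Tendsto (fun s : ℝ => r (-s) / s) atTop (𝓝 1)) (y : ℝ) :
    recession r y = ENNReal.ofReal |y| := by
  have mono : ∀ s t : ℝ, 0 < s → s ≤ t → r (s * y) / s ≤ r (t * y) / t := by
    intro s t hs hst
    have ht : 0 < t := hs.trans_le hst
    have h := hc.2 (mem_univ (t * y)) (mem_univ 0) 
      (show 0 ≤ s / t by positivity)
      (show 0 ≤ 1 - s / t by rw [sub_nonneg, div_le_one ht]; exact hst) (by ring)
    simp only [smul_eq_mul, mul_zero, add_zero, h0] at h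
    rw [show s / t * (t * y) = s * y by field_simp] at h
    rw [div_le_div_iff₀ hs ht]
    rw [div_mul_eq_mul_div, le_div_iff₀ ht] at h
    linarith
  have lim : Tendsto (fun s : ℝ => r (s * y) / s) atTop (𝓝 |y|) := by
    rcases lt_trichotomy y 0 with hy | hy | hy
    · have h := (hn.comp (tendsto_id.atTop_mul_const (neg_pos.2 hy))).const_mul (-y)
      rw [mul_one] at h
      rw [abs_of_neg hy]
      refine h.congr' ?_
      filter_upwards [eventually_gt_atTop 0] with s hs
      have : y ≠ 0 := hy.ne
      simp only [Function.comp, id]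
      rw [show -(s * -y) = s * y by ring]
      field_simp
    · subst hy; simp [h0]
    · have h := (hp.comp (tendsto_id.atTop_mul_const hy)).const_mul y
      rw [mul_one] at h
      rw [abs_of_pos hy]
      refine h.congr' ?_
      filter_upwards [eventually_gt_atTop 0] with s hs
      have : y ≠ 0 := hy.ne'
      simp only [Function.comp, id]
      field_simp
  apply le_antisymm
  · refine iSup₂_le fun s hs => ENNReal.ofReal_le_ofReal ?_
    refine ge_of_tendsto lim ?_
    filter_upwards [eventually_ge_atTop s] with t ht using mono s t hs ht
  · refine le_of_tendsto (ENNReal.tendsto_ofReal lim) ?_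
    filter_upwards [eventually_gt_atTop 0] with s hs
    exact le_iSup₂ (f := fun (s : ℝ) (_ : 0 < s) => ENNReal.ofReal (r (s * y) / s)) s hs

end

end SourceTransport

/-!
The energy density is the supremum of countably many affine functionals of `(μ_t, ν_t, ζ_t)` that
are weakly-* continuous. It is also coercive: the source term controls `∫ |ζ_t|(D̄)² dt`, so the
masses stay bounded, and then the transport term controls `∫ |ν_t|(D̄)² dt` by Cauchy-Schwarz. Hence
the time marginals of `|ν^n|` and `|ζ^n|` are absolutely continuous uniformly in `n`. This yields a
weakly-* convergent subsequence whose limits again disintegrate in time, and it allows testing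
against discontinuous indicators of time intervals, so the integrated continuity equation passes to
the limit and gives `μ^n_t ⇀ μ_t` at every `t`. Lower semicontinuity follows on approximating the
time-dependent choice among the affine functionals by continuous weights in `t`.
-/

namespace SourceTransport

noncomputable section

section Integration

variable {X E F G : Type*} [MeasurableSpace X]
  [NormedAddCommGroup E] [NormedSpace ℝ E] [NormedAddCommGroup F] [NormedSpace ℝ F]
  [NormedAddCommGroup G] [NormedSpace ℝ G] {l : Measure X} {h : X → F}

instance isFiniteMeasure_variation_signedMeasure (τ : SignedMeasure X) :
    IsFiniteMeasure τ.variation := by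
  rw [← SignedMeasure.totalVariation_eq_variation, SignedMeasure.totalVariation]
  infer_instance

theorem withDensityᵥ_rnDeriv_of_variation_absolutelyContinuous (τ : SignedMeasure X)
    [SigmaFinite l] (hτ : τ.variation ≪ l) : l.withDensityᵥ (τ.rnDeriv l) = τ := by
  refine SignedMeasure.withDensityᵥ_rnDeriv_eq τ l
    (VectorMeasure.AbsolutelyContinuous.mk fun s hs hs0 => ?_)
  rw [Measure.toENNRealVectorMeasure_apply_measurable hs] at hs0
  simpa [hτ hs0] using τ.enorm_measure_le_variation s

variable [CompleteSpace F]

theorem lintegral_variation_withDensityᵥ (hh : Integrable h l) {g : X → ℝ≥0∞}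
    (hg : AEMeasurable g (l.withDensityᵥ h).variation) :
    ∫⁻ x, g x ∂(l.withDensityᵥ h).variation = ∫⁻ x, ‖h x‖ₑ * g x ∂l := by
  rw [Measure.variation_withDensityᵥ hh] at hg ⊢
  exact lintegral_withDensity_eq_lintegral_mul₀' hh.1.enorm hg

theorem integrable_bilin (hh : Integrable h l) (B : E →L[ℝ] F →L[ℝ] G) {f : X → E}
    (hf : (l.withDensityᵥ h).Integrable f) : Integrable (fun x => B (f x) (h x)) l := by
  rw [VectorMeasure.Integrable, Measure.variation_withDensityᵥ hh] at hf
  have hf' : Integrable (fun x => ‖h x‖₊ • f x) l :=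
    (integrable_withDensity_iff_integrable_smul₀ hh.1.nnnorm.aemeasurable).1 hf
  have hdir : AEStronglyMeasurable (fun x => ‖h x‖⁻¹ • h x) l :=
    hh.1.norm.aemeasurable.inv.aestronglyMeasurable.smul hh.1
  -- `f` is only known to be measurable where `h ≠ 0`; the factor `‖h‖` cuts off the rest.
  have hpolar : ∀ x, B (f x) (h x) = B (‖h x‖₊ • f x) (‖h x‖⁻¹ • h x) := fun x => by
    by_cases hx : h x = 0
    · simp [hx]
    · rw [NNReal.smul_def, coe_nnnorm, map_smul, map_smul, _root_.smul_apply, smul_smul,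
        inv_mul_cancel₀ (norm_ne_zero_iff.2 hx), one_smul]
  simp_rw [hpolar]
  refine (hf'.norm.const_mul ‖B‖).mono' (B.aestronglyMeasurable_comp₂ hf'.1 hdir)
    (ae_of_all _ fun x => (B.le_opNorm₂ _ _).trans ?_)
  refine mul_le_of_le_one_right (by positivity) ?_
  rw [norm_smul, norm_inv, norm_norm]
  exact inv_mul_le_one

theorem enorm_integral_bilin_le (hh : Integrable h l) (B : E →L[ℝ] F →L[ℝ] G) {f : X → E}
    (hf : (l.withDensityᵥ h).Integrable f) :
    ‖∫ x, B (f x) (h x) ∂l‖ₑ ≤ ‖B‖ₑ * ∫⁻ x, ‖f x‖ₑ ∂(l.withDensityᵥ h).variation := by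
  rw [lintegral_variation_withDensityᵥ hh hf.1.enorm,
    ← lintegral_const_mul' _ _ enorm_ne_top]
  refine (enorm_integral_le_lintegral_enorm _).trans (lintegral_mono fun x => ?_)
  calc ‖B (f x) (h x)‖ₑ ≤ ‖B‖ₑ * ‖f x‖ₑ * ‖h x‖ₑ := by
        simp only [enorm_eq_nnnorm]
        exact_mod_cast B.le_opNorm₂ (f x) (h x)
    _ = ‖B‖ₑ * (‖h x‖ₑ * ‖f x‖ₑ) := by ring

theorem continuous_integral_bilin (hh : Integrable h l) (B : E →L[ℝ] F →L[ℝ] G) :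
    Continuous fun f : X →₁[(l.withDensityᵥ h).variation] E => ∫ x, B (f x) (h x) ∂l := by
  refine (show LipschitzWith ‖B‖₊ _ from fun f g => ?_).continuous
  have hf := L1.integrable_coeFn f
  have hg := L1.integrable_coeFn g
  rw [edist_eq_enorm_sub, ← integral_sub (integrable_bilin hh B hf) (integrable_bilin hh B hg),
    L1.edist_def]
  simp_rw [edist_eq_enorm_sub, ← _root_.sub_apply, ← map_sub]
  exact enorm_integral_bilin_le hh B (hf.sub hg)

theorem integral_bilin_congr_ae (hh : Integrable h l) (B : E →L[ℝ] F →L[ℝ] G) {f g : X → E}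
    (hfg : f =ᵐ[(l.withDensityᵥ h).variation] g) :
    ∫ x, B (f x) (h x) ∂l = ∫ x, B (g x) (h x) ∂l := by
  rw [Measure.variation_withDensityᵥ hh] at hfg
  refine integral_congr_ae ?_
  filter_upwards [(ae_withDensity_iff' hh.1.enorm).1 hfg] with x hx
  by_cases h0 : h x = 0
  · simp [h0]
  · rw [hx (by simpa using h0)]

theorem integral_withDensityᵥ [CompleteSpace G] (hh : Integrable h l) (B : E →L[ℝ] F →L[ℝ] G)
    {f : X → E} (hf : (l.withDensityᵥ h).Integrable f) :
    ∫ᵛ x, f x ∂[B; l.withDensityᵥ h] = ∫ x, B (f x) (h x) ∂l := by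
  have : IsFiniteMeasure (l.withDensityᵥ h).variation := by
    rw [Measure.variation_withDensityᵥ hh]
    exact isFiniteMeasure_withDensity hh.2.ne
  refine Integrable.induction (P := fun f => ∫ᵛ x, f x ∂[B; l.withDensityᵥ h] =
    ∫ x, B (f x) (h x) ∂l) ?indicator ?add ?closed ?congr hf
  case indicator =>
    intro c s hs _
    rw [VectorMeasure.integral_indicator_const _ hs, withDensityᵥ_apply hh hs,
      ← ContinuousLinearMap.integral_comp_comm _ hh.integrableOn, ← integral_indicator hs]
    congr 1 with x
    by_cases hx : x ∈ s <;> simp [hx]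
  case add =>
    intro f g _ hf hg hfB hgB
    rw [VectorMeasure.integral_add hf hg, hfB, hgB,
      ← integral_add (integrable_bilin hh B hf) (integrable_bilin hh B hg)]
    simp
  case closed =>
    exact isClosed_eq VectorMeasure.continuous_integral (continuous_integral_bilin hh B)
  case congr =>
    intro f g hfg _ hfB
    rw [← VectorMeasure.integral_congr_ae hfg, hfB, integral_bilin_congr_ae hh B hfg]

end Integration

section Components

variable {d : ℕ} {X : Type*} [MeasurableSpace X]

/-- The `i`-th component of an `ℝ^d`-valued measure, as a signed measure. It has the shape in which
`vecDensity` presents components. -/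
def component (ν : VectorMeasure X (Vec d)) (i : Fin d) : SignedMeasure X :=
  ν.mapRange (EuclideanSpace.proj (𝕜 := ℝ) i).toLinearMap.toAddMonoidHom
    (EuclideanSpace.proj (𝕜 := ℝ) i).continuous

theorem component_apply (ν : VectorMeasure X (Vec d)) (i : Fin d) (s : Set X) :
    component ν i s = ν s i := rfl

theorem ext_component {ν ν' : VectorMeasure X (Vec d)} (h : ∀ i, component ν i = component ν' i) :
    ν = ν' := by
  ext s _ i
  rw [← component_apply, ← component_apply, h]

theorem variation_component_le (ν : VectorMeasure X (Vec d)) (i : Fin d) :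
    (component ν i).variation ≤ ν.variation :=
  VectorMeasure.variation_le_of_forall_enorm_le fun s _ =>
    (enorm_le_iff_norm_le.2 (PiLp.norm_apply_le (ν s) i)).trans (ν.enorm_measure_le_variation s)

theorem variation_le_sum_component (ν : VectorMeasure X (Vec d)) :
    ν.variation ≤ ∑ i, (component ν i).variation := by
  refine VectorMeasure.variation_le_of_forall_enorm_le fun s _ => ?_
  have hsum : ν s = ∑ i, EuclideanSpace.single i (ν s i) := by
    ext j
    simp [Finset.sum_apply, Pi.single_apply]
  rw [hsum, Measure.finsetSum_apply]
  refine (enorm_sum_le _ _).trans (Finset.sum_le_sum fun i _ => ?_)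
  refine le_trans (le_of_eq ?_) ((component ν i).enorm_measure_le_variation s)
  rw [component_apply, ← ofReal_norm, ← ofReal_norm, PiLp.norm_single]

instance isFiniteMeasure_variation_vec (ν : VectorMeasure X (Vec d)) :
    IsFiniteMeasure ν.variation :=
  isFiniteMeasure_of_le _ (variation_le_sum_component ν)

theorem integrable_vecDensity (ν : VectorMeasure X (Vec d)) (l : Measure X) :
    Integrable (vecDensity ν l) l :=
  Integrable.of_eval_piLp fun i => SignedMeasure.integrable_rnDeriv (component ν i) l

theorem measurable_vecDensity (ν : VectorMeasure X (Vec d)) (l : Measure X) :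
    Measurable (vecDensity ν l) :=
  (WithLp.measurable_toLp 2 _).comp
    (measurable_pi_lambda _ fun _ => SignedMeasure.measurable_rnDeriv _ _)

theorem component_withDensityᵥ {l : Measure X} {h : X → Vec d} (hh : Integrable h l) (i : Fin d) :
    component (l.withDensityᵥ h) i = l.withDensityᵥ fun x => h x i := by
  have hi : Integrable (fun x => h x i) l := (EuclideanSpace.proj (𝕜 := ℝ) i).integrable_comp hh
  ext s hs
  rw [component_apply, withDensityᵥ_apply hh hs, withDensityᵥ_apply hi hs]
  exact ((EuclideanSpace.proj (𝕜 := ℝ) i).integral_comp_comm hh.integrableOn).symm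

theorem withDensityᵥ_vecDensity (ν : VectorMeasure X (Vec d)) {l : Measure X} [SigmaFinite l]
    (h : ν.variation ≪ l) : l.withDensityᵥ (vecDensity ν l) = ν := by
  refine ext_component fun i => ?_
  rw [component_withDensityᵥ (integrable_vecDensity ν l)]
  exact withDensityᵥ_rnDeriv_of_variation_absolutelyContinuous _
    ((Measure.absolutelyContinuous_of_le (variation_component_le ν i)).trans h)

theorem withDensityᵥ_vecDensity_variation (ν : VectorMeasure X (Vec d)) :
    ν.variation.withDensityᵥ (vecDensity ν ν.variation) = ν :=
  withDensityᵥ_vecDensity ν Measure.AbsolutelyContinuous.rfl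

theorem integrable_component {E : Type*} [NormedAddCommGroup E] {ν : VectorMeasure X (Vec d)}
    {f : X → E} (hf : ν.Integrable f) (i : Fin d) : (component ν i).Integrable f :=
  hf.mono_measure (variation_component_le ν i)

theorem integral_eq_integral_bilin_vecDensity {E G : Type*} [NormedAddCommGroup E]
    [NormedSpace ℝ E] [NormedAddCommGroup G] [NormedSpace ℝ G] [CompleteSpace G]
    {ν : VectorMeasure X (Vec d)} (B : E →L[ℝ] Vec d →L[ℝ] G) {f : X → E} (hf : ν.Integrable f) :
    ∫ᵛ x, f x ∂[B; ν] = ∫ x, B (f x) (vecDensity ν ν.variation x) ∂ν.variation := by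
  have := integral_withDensityᵥ (integrable_vecDensity ν ν.variation) B (f := f)
  rw [withDensityᵥ_vecDensity_variation] at this
  exact this hf

theorem component_eq_withDensityᵥ (ν : VectorMeasure X (Vec d)) (i : Fin d) :
    component ν i = ν.variation.withDensityᵥ fun x => vecDensity ν ν.variation x i := by
  rw [← component_withDensityᵥ (integrable_vecDensity ν _), withDensityᵥ_vecDensity_variation]

theorem integrable_mul_vecDensity {ν : VectorMeasure X (Vec d)} {f : X → ℝ} (hf : ν.Integrable f)
    (i : Fin d) : Integrable (fun x => f x * vecDensity ν ν.variation x i) ν.variation := by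
  have hfi := integrable_component hf i
  rw [component_eq_withDensityᵥ] at hfi
  exact integrable_bilin ((integrable_vecDensity ν _).eval_piLp i)
    (ContinuousLinearMap.lsmul ℝ ℝ) hfi

theorem integral_component_eq_integral_mul {ν : VectorMeasure X (Vec d)} {f : X → ℝ}
    (hf : ν.Integrable f) (i : Fin d) :
    ∫ᵛ x, f x ∂•(component ν i) = ∫ x, f x * vecDensity ν ν.variation x i ∂ν.variation := by
  have hfi := integrable_component hf i
  have hdens := component_eq_withDensityᵥ ν i
  rw [hdens] at hfi ⊢
  exact integral_withDensityᵥ ((integrable_vecDensity ν _).eval_piLp i)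
    (ContinuousLinearMap.lsmul ℝ ℝ) hfi

theorem integral_component {ν : VectorMeasure X (Vec d)} {f : X → ℝ} (hf : ν.Integrable f)
    (i : Fin d) : (∫ᵛ x, f x ∂•ν) i = ∫ᵛ x, f x ∂•(component ν i) := by
  have hint : Integrable (fun x => f x • vecDensity ν ν.variation x) ν.variation :=
    Integrable.of_eval_piLp fun i => integrable_mul_vecDensity hf i
  rw [integral_component_eq_integral_mul hf, integral_eq_integral_bilin_vecDensity _ hf]
  exact ((EuclideanSpace.proj (𝕜 := ℝ) i).integral_comp_comm hint).symm

theorem integral_inner_eq_sum {ν : VectorMeasure X (Vec d)} {f : X → Vec d} (hf : ν.Integrable f) :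
    ∫ᵛ x, f x ∂[innerSL ℝ; ν] = ∑ i, ∫ᵛ x, f x i ∂•(component ν i) := by
  have hfi : ∀ i, ν.Integrable fun x => f x i := fun i =>
    (EuclideanSpace.proj (𝕜 := ℝ) i).integrable_comp hf
  simp_rw [integral_eq_integral_bilin_vecDensity _ hf,
    fun i => integral_component_eq_integral_mul (hfi i) i]
  rw [← integral_finsetSum _ fun i _ => integrable_mul_vecDensity (hfi i) i]
  refine integral_congr_ae (ae_of_all _ fun x => ?_)
  change inner ℝ (f x) (vecDensity ν ν.variation x) = _
  rw [PiLp.inner_apply]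
  exact Finset.sum_congr rfl fun i _ => mul_comm _ _

end Components

section RunMax

variable {X : Type*}

/-- The running maxima `max (0, f 0, …, f (N - 1))`. -/
def runMax (f : ℕ → X → ℝ) : ℕ → X → ℝ
  | 0 => fun _ => 0
  | N + 1 => fun x => max (runMax f N x) (f N x)

theorem runMax_nonneg (f : ℕ → X → ℝ) (N : ℕ) (x : X) : 0 ≤ runMax f N x := by
  induction N with
  | zero => exact le_rfl
  | succ N ih => exact ih.trans (le_max_left _ _)

theorem monotone_ofReal_runMax (f : ℕ → X → ℝ) :
    Monotone fun N x => ENNReal.ofReal (runMax f N x) :=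
  monotone_nat_of_le_succ fun _ _ => ENNReal.ofReal_le_ofReal (le_max_left _ _)

theorem iSup_ofReal_runMax (f : ℕ → X → ℝ) (x : X) :
    ⨆ N, ENNReal.ofReal (runMax f N x) = ⨆ k, ENNReal.ofReal (f k x) := by
  refine le_antisymm (iSup_le fun N => ?_) (iSup_le fun k => ?_)
  · induction N with
    | zero => simp [runMax]
    | succ N ih =>
      simp only [runMax, ENNReal.ofReal_max]
      exact max_le ih (le_iSup (fun k => ENNReal.ofReal (f k x)) N)
  · exact le_iSup_of_le (k + 1) (ENNReal.ofReal_le_ofReal (le_max_right _ _))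

variable [MeasurableSpace X] {f : ℕ → X → ℝ}

theorem measurable_runMax (hf : ∀ k, Measurable (f k)) (N : ℕ) : Measurable (runMax f N) := by
  induction N with
  | zero => exact measurable_const
  | succ N ih => exact ih.max (hf N)

theorem integrable_runMax {l : Measure X} (hf : ∀ k, Integrable (f k) l) (N : ℕ) :
    Integrable (runMax f N) l := by
  induction N with
  | zero => exact integrable_zero _ _ _
  | succ N ih => exact ih.sup (hf N)

theorem lintegral_iSup_ofReal {l : Measure X} (hf : ∀ k, Measurable (f k)) :
    ∫⁻ x, ⨆ k, ENNReal.ofReal (f k x) ∂l = ⨆ N, ∫⁻ x, ENNReal.ofReal (runMax f N x) ∂l := by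
  rw [← lintegral_congr (iSup_ofReal_runMax f)]
  exact lintegral_iSup (fun N => (measurable_runMax hf N).ennreal_ofReal)
    (monotone_ofReal_runMax f)

end RunMax

section Weights

variable {X : Type*} [TopologicalSpace X] {N : ℕ}

/-- Subpartitions of unity: `N` continuous non-negative weights with sum at most one. They allow to
recover, in the limit, the pointwise maximum of `N` functions and `0`, see
`exists_weights_tendsto_runMax`. -/
abbrev Weights (X : Type*) [TopologicalSpace X] (N : ℕ) : Type _ :=
  {φ : Fin N → C(X, ℝ) // (∀ k x, 0 ≤ φ k x) ∧ ∀ x, ∑ k, φ k x ≤ 1}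

instance nonempty_weights (N : ℕ) : Nonempty (Weights X N) := ⟨⟨0, by simp⟩⟩

theorem weights_le_one (φ : Weights X N) (k : Fin N) (x : X) : φ.1 k x ≤ 1 :=
  (Finset.single_le_sum (f := fun k => φ.1 k x) (fun k _ => φ.2.1 k x) (Finset.mem_univ k)).trans
    (φ.2.2 x)

theorem sum_weights_mul_le {f : ℕ → X → ℝ} (φ : Weights X N) (x : X) :
    ENNReal.ofReal (∑ k, φ.1 k x * f k x) ≤ ⨆ k, ENNReal.ofReal (f k x) := by
  by_cases htop : ⨆ k, ENNReal.ofReal (f k x) = ∞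
  · rw [htop]; exact le_top
  refine ENNReal.ofReal_le_of_le_toReal ?_
  set s := (⨆ k, ENNReal.ofReal (f k x)).toReal
  have hs : ∀ k, f k x ≤ s := fun k =>
    (ENNReal.ofReal_le_iff_le_toReal htop).1 (le_iSup (fun k => ENNReal.ofReal (f k x)) k)
  calc ∑ k, φ.1 k x * f k x ≤ ∑ k, φ.1 k x * s :=
        Finset.sum_le_sum fun k _ => mul_le_mul_of_nonneg_left (hs k) (φ.2.1 k x)
    _ = (∑ k, φ.1 k x) * s := by rw [Finset.sum_mul]
    _ ≤ s := mul_le_of_le_one_left ENNReal.toReal_nonneg (φ.2.2 x)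

theorem sum_snoc_mul (ψ : C(X, ℝ)) (φ : Fin N → C(X, ℝ)) (u : ℕ → ℝ) (x : X) :
    ∑ k : Fin (N + 1), (Fin.snoc (α := fun _ => C(X, ℝ)) (fun k => (1 - ψ) * φ k) ψ k) x * u k =
      (1 - ψ x) * ∑ k : Fin N, φ k x * u k + ψ x * u N := by
  rw [Fin.sum_univ_castSucc, Finset.mul_sum]
  simp [mul_assoc]

/-- The weights `φ`, scaled by `1 - ψ`, followed by the weight `ψ`. -/
def snocWeights (ψ : C(X, ℝ)) (hψ0 : ∀ x, 0 ≤ ψ x) (hψ1 : ∀ x, ψ x ≤ 1) (φ : Weights X N) :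
    Weights X (N + 1) :=
  ⟨Fin.snoc (α := fun _ => C(X, ℝ)) (fun k => (1 - ψ) * φ.1 k) ψ, fun k x => by
    induction k using Fin.lastCases with
    | last => simpa using hψ0 x
    | cast k =>
      rw [Fin.snoc_castSucc]
      exact mul_nonneg (by simpa using hψ1 x) (φ.2.1 k x), fun x => by
    have hsum := sum_snoc_mul ψ φ.1 1 x
    simp only [Pi.one_apply, mul_one] at hsum
    rw [hsum]
    nlinarith [φ.2.2 x, hψ1 x, hψ0 x]⟩

end Weights

section Duality

theorem le_iSup_of_denseRange {Y ι : Type*} [TopologicalSpace Y] {e : ι → Y} (he : DenseRange e)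
    {F : Y → ℝ≥0∞} (hF : Continuous F) (y : Y) : F y ≤ ⨆ k, F (e k) :=
  (isClosed_le hF continuous_const).closure_subset_iff.2
    (range_subset_iff.2 fun k => le_iSup (fun k => F (e k)) k) (he y)

theorem ofReal_integral_le_lintegral {X : Type*} [MeasurableSpace X] {l : Measure X} (f : X → ℝ) :
    ENNReal.ofReal (∫ x, f x ∂l) ≤ ∫⁻ x, ENNReal.ofReal (f x) ∂l := by
  by_cases hf : Integrable f l
  · calc ENNReal.ofReal (∫ x, f x ∂l) ≤ ENNReal.ofReal (∫ x, max (f x) 0 ∂l) :=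
          ENNReal.ofReal_le_ofReal (integral_mono hf hf.pos_part fun x => le_max_left _ _)
      _ = ∫⁻ x, ENNReal.ofReal (max (f x) 0) ∂l :=
          ofReal_integral_eq_lintegral_ofReal hf.pos_part (ae_of_all _ fun x => le_max_right _ _)
      _ = _ := by simp
  · simp [integral_undef hf]

variable {X : Type*} [MetricSpace X] [MeasurableSpace X] [BorelSpace X] {l : Measure X}
  {f : ℕ → X → ℝ}

theorem exists_seq_continuousMap_tendsto_indicator (l : Measure X) [IsFiniteMeasure l]
    {B : Set X} (hB : MeasurableSet B) :
    ∃ ψ : ℕ → C(X, ℝ), (∀ n x, 0 ≤ ψ n x) ∧ (∀ n x, ψ n x ≤ 1) ∧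
      ∀ᵐ x ∂l, Tendsto (fun n => ψ n x) atTop (𝓝 (B.indicator 1 x)) := by
  have hmem : MemLp (B.indicator (1 : X → ℝ)) 1 l :=
    memLp_indicator_const 1 hB (1 : ℝ) (Or.inr (measure_ne_top _ _))
  have hex : ∀ n : ℕ, ∃ g : BoundedContinuousFunction X ℝ,
      eLpNorm (B.indicator (1 : X → ℝ) - ⇑g) 1 l ≤ ENNReal.ofReal (1 / (n + 1)) ∧ MemLp g 1 l :=
    fun n => hmem.exists_boundedContinuous_eLpNorm_sub_le ENNReal.one_ne_top
      (ENNReal.ofReal_pos.2 Nat.one_div_pos_of_nat).ne'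
  choose g hg hgm using hex
  have hL : Tendsto (fun n => eLpNorm (⇑(g n) - B.indicator (1 : X → ℝ)) 1 l) atTop (𝓝 0) := by
    have h0 := ENNReal.tendsto_ofReal (tendsto_one_div_add_atTop_nhds_zero_nat (𝕜 := ℝ))
    rw [ENNReal.ofReal_zero] at h0
    refine tendsto_of_tendsto_of_tendsto_of_le_of_le tendsto_const_nhds h0 (fun _ => zero_le)
      fun n => ?_
    rw [eLpNorm_sub_comm]
    exact hg n
  obtain ⟨ns, -, hns⟩ := (tendstoInMeasure_of_tendsto_eLpNorm one_ne_zero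
    (fun n => (hgm n).1) hmem.1 hL).exists_seq_tendsto_ae
  refine ⟨fun n => ⟨fun x => max 0 (min 1 (g (ns n) x)), by fun_prop⟩, fun n x => le_max_left _ _,
    fun n x => max_le zero_le_one (min_le_left _ _), ?_⟩
  filter_upwards [hns] with x hx
  have hclamp : Continuous fun y : ℝ => max 0 (min 1 y) := by fun_prop
  refine ((hclamp.tendsto _).comp hx).trans (le_of_eq ?_)
  by_cases hxB : x ∈ B <;> simp [hxB]

theorem exists_weights_tendsto_runMax (l : Measure X) [IsFiniteMeasure l]
    (hf : ∀ k, Measurable (f k)) (N : ℕ) :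
    ∃ φ : ℕ → Weights X N, ∀ᵐ x ∂l,
      Tendsto (fun j => ∑ k, (φ j).1 k x * f k x) atTop (𝓝 (runMax f N x)) := by
  induction N with
  | zero => exact ⟨fun _ => ⟨0, by simp⟩, ae_of_all _ fun x => by simp [runMax]⟩
  | succ N ih =>
    obtain ⟨φ, hφ⟩ := ih
    obtain ⟨ψ, hψ0, hψ1, hψ⟩ := exists_seq_continuousMap_tendsto_indicator l
      (measurableSet_lt (measurable_runMax hf N) (hf N))
    refine ⟨fun j => snocWeights (ψ j) (hψ0 j) (hψ1 j) (φ j), ?_⟩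
    filter_upwards [hφ, hψ] with x hφx hψx
    simp_rw [snocWeights, sum_snoc_mul _ _ fun k => f k x]
    refine (((hψx.const_sub 1).mul hφx).add (hψx.mul_const (f N x))).trans (le_of_eq ?_)
    by_cases hx : runMax f N x < f N x
    · simp [runMax, hx, hx.le]
    · simp [runMax, hx, not_lt.1 hx]

variable [CompactSpace X]

theorem integrable_continuousMap_mul {f : X → ℝ} (hf : Integrable f l) (φ : C(X, ℝ)) :
    Integrable (fun x => φ x * f x) l :=
  hf.bdd_mul φ.continuous.measurable.aestronglyMeasurable
    (ae_of_all _ fun x => φ.norm_coe_le_norm x)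

theorem integral_sum_continuousMap_mul (hf : ∀ k, Integrable (f k) l) {N : ℕ}
    (φ : Fin N → C(X, ℝ)) :
    ∫ x, ∑ k, φ k x * f k x ∂l = ∑ k, ∫ x, φ k x * f k x ∂l :=
  integral_finsetSum _ fun k _ => integrable_continuousMap_mul (hf k) (φ k)

theorem lintegral_iSup_le_of_weights_of_measurable [IsFiniteMeasure l]
    (hfm : ∀ k, Measurable (f k)) (hf : ∀ k, Integrable (f k) l) {M : ℝ≥0∞}
    (H : ∀ (N : ℕ) (φ : Weights X N), ENNReal.ofReal (∑ k, ∫ x, φ.1 k x * f k x ∂l) ≤ M) :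
    ∫⁻ x, ⨆ k, ENNReal.ofReal (f k x) ∂l ≤ M := by
  rw [lintegral_iSup_ofReal hfm]
  refine iSup_le fun N => ?_
  rw [← ofReal_integral_eq_lintegral_ofReal (integrable_runMax hf N)
    (ae_of_all _ fun x => runMax_nonneg f N x)]
  obtain ⟨φ, hφ⟩ := exists_weights_tendsto_runMax l hfm N
  have hlim : Tendsto (fun j => ∫ x, ∑ k, (φ j).1 k x * f k x ∂l) atTop
      (𝓝 (∫ x, runMax f N x ∂l)) := by
    refine tendsto_integral_of_dominated_convergence (fun x => ∑ k : Fin N, |f k x|)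
      (fun j => (integrable_finsetSum _ fun (k : Fin N) _ =>
        integrable_continuousMap_mul (hf k) ((φ j).1 k)).1)
      (integrable_finsetSum _ fun k _ => (hf k).abs)
      (fun j => ae_of_all _ fun x => (norm_sum_le _ _).trans
        (Finset.sum_le_sum fun k _ => ?_)) hφ
    rw [norm_mul, Real.norm_eq_abs, Real.norm_eq_abs, abs_of_nonneg ((φ j).2.1 k x)]
    exact mul_le_of_le_one_left (abs_nonneg _) (weights_le_one _ _ _)
  refine le_of_tendsto (ENNReal.tendsto_ofReal hlim) (Eventually.of_forall fun j => ?_)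
  rw [integral_sum_continuousMap_mul hf]
  exact H N (φ j)

theorem lintegral_iSup_le_of_weights [IsFiniteMeasure l] (hf : ∀ k, Integrable (f k) l) {M : ℝ≥0∞}
    (H : ∀ (N : ℕ) (φ : Weights X N), ENNReal.ofReal (∑ k, ∫ x, φ.1 k x * f k x ∂l) ≤ M) :
    ∫⁻ x, ⨆ k, ENNReal.ofReal (f k x) ∂l ≤ M := by
  have hmk : ∀ k, f k =ᵐ[l] (hf k).1.mk := fun k => (hf k).1.ae_eq_mk
  calc ∫⁻ x, ⨆ k, ENNReal.ofReal (f k x) ∂l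
      = ∫⁻ x, ⨆ k, ENNReal.ofReal ((hf k).1.mk _ x) ∂l := by
        refine lintegral_congr_ae ?_
        filter_upwards [ae_all_iff.2 hmk] with x hx
        simp only [hx]
    _ ≤ M := by
        refine lintegral_iSup_le_of_weights_of_measurable
          (fun k => (hf k).1.stronglyMeasurable_mk.measurable)
          (fun k => (hf k).congr (hmk k)) fun N φ => ?_
        have hcongr : ∀ k : Fin N, ∫ x, φ.1 k x * (hf k).1.mk _ x ∂l =
            ∫ x, φ.1 k x * f k x ∂l := fun k =>
          integral_congr_ae ((hmk k).mono fun x hx => congrArg (φ.1 k x * ·) hx.symm)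
        simpa only [hcongr] using H N φ

theorem sum_integral_weights_le (hf : ∀ k, Integrable (f k) l) {N : ℕ} (φ : Weights X N) :
    ENNReal.ofReal (∑ k, ∫ x, φ.1 k x * f k x ∂l) ≤ ∫⁻ x, ⨆ k, ENNReal.ofReal (f k x) ∂l := by
  rw [← integral_sum_continuousMap_mul hf]
  exact (ofReal_integral_le_lintegral _).trans (lintegral_mono fun x => sum_weights_mul_le φ x)

theorem continuous_integral_continuousMap_mul {f : X → ℝ} (hf : Integrable f l) :
    Continuous fun φ : C(X, ℝ) => ∫ x, φ x * f x ∂l := by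
  refine (LipschitzWith.of_dist_le_mul (K := (∫ x, |f x| ∂l).toNNReal) fun φ ψ => ?_).continuous
  rw [dist_eq_norm, ← integral_sub (integrable_continuousMap_mul hf _)
    (integrable_continuousMap_mul hf _),
    Real.coe_toNNReal _ (integral_nonneg fun _ => abs_nonneg _), mul_comm, ← integral_const_mul]
  refine norm_integral_le_of_norm_le (hf.abs.const_mul _) (ae_of_all _ fun x => ?_)
  rw [← sub_mul, norm_mul, ← dist_eq_norm]
  exact mul_le_mul_of_nonneg_right (ContinuousMap.dist_apply_le_dist x) (norm_nonneg _)

/-- A countable dense family of weights, over which suprema are taken in `lintegral_iSup_eq`. -/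
def denseWeights (X : Type*) [MetricSpace X] [CompactSpace X] (N : ℕ) : ℕ → Weights X N :=
  TopologicalSpace.denseSeq (Weights X N)

theorem lintegral_iSup_eq [IsFiniteMeasure l] (hf : ∀ k, Integrable (f k) l) :
    ∫⁻ x, ⨆ k, ENNReal.ofReal (f k x) ∂l =
      ⨆ N, ⨆ j, ENNReal.ofReal (∑ k, ∫ x, (denseWeights X N j).1 k x * f k x ∂l) := by
  refine le_antisymm (lintegral_iSup_le_of_weights hf fun N φ => ?_)
    (iSup₂_le fun N j => sum_integral_weights_le hf _)
  have hcont : Continuous fun φ : Weights X N =>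
      ENNReal.ofReal (∑ k, ∫ x, φ.1 k x * f k x ∂l) :=
    ENNReal.continuous_ofReal.comp (continuous_finsetSum _ fun k _ =>
      (continuous_integral_continuousMap_mul (hf k)).comp
        ((continuous_apply k).comp continuous_subtype_val))
  exact le_iSup_of_le N (le_iSup_of_denseRange (TopologicalSpace.denseRange_denseSeq _) hcont φ)

theorem lintegral_iSup_add_eq {p : Measure X} [IsFiniteMeasure l] [IsFiniteMeasure p]
    (hpl : p ⟂ₘ l) {g : ℕ → X → ℝ} (hf : ∀ k, Integrable (f k) l)
    (hg : ∀ k, Integrable (g k) p) :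
    ∫⁻ x, ⨆ k, ENNReal.ofReal (f k x) ∂l + ∫⁻ x, ⨆ k, ENNReal.ofReal (g k x) ∂p =
      ⨆ N, ⨆ j, ENNReal.ofReal (∑ k, (∫ x, (denseWeights X N j).1 k x * f k x ∂l
        + ∫ x, (denseWeights X N j).1 k x * g k x ∂p)) := by
  classical
  obtain ⟨s, -, hps, hls⟩ := hpl
  have hl : ∀ᵐ x ∂l, x ∈ s := ae_iff.2 hls
  have hp : ∀ᵐ x ∂p, x ∉ s := ae_iff.2 (by simpa using hps)
  -- By mutual singularity, both integrals are integrals of one family against `l + p`.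
  let h : ℕ → X → ℝ := fun k => s.piecewise (f k) (g k)
  have hhf : ∀ᵐ x ∂l, ∀ k, h k x = f k x :=
    hl.mono fun x hx k => piecewise_eq_of_mem _ _ _ hx
  have hhg : ∀ᵐ x ∂p, ∀ k, h k x = g k x :=
    hp.mono fun x hx k => piecewise_eq_of_notMem _ _ _ hx
  have hhl : ∀ k, Integrable (h k) l := fun k => (hf k).congr (hhf.mono fun x hx => (hx k).symm)
  have hhp : ∀ k, Integrable (h k) p := fun k => (hg k).congr (hhg.mono fun x hx => (hx k).symm)
  calc _ = ∫⁻ x, ⨆ k, ENNReal.ofReal (h k x) ∂(l + p) := by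
        rw [lintegral_add_measure]
        congr 1
        · exact lintegral_congr_ae (hhf.mono fun x hx => by simp_rw [hx])
        · exact lintegral_congr_ae (hhg.mono fun x hx => by simp_rw [hx])
    _ = _ := lintegral_iSup_eq fun k => (hhl k).add_measure (hhp k)
    _ = _ := by
        congr! 6 with N j k
        rw [integral_add_measure (integrable_continuousMap_mul (hhl _) _)
          (integrable_continuousMap_mul (hhp _) _)]
        congr 1
        · exact integral_congr_ae (hhf.mono fun x hx => by simp only [hx])
        · exact integral_congr_ae (hhg.mono fun x hx => by simp only [hx])

end Duality

section Integrands

theorem two_inner_sub_le {E : Type*} [NormedAddCommGroup E] [InnerProductSpace ℝ E] {u : ℝ}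
    (hu : 0 < u) (b m : E) : 2 * inner ℝ b m - ‖b‖ ^ 2 * u ≤ ‖m‖ ^ 2 / u := by
  rw [le_div_iff₀ hu]
  have hsq := norm_sub_sq_real m (u • b)
  rw [inner_smul_right, norm_smul, Real.norm_eq_abs, abs_of_pos hu, real_inner_comm] at hsq
  nlinarith [sq_nonneg ‖m - u • b‖]

theorem Phi_eq_iSup {d : ℕ} {u : ℝ} (hu : 0 ≤ u) (m : Vec d) :
    Phi u m = ⨆ k : ℕ, ENNReal.ofReal (2 * inner ℝ (TopologicalSpace.denseSeq (Vec d) k) m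
      - ‖TopologicalSpace.denseSeq (Vec d) k‖ ^ 2 * u) := by
  have hcont : Continuous fun b : Vec d => ENNReal.ofReal (2 * inner ℝ b m - ‖b‖ ^ 2 * u) :=
    ENNReal.continuous_ofReal.comp (by fun_prop)
  have hle := le_iSup_of_denseRange (TopologicalSpace.denseRange_denseSeq (Vec d)) hcont
  unfold Phi
  split_ifs with hpos hzero
  · refine le_antisymm ?_ (iSup_le fun k => ENNReal.ofReal_le_ofReal (two_inner_sub_le hpos _ _))
    refine (ENNReal.ofReal_le_ofReal (le_of_eq ?_)).trans (hle (u⁻¹ • m))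
    rw [real_inner_smul_left, real_inner_self_eq_norm_sq, norm_smul, Real.norm_eq_abs,
      abs_of_pos (inv_pos.2 hpos)]
    field_simp
    ring
  · obtain ⟨rfl, rfl⟩ := hzero
    simp
  · obtain rfl : u = 0 := le_antisymm (not_lt.1 hpos) hu
    have hm : ‖m‖ ^ 2 ≠ 0 := pow_ne_zero _ (norm_ne_zero_iff.2 fun h => hzero ⟨rfl, h⟩)
    refine (ENNReal.eq_top_of_forall_nnreal_le fun c => ?_).symm
    refine le_trans ?_ (hle (((c : ℝ) / ‖m‖ ^ 2) • m))
    rw [real_inner_smul_left, real_inner_self_eq_norm_sq, div_mul_cancel₀ _ hm, mul_zero,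
      sub_zero, ← ENNReal.ofReal_coe_nnreal]
    exact ENNReal.ofReal_le_ofReal (by linarith [c.coe_nonneg])

variable {r : ℝ → ℝ}

theorem continuous_of_convexOn_univ (hr : ConvexOn ℝ univ r) : Continuous r :=
  continuousOn_univ.1 (hr.continuousOn isOpen_univ)

theorem exists_iSup_affine_eq (hr : ConvexOn ℝ univ r) :
    ∃ p q : ℕ → ℝ, (∀ k s, p k * s - q k ≤ r s) ∧
      ∀ s, ENNReal.ofReal (r s) = ⨆ k, ENNReal.ofReal (p k * s - q k) := by
  obtain ⟨L, c, hle, hsup⟩ := hr.real_univ_sSup_of_nat_affine_eq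
    (continuous_of_convexOn_univ hr).lowerSemicontinuous
  have haff : ∀ k s, (⇑(L k) + Function.const ℝ (c k)) s = L k 1 * s - -c k := fun k s => by
    rw [mul_comm, ← smul_eq_mul, ← map_smul, smul_eq_mul, mul_one, sub_neg_eq_add]
    rfl
  have hle' : ∀ k s, L k 1 * s - -c k ≤ r s := fun k s => haff k s ▸ hle k s
  refine ⟨fun k => L k 1, fun k => -c k, hle', fun s => ?_⟩
  rw [← hsup, iSup_apply]
  simp_rw [haff]
  exact Monotone.map_ciSup_of_continuousAt ENNReal.continuous_ofReal.continuousAt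
    (fun _ _ => ENNReal.ofReal_le_ofReal) ⟨r s, forall_mem_range.2 fun k => hle' k s⟩

theorem recession_eq_iSup_slope {p q : ℕ → ℝ} (hq : ∀ k, 0 ≤ q k)
    (hr : ∀ s, ENNReal.ofReal (r s) = ⨆ k, ENNReal.ofReal (p k * s - q k)) (y : ℝ) :
    recession r y = ⨆ k, ENNReal.ofReal (p k * y) := by
  refine le_antisymm (iSup₂_le fun s hs => ?_) (iSup_le fun k => ?_)
  · rw [ENNReal.ofReal_div_of_pos hs, hr]
    refine ENNReal.div_le_of_le_mul (iSup_le fun k => ?_)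
    calc ENNReal.ofReal (p k * (s * y) - q k) ≤ ENNReal.ofReal (p k * y * s) :=
          ENNReal.ofReal_le_ofReal (by linarith [hq k])
      _ = ENNReal.ofReal (p k * y) * ENNReal.ofReal s := ENNReal.ofReal_mul' hs.le
      _ ≤ _ := by
          gcongr
          exact le_iSup (fun k => ENNReal.ofReal (p k * y)) k
  · have hlim : Tendsto (fun s : ℝ => p k * y - q k / s) atTop (𝓝 (p k * y - 0)) :=
      tendsto_const_nhds.sub (tendsto_const_nhds.div_atTop tendsto_id)
    rw [sub_zero] at hlim
    refine le_of_tendsto (ENNReal.tendsto_ofReal hlim) ?_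
    filter_upwards [eventually_gt_atTop 0] with s hs
    calc ENNReal.ofReal (p k * y - q k / s) = ENNReal.ofReal (p k * (s * y) - q k) /
          ENNReal.ofReal s := by
          rw [← ENNReal.ofReal_div_of_pos hs]
          congr 1
          field_simp
      _ ≤ ENNReal.ofReal (r (s * y)) / ENNReal.ofReal s := by
          rw [hr]
          gcongr
          exact le_iSup (fun k => ENNReal.ofReal (p k * (s * y) - q k)) k
      _ = ENNReal.ofReal (r (s * y) / s) := (ENNReal.ofReal_div_of_pos hs).symm
      _ ≤ _ := le_iSup₂ (f := fun (s : ℝ) (_ : 0 < s) => ENNReal.ofReal (r (s * y) / s)) s hs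

theorem exists_iSup_affine_eq_recession (hr : ConvexOn ℝ univ r) (h0 : r 0 = 0) :
    ∃ p q : ℕ → ℝ, (∀ s, ENNReal.ofReal (r s) = ⨆ k, ENNReal.ofReal (p k * s - q k)) ∧
      ∀ y, recession r y = ⨆ k, ENNReal.ofReal (p k * y) := by
  obtain ⟨p, q, hle, hsup⟩ := exists_iSup_affine_eq hr
  exact ⟨p, q, hsup, recession_eq_iSup_slope (fun k => by linarith [hle k 0]) hsup⟩

end Integrands

section Decompositions

variable {d : ℕ} {X : Type*} [MeasurableSpace X]

theorem mutuallySingular_variation_singularPart (τ : SignedMeasure X) (l : Measure X) :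
    (τ.singularPart l).variation ⟂ₘ l := by
  rw [← SignedMeasure.totalVariation_eq_variation, SignedMeasure.singularPart_totalVariation]
  exact (Measure.mutuallySingular_singularPart _ _).add_left
    (Measure.mutuallySingular_singularPart _ _)

theorem component_vecSingularPart (ν : VectorMeasure X (Vec d)) (l : Measure X) [SigmaFinite l]
    (i : Fin d) : component (vecSingularPart ν l) i = (component ν i).singularPart l := by
  have hsub : component (vecSingularPart ν l) i =
      component ν i - component (l.withDensityᵥ (vecDensity ν l)) i := by
    ext s _
    simp [component_apply, vecSingularPart]
  rw [hsub, component_withDensityᵥ (integrable_vecDensity ν l)]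
  exact sub_eq_of_eq_add ((component ν i).singularPart_add_withDensity_rnDeriv_eq l).symm

theorem mutuallySingular_variation_vecSingularPart (ν : VectorMeasure X (Vec d)) (l : Measure X)
    [SigmaFinite l] : (vecSingularPart ν l).variation ⟂ₘ l := by
  refine Measure.MutuallySingular.mono ?_ (variation_le_sum_component _) le_rfl
  rw [← Measure.sum_fintype, Measure.MutuallySingular.sum_left]
  intro i
  rw [component_vecSingularPart]
  exact mutuallySingular_variation_singularPart _ _

variable (l : Measure X) (μ : FiniteMeasure X) (ν : VectorMeasure X (Vec d)) (ζ : SignedMeasure X)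

instance isFiniteMeasure_perp : IsFiniteMeasure (perp l μ ν ζ) := by
  unfold perp; infer_instance

theorem mutuallySingular_perp [SigmaFinite l] : perp l μ ν ζ ⟂ₘ l :=
  ((Measure.mutuallySingular_singularPart _ _).add_left
    (mutuallySingular_variation_vecSingularPart ν l)).add_left
    (mutuallySingular_variation_singularPart ζ l)

theorem singularPart_mass_le_perp : (μ : Measure X).singularPart l ≤ perp l μ ν ζ := by
  unfold perp
  rw [add_assoc]
  exact Measure.le_add_right le_rfl

theorem variation_vecSingularPart_le_perp : (vecSingularPart ν l).variation ≤ perp l μ ν ζ := by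
  unfold perp
  rw [add_right_comm]
  exact Measure.le_add_left le_rfl

theorem variation_singularPart_le_perp : (ζ.singularPart l).variation ≤ perp l μ ν ζ :=
  Measure.le_add_left le_rfl

end Decompositions

section DecompositionIntegrals

variable {d : ℕ} {X : Type*} [MetricSpace X] [CompactSpace X] [MeasurableSpace X] [BorelSpace X]
  {l p : Measure X}

theorem integrable_continuousMap {E : Type*} [NormedAddCommGroup E] [IsFiniteMeasure l]
    (f : C(X, E)) : Integrable f l :=
  Integrable.of_bound f.continuous.aestronglyMeasurable ‖f‖ (ae_of_all _ f.norm_coe_le_norm)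

variable [SigmaFinite p]

theorem integral_mass_eq_integral_density_add [SigmaFinite l] (μ : FiniteMeasure X)
    (hp : (μ : Measure X).singularPart l ≤ p) (f : C(X, ℝ)) :
    ∫ x, f x ∂(μ : Measure X) = ∫ x, f x * ((μ : Measure X).rnDeriv l x).toReal ∂l
      + ∫ x, f x * (((μ : Measure X).singularPart l).rnDeriv p x).toReal ∂p := by
  have hac : ∫ x, f x * ((μ : Measure X).rnDeriv l x).toReal ∂l =
      ∫ x, f x ∂(l.withDensity ((μ : Measure X).rnDeriv l)) := by
    rw [integral_withDensity_eq_integral_toReal_smul (Measure.measurable_rnDeriv _ _)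
      (Measure.rnDeriv_lt_top _ _)]
    simp only [smul_eq_mul, mul_comm]
  have hsing : ∫ x, f x * (((μ : Measure X).singularPart l).rnDeriv p x).toReal ∂p =
      ∫ x, f x ∂((μ : Measure X).singularPart l) := by
    rw [← integral_rnDeriv_smul (Measure.absolutelyContinuous_of_le hp)]
    simp only [smul_eq_mul, mul_comm]
  rw [hac, hsing, ← integral_add_measure (integrable_continuousMap f) (integrable_continuousMap f),
    add_comm, Measure.singularPart_add_rnDeriv]

theorem integral_momentum_eq_integral_density_add (ν : VectorMeasure X (Vec d))
    (hp : (vecSingularPart ν l).variation ≤ p) (f : C(X, Vec d)) :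
    ∫ᵛ x, f x ∂[innerSL ℝ; ν] = ∫ x, inner ℝ (f x) (vecDensity ν l x) ∂l
      + ∫ x, inner ℝ (f x) (vecDensity (vecSingularPart ν l) p x) ∂p := by
  have hf : ∀ ν : VectorMeasure X (Vec d), ν.Integrable f := fun _ => integrable_continuousMap f
  have hac : ∫ᵛ x, f x ∂[innerSL ℝ; l.withDensityᵥ (vecDensity ν l)] =
      ∫ x, inner ℝ (f x) (vecDensity ν l x) ∂l :=
    integral_withDensityᵥ (integrable_vecDensity ν l) (innerSL ℝ) (hf _)
  have hsing : ∫ᵛ x, f x ∂[innerSL ℝ; vecSingularPart ν l] =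
      ∫ x, inner ℝ (f x) (vecDensity (vecSingularPart ν l) p x) ∂p := by
    conv_lhs => rw [← withDensityᵥ_vecDensity _ (Measure.absolutelyContinuous_of_le hp)]
    exact integral_withDensityᵥ (integrable_vecDensity (vecSingularPart ν l) p) (innerSL ℝ) (hf _)
  rw [← hac, ← hsing, ← VectorMeasure.integral_add_vectorMeasure (hf _) (hf _), vecSingularPart,
    add_sub_cancel]

theorem integral_source_eq_integral_density_add [SigmaFinite l] (ζ : SignedMeasure X)
    (hp : (ζ.singularPart l).variation ≤ p) (f : C(X, ℝ)) :
    ∫ᵛ x, f x ∂•ζ = ∫ x, f x * ζ.rnDeriv l x ∂l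
      + ∫ x, f x * (ζ.singularPart l).rnDeriv p x ∂p := by
  have hf : ∀ ζ : SignedMeasure X, ζ.Integrable f := fun _ => integrable_continuousMap f
  have hac := integral_withDensityᵥ (ζ.integrable_rnDeriv l) (ContinuousLinearMap.lsmul ℝ ℝ) (hf _)
  have hsing := integral_withDensityᵥ ((ζ.singularPart l).integrable_rnDeriv p)
    (ContinuousLinearMap.lsmul ℝ ℝ) (hf _)
  rw [withDensityᵥ_rnDeriv_of_variation_absolutelyContinuous _
    (Measure.absolutelyContinuous_of_le hp)] at hsing
  simp only [ContinuousLinearMap.lsmul_apply, smul_eq_mul] at hac hsing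
  rw [← hac, ← hsing, ← VectorMeasure.integral_add_vectorMeasure (hf _) (hf _), add_comm,
    SignedMeasure.singularPart_add_withDensity_rnDeriv_eq]

end DecompositionIntegrals

section Pairing

variable {d : ℕ} {X : Type*}

/-- The values `(m, u, z)` of momentum, mass and source densities; also the values of the test
fields which are paired with such densities. -/
abbrev Coeff (d : ℕ) : Type := Vec d × ℝ × ℝ

/-- The standard scalar product of `ℝ^d × ℝ × ℝ`, whose product topology is not Euclidean. -/
def dot (d : ℕ) : Coeff d →L[ℝ] Coeff d →L[ℝ] ℝ :=
  let m := ContinuousLinearMap.fst ℝ (Vec d) (ℝ × ℝ)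
  let u := (ContinuousLinearMap.fst ℝ ℝ ℝ).comp (ContinuousLinearMap.snd ℝ (Vec d) (ℝ × ℝ))
  let z := (ContinuousLinearMap.snd ℝ ℝ ℝ).comp (ContinuousLinearMap.snd ℝ (Vec d) (ℝ × ℝ))
  let inn : Vec d →L[ℝ] Vec d →L[ℝ] ℝ := innerSL ℝ
  inn.bilinearComp m m + (ContinuousLinearMap.mul ℝ ℝ).bilinearComp u u
    + (ContinuousLinearMap.mul ℝ ℝ).bilinearComp z z

theorem dot_apply (c v : Coeff d) :
    dot d c v = inner ℝ c.1 v.1 + c.2.1 * v.2.1 + c.2.2 * v.2.2 := rfl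

/-- The densities of the absolutely continuous parts of momentum, mass and source. -/
def acDensity [MeasurableSpace X] (l : Measure X) (μ : FiniteMeasure X)
    (ν : VectorMeasure X (Vec d)) (ζ : SignedMeasure X) (x : X) : Coeff d :=
  (vecDensity ν l x, ((μ : Measure X).rnDeriv l x).toReal, ζ.rnDeriv l x)

/-- The densities of the singular parts of momentum, mass and source with respect to `perp`. -/
def singDensity [MeasurableSpace X] (l : Measure X) (μ : FiniteMeasure X)
    (ν : VectorMeasure X (Vec d)) (ζ : SignedMeasure X) (x : X) : Coeff d :=
  (vecDensity (vecSingularPart ν l) (perp l μ ν ζ) x,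
    (((μ : Measure X).singularPart l).rnDeriv (perp l μ ν ζ) x).toReal,
    (ζ.singularPart l).rnDeriv (perp l μ ν ζ) x)

section Densities

variable [MeasurableSpace X] (l : Measure X) (μ : FiniteMeasure X) (ν : VectorMeasure X (Vec d))
  (ζ : SignedMeasure X)

theorem integrable_acDensity : Integrable (acDensity l μ ν ζ) l :=
  (integrable_vecDensity _ _).prodMk
    (Measure.integrable_toReal_rnDeriv.prodMk (SignedMeasure.integrable_rnDeriv _ _))

theorem integrable_singDensity : Integrable (singDensity l μ ν ζ) (perp l μ ν ζ) :=
  (integrable_vecDensity _ _).prodMk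
    (Measure.integrable_toReal_rnDeriv.prodMk (SignedMeasure.integrable_rnDeriv _ _))

end Densities

variable [MetricSpace X] [CompactSpace X] [MeasurableSpace X] [BorelSpace X]

/-- The duality pairing of a momentum, a mass and a source with continuous test fields. -/
def pairing (μ : FiniteMeasure X) (ν : VectorMeasure X (Vec d)) (ζ : SignedMeasure X) :
    C(X, Coeff d) →ₗ[ℝ] ℝ where
  toFun L := ∫ᵛ x, (L x).1 ∂[innerSL ℝ; ν] + ∫ x, (L x).2.1 ∂(μ : Measure X)
    + ∫ᵛ x, (L x).2.2 ∂•ζ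
  map_add' L M := by
    have hν : ∀ L : C(X, Coeff d), ν.Integrable fun x => (L x).1 := fun L =>
      integrable_continuousMap (ContinuousMap.fst.comp L)
    have hμ : ∀ L : C(X, Coeff d), Integrable (fun x => (L x).2.1) (μ : Measure X) := fun L =>
      integrable_continuousMap (ContinuousMap.fst.comp (ContinuousMap.snd.comp L))
    have hζ : ∀ L : C(X, Coeff d), ζ.Integrable fun x => (L x).2.2 := fun L =>
      integrable_continuousMap (ContinuousMap.snd.comp (ContinuousMap.snd.comp L))
    simp only [ContinuousMap.add_apply, Prod.fst_add, Prod.snd_add]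
    rw [VectorMeasure.integral_fun_add (hν L) (hν M), integral_add (hμ L) (hμ M),
      VectorMeasure.integral_fun_add (hζ L) (hζ M)]
    ring
  map_smul' c L := by
    simp only [ContinuousMap.smul_apply, Prod.smul_fst, Prod.smul_snd, RingHom.id_apply]
    rw [VectorMeasure.integral_fun_smul, integral_smul, VectorMeasure.integral_fun_smul]
    simp only [smul_eq_mul, mul_add]

theorem pairing_apply (μ : FiniteMeasure X) (ν : VectorMeasure X (Vec d)) (ζ : SignedMeasure X)
    (L : C(X, Coeff d)) : pairing μ ν ζ L = ∫ᵛ x, (L x).1 ∂[innerSL ℝ; ν]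
      + ∫ x, (L x).2.1 ∂(μ : Measure X) + ∫ᵛ x, (L x).2.2 ∂•ζ := rfl

theorem integral_dot {l : Measure X} (L : C(X, Coeff d)) {ρ : X → Coeff d} (hρ : Integrable ρ l) :
    ∫ x, dot d (L x) (ρ x) ∂l = ∫ x, inner ℝ (L x).1 (ρ x).1 ∂l
      + ∫ x, (L x).2.1 * (ρ x).2.1 ∂l + ∫ x, (L x).2.2 * (ρ x).2.2 ∂l := by
  have hm : Integrable (fun x => inner ℝ (L x).1 (ρ x).1) l := by
    refine (hρ.fst.norm.const_mul ‖ContinuousMap.fst.comp L‖).mono'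
      ((ContinuousMap.fst.comp L).continuous.aestronglyMeasurable.inner hρ.fst.1)
      (ae_of_all _ fun x => (norm_inner_le_norm _ _).trans ?_)
    exact mul_le_mul_of_nonneg_right ((ContinuousMap.fst.comp L).norm_coe_le_norm x)
      (norm_nonneg _)
  have hu : Integrable (fun x => (L x).2.1 * (ρ x).2.1) l :=
    integrable_continuousMap_mul hρ.snd.fst (ContinuousMap.fst.comp (ContinuousMap.snd.comp L))
  have hz : Integrable (fun x => (L x).2.2 * (ρ x).2.2) l :=
    integrable_continuousMap_mul hρ.snd.snd (ContinuousMap.snd.comp (ContinuousMap.snd.comp L))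
  have hmu : Integrable (fun x => inner ℝ (L x).1 (ρ x).1 + (L x).2.1 * (ρ x).2.1) l := hm.add hu
  simp only [dot_apply]
  rw [integral_add hmu hz, integral_add hm hu]

theorem pairing_eq_integral_density_add (l : Measure X) [IsFiniteMeasure l] (μ : FiniteMeasure X)
    (ν : VectorMeasure X (Vec d)) (ζ : SignedMeasure X) (L : C(X, Coeff d)) :
    pairing μ ν ζ L = ∫ x, dot d (L x) (acDensity l μ ν ζ x) ∂l
      + ∫ x, dot d (L x) (singDensity l μ ν ζ x) ∂(perp l μ ν ζ) := by
  rw [integral_dot L (integrable_acDensity l μ ν ζ),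
    integral_dot L (integrable_singDensity l μ ν ζ)]
  have hν := integral_momentum_eq_integral_density_add ν
    (variation_vecSingularPart_le_perp l μ ν ζ) (ContinuousMap.fst.comp L)
  have hμ := integral_mass_eq_integral_density_add μ (singularPart_mass_le_perp l μ ν ζ)
    (ContinuousMap.fst.comp (ContinuousMap.snd.comp L))
  have hζ := integral_source_eq_integral_density_add ζ (variation_singularPart_le_perp l μ ν ζ)
    (ContinuousMap.snd.comp (ContinuousMap.snd.comp L))
  simp only [ContinuousMap.comp_apply, ContinuousMap.fst_apply, ContinuousMap.snd_apply]
    at hν hμ hζ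
  rw [pairing_apply, hν, hμ, hζ]
  simp only [acDensity, singDensity]
  ring

end Pairing

section AffineSuprema

theorem ofReal_sq_eq_iSup (s : ℝ) :
    ENNReal.ofReal s ^ 2 = ⨆ c : ℚ, ENNReal.ofReal (2 * |(c : ℝ)| * s - (c : ℝ) ^ 2) := by
  have hcont : Continuous fun c : ℝ => ENNReal.ofReal (2 * |c| * s - c ^ 2) :=
    ENNReal.continuous_ofReal.comp (by fun_prop)
  rcases le_or_gt s 0 with hs | hs
  · rw [ENNReal.ofReal_of_nonpos hs, zero_pow two_ne_zero]
    refine (ENNReal.iSup_eq_zero.2 fun c => ENNReal.ofReal_of_nonpos ?_).symm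
    nlinarith [abs_nonneg (c : ℝ), sq_nonneg (c : ℝ)]
  · rw [← ENNReal.ofReal_pow hs.le]
    refine le_antisymm ?_ (iSup_le fun c => ENNReal.ofReal_le_ofReal ?_)
    · refine (ENNReal.ofReal_le_ofReal ?_).trans
        (le_iSup_of_denseRange Rat.denseRange_cast hcont s)
      rw [abs_of_pos hs]
      linarith [sq_nonneg s]
    · nlinarith [sq_nonneg (|(c : ℝ)| - s), sq_abs (c : ℝ)]

theorem iSup_ofReal_add_iSup_ofReal {ι κ : Type*} {x : ι → ℝ} {y : κ → ℝ} (hx : ∃ i, x i = 0)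
    (hy : ∃ j, y j = 0) :
    (⨆ i, ENNReal.ofReal (x i)) + ⨆ j, ENNReal.ofReal (y j) =
      ⨆ ij : ι × κ, ENNReal.ofReal (x ij.1 + y ij.2) := by
  obtain ⟨i₀, hi₀⟩ := hx
  obtain ⟨j₀, hj₀⟩ := hy
  have : Nonempty ι := ⟨i₀⟩
  have : Nonempty κ := ⟨j₀⟩
  refine le_antisymm (ENNReal.iSup_add_iSup_le fun i j => ?_) (iSup_le fun ij => ?_)
  · have hle := le_iSup fun ij : ι × κ => ENNReal.ofReal (x ij.1 + y ij.2)
    rcases le_total (x i) 0 with hxi | hxi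
    · rw [ENNReal.ofReal_of_nonpos hxi, zero_add]
      simpa [hi₀] using hle (i₀, j)
    · rcases le_total (y j) 0 with hyj | hyj
      · rw [ENNReal.ofReal_of_nonpos hyj, add_zero]
        simpa [hj₀] using hle (i, j₀)
      · rw [← ENNReal.ofReal_add hxi hyj]
        exact hle (i, j)
  · exact ENNReal.ofReal_add_le.trans
      (add_le_add (le_iSup (fun i => ENNReal.ofReal (x i)) ij.1)
        (le_iSup (fun j => ENNReal.ofReal (y j)) ij.2))

variable {d : ℕ} {X : Type*} [MetricSpace X] [CompactSpace X] [MeasurableSpace X] [BorelSpace X]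
  {F G : FiniteMeasure X → VectorMeasure X (Vec d) → SignedMeasure X → ℝ≥0∞}

/-- Suprema of countably many affine weak-* continuous functionals, one of which is zero. The
truncation `ENNReal.ofReal` at `0` is then harmless. -/
def IsAffineSup (F : FiniteMeasure X → VectorMeasure X (Vec d) → SignedMeasure X → ℝ≥0∞) : Prop :=
  ∃ (L : ℕ → C(X, Coeff d)) (q : ℕ → ℝ), (∃ i, L i = 0 ∧ q i = 0) ∧
    ∀ μ ν ζ, F μ ν ζ = ⨆ i, ENNReal.ofReal (pairing μ ν ζ (L i) - q i)

theorem IsAffineSup.of_countable {ι : Type*} [Countable ι] {L : ι → C(X, Coeff d)} {q : ι → ℝ}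
    (hzero : ∃ i, L i = 0 ∧ q i = 0)
    (hF : ∀ μ ν ζ, F μ ν ζ = ⨆ i, ENNReal.ofReal (pairing μ ν ζ (L i) - q i)) :
    IsAffineSup F := by
  obtain ⟨i₀, hL₀, hq₀⟩ := hzero
  have : Nonempty ι := ⟨i₀⟩
  obtain ⟨e, he⟩ := exists_surjective_nat ι
  obtain ⟨n₀, rfl⟩ := he i₀
  refine ⟨L ∘ e, q ∘ e, ⟨n₀, hL₀, hq₀⟩, fun μ ν ζ => ?_⟩
  rw [hF]
  exact (he.iSup_comp fun i => ENNReal.ofReal (pairing μ ν ζ (L i) - q i)).symm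

theorem IsAffineSup.add (hF : IsAffineSup F) (hG : IsAffineSup G) :
    IsAffineSup fun μ ν ζ => F μ ν ζ + G μ ν ζ := by
  obtain ⟨L, q, ⟨i₀, hL₀, hq₀⟩, hF⟩ := hF
  obtain ⟨M, s, ⟨j₀, hM₀, hs₀⟩, hG⟩ := hG
  refine .of_countable (L := fun ij : ℕ × ℕ => L ij.1 + M ij.2) (q := fun ij => q ij.1 + s ij.2)
    ⟨(i₀, j₀), by simp [hL₀, hM₀], by simp [hq₀, hs₀]⟩ fun μ ν ζ => ?_
  rw [hF, hG, iSup_ofReal_add_iSup_ofReal ⟨i₀, by simp [hL₀, hq₀]⟩ ⟨j₀, by simp [hM₀, hs₀]⟩]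
  simp only [map_add, add_sub_add_comm]

theorem IsAffineSup.const_mul (hF : IsAffineSup F) {a : ℝ} (ha : 0 ≤ a) :
    IsAffineSup fun μ ν ζ => ENNReal.ofReal a * F μ ν ζ := by
  obtain ⟨L, q, ⟨i₀, hL₀, hq₀⟩, hF⟩ := hF
  refine ⟨fun i => a • L i, fun i => a * q i, ⟨i₀, by ext1 x; simp [hL₀], by simp [hq₀]⟩,
    fun μ ν ζ => ?_⟩
  simp only [hF, ENNReal.mul_iSup, ← ENNReal.ofReal_mul ha, map_smul, smul_eq_mul, mul_sub]

theorem IsAffineSup.sq (hF : IsAffineSup F) : IsAffineSup fun μ ν ζ => F μ ν ζ ^ 2 := by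
  obtain ⟨L, q, ⟨i₀, hL₀, hq₀⟩, hF⟩ := hF
  refine .of_countable (L := fun ic : ℕ × ℚ => (2 * |(ic.2 : ℝ)|) • L ic.1)
    (q := fun ic => 2 * |(ic.2 : ℝ)| * q ic.1 + (ic.2 : ℝ) ^ 2)
    ⟨(i₀, 0), by ext1 x; simp [hL₀], by simp [hq₀]⟩ fun μ ν ζ => ?_
  simp only [hF, ENNReal.iSup_pow_of_ne_zero two_ne_zero, ofReal_sq_eq_iSup, map_smul, smul_eq_mul,
    iSup_prod, mul_sub, sub_add_eq_sub_sub]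

variable (l : Measure X) [IsFiniteMeasure l]

theorem isAffineSup_lintegral_iSup_dot (c : ℕ → Coeff d) (q : ℕ → ℝ) :
    IsAffineSup fun μ ν ζ =>
      ∫⁻ x, ⨆ k, ENNReal.ofReal (dot d (c k) (acDensity l μ ν ζ x) - q k) ∂l
        + ∫⁻ x, ⨆ k, ENNReal.ofReal (dot d (c k) (singDensity l μ ν ζ x)) ∂(perp l μ ν ζ) := by
  refine .of_countable (ι := ℕ × ℕ)
    (L := fun i => ∑ k : Fin i.1, (denseWeights X i.1 i.2).1 k • ContinuousMap.const X (c k))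
    (q := fun i => ∑ k : Fin i.1, q k * ∫ x, (denseWeights X i.1 i.2).1 k x ∂l)
    ⟨(0, 0), by simp, by simp⟩ fun μ ν ζ => ?_
  have hac : ∀ k, Integrable (fun x => dot d (c k) (acDensity l μ ν ζ x)) l := fun k =>
    (dot d (c k)).integrable_comp (integrable_acDensity l μ ν ζ)
  have hacq : ∀ k, Integrable (fun x => dot d (c k) (acDensity l μ ν ζ x) - q k) l := fun k =>
    (hac k).sub (integrable_const _)
  have hsing : ∀ k, Integrable (fun x => dot d (c k) (singDensity l μ ν ζ x)) (perp l μ ν ζ) :=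
    fun k => (dot d (c k)).integrable_comp (integrable_singDensity l μ ν ζ)
  rw [lintegral_iSup_add_eq (mutuallySingular_perp l μ ν ζ) hacq hsing, iSup_prod]
  congr! 5 with N j
  rw [map_sum, ← Finset.sum_sub_distrib]
  refine Finset.sum_congr rfl fun k _ => ?_
  have hsub : ∫ x, (denseWeights X N j).1 k x * (dot d (c k) (acDensity l μ ν ζ x) - q k) ∂l =
      ∫ x, (denseWeights X N j).1 k x * dot d (c k) (acDensity l μ ν ζ x) ∂l
        - q k * ∫ x, (denseWeights X N j).1 k x ∂l := by
    rw [← integral_const_mul, ← integral_sub (integrable_continuousMap_mul (hac k) _)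
      ((integrable_continuousMap _).const_mul _)]
    simp only [mul_sub, mul_comm (q k)]
  rw [pairing_eq_integral_density_add l, hsub]
  simp only [ContinuousMap.smul_apply', ContinuousMap.const_apply, map_smul, _root_.smul_apply,
    smul_eq_mul]
  ring

theorem isAffineSup_transportAction (d : ℕ) : IsAffineSup (transportAction (d := d) l) := by
  have hPhi : ∀ v : Coeff d, 0 ≤ v.2.1 → Phi v.2.1 v.1 = ⨆ k, ENNReal.ofReal (dot d
      ((2 : ℝ) • TopologicalSpace.denseSeq (Vec d) k,
        -‖TopologicalSpace.denseSeq (Vec d) k‖ ^ 2, 0) v) := fun v hv => by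
    simp only [Phi_eq_iSup hv, dot_apply, real_inner_smul_left, neg_mul, zero_mul, add_zero,
      sub_eq_add_neg]
  convert isAffineSup_lintegral_iSup_dot l
    (fun k => ((2 : ℝ) • TopologicalSpace.denseSeq (Vec d) k,
      -‖TopologicalSpace.denseSeq (Vec d) k‖ ^ 2, 0)) 0 using 4 with μ ν ζ
  simp only [transportAction, Pi.zero_apply, sub_zero]
  congr 1
  · exact lintegral_congr fun x => hPhi (acDensity l μ ν ζ x) ENNReal.toReal_nonneg
  · exact lintegral_congr fun x => hPhi (singDensity l μ ν ζ x) ENNReal.toReal_nonneg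

variable {r : ℝ → ℝ}

theorem isAffineSup_sourceAction (d : ℕ) (hr : ConvexOn ℝ univ r) (h0 : r 0 = 0) :
    IsAffineSup (sourceAction (d := d) r l) := by
  obtain ⟨p, q, hr, hrec⟩ := exists_iSup_affine_eq_recession hr h0
  convert (isAffineSup_lintegral_iSup_dot (d := d) l (fun k => (0, 0, p k)) q).sq using 4
  simp only [sourceAction, hr, hrec, dot_apply, acDensity, singDensity, inner_zero_left, zero_mul,
    zero_add]

theorem isAffineSup_energyDensity (d : ℕ) (hr : ConvexOn ℝ univ r) (h0 : r 0 = 0) {δ : ℝ}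
    (hδ : 0 ≤ δ) : IsAffineSup (energyDensity (d := d) δ r l) :=
  (isAffineSup_transportAction l d).add
    ((isAffineSup_sourceAction l d hr h0).const_mul (one_div_nonneg.2 hδ))

end AffineSuprema

section Coercivity

variable {d : ℕ} {X : Type*} [MeasurableSpace X]

theorem variation_le_lintegral_enorm_vecDensity_add (ν : VectorMeasure X (Vec d)) (l : Measure X)
    {p : Measure X} [SigmaFinite p] (hp : (vecSingularPart ν l).variation ≤ p) :
    ν.variation univ ≤
      ∫⁻ x, ‖vecDensity ν l x‖ₑ ∂l + ∫⁻ x, ‖vecDensity (vecSingularPart ν l) p x‖ₑ ∂p := by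
  have hsum : ν = l.withDensityᵥ (vecDensity ν l) + p.withDensityᵥ
      (vecDensity (vecSingularPart ν l) p) := by
    rw [withDensityᵥ_vecDensity _ (Measure.absolutelyContinuous_of_le hp), vecSingularPart,
      add_sub_cancel]
  have hle := Measure.le_iff'.1 (VectorMeasure.variation_add_le (μ := l.withDensityᵥ
    (vecDensity ν l)) (ν := p.withDensityᵥ (vecDensity (vecSingularPart ν l) p))) univ
  rwa [← hsum, Measure.variation_withDensityᵥ (integrable_vecDensity _ _),
    Measure.variation_withDensityᵥ (integrable_vecDensity _ _), Measure.add_apply,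
    withDensity_apply _ MeasurableSet.univ, withDensity_apply _ MeasurableSet.univ,
    Measure.restrict_univ, Measure.restrict_univ] at hle

theorem variation_le_lintegral_enorm_rnDeriv_add (ζ : SignedMeasure X) (l : Measure X)
    [SigmaFinite l] {p : Measure X} [SigmaFinite p] (hp : (ζ.singularPart l).variation ≤ p) :
    ζ.variation univ ≤
      ∫⁻ x, ‖ζ.rnDeriv l x‖ₑ ∂l + ∫⁻ x, ‖(ζ.singularPart l).rnDeriv p x‖ₑ ∂p := by
  have hsum : ζ = l.withDensityᵥ (ζ.rnDeriv l) + p.withDensityᵥ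
      ((ζ.singularPart l).rnDeriv p) := by
    rw [withDensityᵥ_rnDeriv_of_variation_absolutelyContinuous _
      (Measure.absolutelyContinuous_of_le hp), add_comm,
      SignedMeasure.singularPart_add_withDensity_rnDeriv_eq]
  have hle := Measure.le_iff'.1 (VectorMeasure.variation_add_le (μ := l.withDensityᵥ
    (ζ.rnDeriv l)) (ν := p.withDensityᵥ ((ζ.singularPart l).rnDeriv p))) univ
  rwa [← hsum, Measure.variation_withDensityᵥ (SignedMeasure.integrable_rnDeriv _ _),
    Measure.variation_withDensityᵥ (SignedMeasure.integrable_rnDeriv _ _), Measure.add_apply,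
    withDensity_apply _ MeasurableSet.univ, withDensity_apply _ MeasurableSet.univ,
    Measure.restrict_univ, Measure.restrict_univ] at hle

theorem enorm_le_mul_Phi_add {ε : ℝ} (hε : 0 < ε) {u : ℝ} (hu : 0 ≤ u) (m : Vec d) :
    ‖m‖ₑ ≤ ENNReal.ofReal ε * Phi u m + ENNReal.ofReal (1 / ε) * ENNReal.ofReal u := by
  unfold Phi
  split_ifs with hpos hzero
  · rw [← ENNReal.ofReal_mul hε.le, ← ENNReal.ofReal_mul (by positivity),
      ← ENNReal.ofReal_add (by positivity) (by positivity), ← ofReal_norm]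
    refine ENNReal.ofReal_le_ofReal (sub_nonneg.1 ?_)
    have hsq : ε * (‖m‖ ^ 2 / u) + 1 / ε * u - ‖m‖ =
        ((ε * ‖m‖ - u / 2) ^ 2 + 3 / 4 * u ^ 2) / (ε * u) := by
      field_simp
      ring
    rw [hsq]
    positivity
  · obtain ⟨rfl, rfl⟩ := hzero
    simp
  · rw [ENNReal.mul_top (by simpa using hε)]
    simp

theorem lintegral_enorm_le_mul_lintegral_Phi_add {ε : ℝ} (hε : 0 < ε) (l μ : Measure X)
    (m : X → Vec d) :
    ∫⁻ x, ‖m x‖ₑ ∂l ≤ ENNReal.ofReal ε * ∫⁻ x, Phi (μ.rnDeriv l x).toReal (m x) ∂l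
      + ENNReal.ofReal (1 / ε) * μ univ := by
  have hmeas : Measurable fun x =>
      ENNReal.ofReal (1 / ε) * ENNReal.ofReal (μ.rnDeriv l x).toReal :=
    (Measure.measurable_rnDeriv _ _).ennreal_toReal.ennreal_ofReal.const_mul _
  calc ∫⁻ x, ‖m x‖ₑ ∂l ≤ ∫⁻ x, (ENNReal.ofReal ε * Phi (μ.rnDeriv l x).toReal (m x)
        + ENNReal.ofReal (1 / ε) * ENNReal.ofReal (μ.rnDeriv l x).toReal) ∂l :=
        lintegral_mono fun x => enorm_le_mul_Phi_add hε ENNReal.toReal_nonneg _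
    _ = ENNReal.ofReal ε * ∫⁻ x, Phi (μ.rnDeriv l x).toReal (m x) ∂l
        + ENNReal.ofReal (1 / ε) * ∫⁻ x, ENNReal.ofReal (μ.rnDeriv l x).toReal ∂l := by
        rw [lintegral_add_right _ hmeas, lintegral_const_mul' _ _ ENNReal.ofReal_ne_top,
          lintegral_const_mul' _ _ ENNReal.ofReal_ne_top]
    _ ≤ _ := by
        gcongr
        exact (lintegral_mono fun x => ENNReal.ofReal_toReal_le).trans
          Measure.lintegral_rnDeriv_le

theorem variation_le_mul_transportAction_add {ε : ℝ} (hε : 0 < ε) (l : Measure X)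
    (μ : FiniteMeasure X) (ν : VectorMeasure X (Vec d)) (ζ : SignedMeasure X) :
    ν.variation univ ≤ ENNReal.ofReal ε * transportAction l μ ν ζ
      + ENNReal.ofReal (2 / ε) * (μ : Measure X) univ := by
  have hac := lintegral_enorm_le_mul_lintegral_Phi_add hε l μ (vecDensity ν l)
  have hsing := (lintegral_enorm_le_mul_lintegral_Phi_add hε (perp l μ ν ζ)
    ((μ : Measure X).singularPart l) (vecDensity (vecSingularPart ν l) (perp l μ ν ζ))).trans
    (add_le_add_right (mul_le_mul_right (Measure.le_iff'.1 (Measure.singularPart_le _ _) univ) _) _)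
  refine ((variation_le_lintegral_enorm_vecDensity_add ν l
    (variation_vecSingularPart_le_perp l μ ν ζ)).trans (add_le_add hac hsing)).trans_eq ?_
  have htwo : ENNReal.ofReal (2 / ε) = ENNReal.ofReal (1 / ε) + ENNReal.ofReal (1 / ε) := by
    rw [← ENNReal.ofReal_add (by positivity) (by positivity), ← add_div, one_add_one_eq_two]
  rw [transportAction, htwo]
  ring

/-- The hypotheses on a source penalty that make the energy coercive and lower semicontinuous.
Unlike in `IsSourcePenalty`, the growth at `±∞` may be superlinear. -/
structure IsCoercivePenalty (r : ℝ → ℝ) : Prop where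
  nonneg : ∀ s, 0 ≤ r s
  convex : ConvexOn ℝ univ r
  zero : r 0 = 0
  recession_one_pos : 0 < recession r 1
  recession_neg_one_pos : 0 < recession r (-1)

variable {r : ℝ → ℝ}

theorem IsSourcePenalty.isCoercivePenalty (hr : IsSourcePenalty r) : IsCoercivePenalty r :=
  ⟨hr.nonneg, hr.convex, hr.zero, hr.growth_pos.1, hr.growth_neg.1⟩

theorem le_div_mul_add_of_convexOn (hc : ConvexOn ℝ univ r) (h0 : r 0 = 0) (hnn : ∀ s, 0 ≤ r s)
    {a : ℝ} (ha : 0 < a) (hra : 0 < r a) (s : ℝ) : s ≤ a / r a * r s + a := by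
  rcases le_total s a with hsa | has
  · have : 0 ≤ a / r a * r s := mul_nonneg (by positivity) (hnn s)
    linarith
  · have hs : 0 < s := ha.trans_le has
    have hslope := hc.2 (mem_univ s) (mem_univ 0) (show 0 ≤ a / s by positivity)
      (sub_nonneg.2 ((div_le_one hs).2 has)) (add_sub_cancel _ _)
    simp only [smul_eq_mul, mul_zero, add_zero, h0] at hslope
    rw [div_mul_cancel₀ _ hs.ne', div_mul_eq_mul_div, le_div_iff₀ hs] at hslope
    have : s ≤ a / r a * r s := by
      rw [div_mul_eq_mul_div, le_div_iff₀ hra]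
      linarith
    linarith

theorem exists_pos_of_recession_pos {y : ℝ} (h : 0 < recession r y) :
    ∃ a > 0, 0 < r (a * y) := by
  simp only [recession, lt_iSup_iff] at h
  obtain ⟨s, hs, h⟩ := h
  rw [ENNReal.ofReal_pos] at h
  exact ⟨s, hs, (div_pos_iff_of_pos_right hs).1 h⟩

theorem IsCoercivePenalty.exists_abs_le (hr : IsCoercivePenalty r) :
    ∃ κ C : ℝ, 0 ≤ κ ∧ ∀ s, |s| ≤ κ * r s + C := by
  obtain ⟨a, ha, hra⟩ := exists_pos_of_recession_pos hr.recession_one_pos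
  obtain ⟨b, hb, hrb⟩ := exists_pos_of_recession_pos hr.recession_neg_one_pos
  rw [mul_one] at hra
  rw [mul_neg_one] at hrb
  have hconv : ConvexOn ℝ univ fun s => r (-s) :=
    hr.convex.comp_linearMap (-LinearMap.id : ℝ →ₗ[ℝ] ℝ)
  have hκa : 0 ≤ a / r a := by positivity
  have hκb : 0 ≤ b / r (-b) := by positivity
  refine ⟨a / r a + b / r (-b), a + b, by positivity, fun s => ?_⟩
  have hpos := le_div_mul_add_of_convexOn hr.convex hr.zero hr.nonneg ha hra s
  have hneg := le_div_mul_add_of_convexOn hconv (by rw [neg_zero, hr.zero])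
    (fun s => hr.nonneg _) hb hrb (-s)
  rw [neg_neg] at hneg
  rw [add_mul]
  exact abs_le'.2 ⟨by nlinarith [hr.nonneg s], by nlinarith [hr.nonneg s]⟩

theorem enorm_le_mul_recession {κ C : ℝ} (hκ : 0 ≤ κ) (h : ∀ s, |s| ≤ κ * r s + C) (y : ℝ) :
    ‖y‖ₑ ≤ ENNReal.ofReal κ * recession r y := by
  have hle : ∀ s > 0, ENNReal.ofReal (|y| - C / s) ≤ ENNReal.ofReal κ * recession r y := by
    intro s hs
    refine le_trans ?_ (mul_le_mul_right (le_iSup₂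
      (f := fun (s : ℝ) (_ : 0 < s) => ENNReal.ofReal (r (s * y) / s)) s hs) _)
    rw [← ENNReal.ofReal_mul hκ]
    refine ENNReal.ofReal_le_ofReal ?_
    have hsy := h (s * y)
    rw [abs_mul, abs_of_pos hs] at hsy
    rw [← mul_div_assoc, le_div_iff₀ hs, sub_mul, div_mul_cancel₀ _ hs.ne']
    linarith
  have hlim : Tendsto (fun s : ℝ => |y| - C / s) atTop (𝓝 (|y| - 0)) :=
    tendsto_const_nhds.sub (tendsto_const_nhds.div_atTop tendsto_id)
  rw [sub_zero] at hlim
  rw [← ofReal_norm]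
  refine le_of_tendsto (ENNReal.tendsto_ofReal hlim) ?_
  filter_upwards [eventually_gt_atTop 0] with s hs using hle s hs

theorem le_mul_sq_add {ε : ℝ} (hε : 0 < ε) (s : ℝ≥0∞) :
    s ≤ ENNReal.ofReal ε * s ^ 2 + ENNReal.ofReal (1 / ε) := by
  induction s with
  | top => simp [hε]
  | coe s =>
    rw [← ENNReal.ofReal_coe_nnreal, ← ENNReal.ofReal_pow s.coe_nonneg, ← ENNReal.ofReal_mul hε.le,
      ← ENNReal.ofReal_add (by positivity) (by positivity)]
    refine ENNReal.ofReal_le_ofReal (sub_nonneg.1 ?_)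
    have hsq : ε * (s : ℝ) ^ 2 + 1 / ε - s = ((ε * s - 1 / 2) ^ 2 + 3 / 4) / ε := by
      field_simp
      ring
    rw [hsq]
    positivity

theorem variation_le_mul_sourceAction_add {κ C : ℝ} (hκ : 0 ≤ κ) (h : ∀ s, |s| ≤ κ * r s + C)
    {ε : ℝ} (hε : 0 < ε) (l : Measure X) [SigmaFinite l]
    (μ : FiniteMeasure X) (ν : VectorMeasure X (Vec d)) (ζ : SignedMeasure X) :
    ζ.variation univ ≤ ENNReal.ofReal κ * (ENNReal.ofReal ε * sourceAction r l μ ν ζ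
      + ENNReal.ofReal (1 / ε)) + ENNReal.ofReal C * l univ := by
  have hr : ∀ s, ‖s‖ₑ ≤ ENNReal.ofReal κ * ENNReal.ofReal (r s) + ENNReal.ofReal C := fun s => by
    rw [← ENNReal.ofReal_mul hκ, ← ofReal_norm]
    exact (ENNReal.ofReal_le_ofReal (h s)).trans ENNReal.ofReal_add_le
  have hac : ∫⁻ x, ‖ζ.rnDeriv l x‖ₑ ∂l ≤ ENNReal.ofReal κ *
      ∫⁻ x, ENNReal.ofReal (r (ζ.rnDeriv l x)) ∂l + ENNReal.ofReal C * l univ := by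
    refine (lintegral_mono fun x => hr _).trans_eq ?_
    rw [lintegral_add_right _ measurable_const, lintegral_const,
      lintegral_const_mul' _ _ ENNReal.ofReal_ne_top]
  have hsing : ∫⁻ x, ‖(ζ.singularPart l).rnDeriv (perp l μ ν ζ) x‖ₑ ∂(perp l μ ν ζ) ≤
      ENNReal.ofReal κ * ∫⁻ x, recession r ((ζ.singularPart l).rnDeriv (perp l μ ν ζ) x)
        ∂(perp l μ ν ζ) := by
    refine (lintegral_mono fun x => enorm_le_mul_recession hκ h _).trans_eq ?_
    rw [lintegral_const_mul' _ _ ENNReal.ofReal_ne_top]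
  refine ((variation_le_lintegral_enorm_rnDeriv_add ζ l
    (variation_singularPart_le_perp l μ ν ζ)).trans (add_le_add hac hsing)).trans ?_
  rw [add_right_comm, ← mul_add]
  exact add_le_add_left (mul_le_mul_right (le_mul_sq_add hε _) _) _

end Coercivity

section Families

variable {S K X : Type*} [MeasurableSpace S] [MeasurableSpace K] [MeasurableSpace X]

theorem integrable_of_norm_le {E : Type*} [NormedAddCommGroup E] {l : Measure X}
    [IsFiniteMeasure l] {f : X → E} (hf : StronglyMeasurable f) {C : ℝ} (hC : ∀ x, ‖f x‖ ≤ C) :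
    Integrable f l :=
  Integrable.of_bound hf.aestronglyMeasurable C (ae_of_all _ hC)

theorem integral_indicator_const_eq_mul (τ : SignedMeasure X) {E : Set X} (hE : MeasurableSet E)
    (c : ℝ) : ∫ᵛ x, E.indicator (fun _ => c) x ∂•τ = c * τ E := by
  rw [VectorMeasure.integral_indicator_const c hE, ContinuousLinearMap.lsmul_apply, smul_eq_mul]

theorem norm_indicator_one_le {Y : Type*} (E : Set Y) (x : Y) :
    ‖E.indicator (fun _ => (1 : ℝ)) x‖ ≤ 1 :=
  (norm_indicator_le_norm_self _ _).trans norm_one.le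

theorem enorm_integral_le_mul_variation_of_norm_le_indicator (τ : SignedMeasure X) {E : Set X}
    (hE : MeasurableSet E) {η : X → ℝ} {C : ℝ} (hC : ∀ x, ‖η x‖ ≤ E.indicator (fun _ => C) x) :
    ‖∫ᵛ x, η x ∂•τ‖ₑ ≤ ENNReal.ofReal C * τ.variation E := by
  have hle := VectorMeasure.enorm_integral_le_lintegral_enorm (μ := τ)
    (B := ContinuousLinearMap.lsmul ℝ ℝ) (f := η)
  have hlsmul : ‖(ContinuousLinearMap.lsmul ℝ ℝ : ℝ →L[ℝ] ℝ →L[ℝ] ℝ)‖ₑ ≤ 1 := by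
    rw [← ofReal_norm, ← ENNReal.ofReal_one]
    exact ENNReal.ofReal_le_ofReal ContinuousLinearMap.opNorm_lsmul_le
  refine hle.trans ((mul_le_of_le_one_left zero_le hlsmul).trans ?_)
  rw [← lintegral_indicator_const hE]
  refine lintegral_mono fun x => ?_
  rw [← ofReal_norm]
  refine (ENNReal.ofReal_le_ofReal (hC x)).trans_eq ?_
  by_cases hx : x ∈ E <;> simp [hx]

theorem enorm_integral_le_mul_variation (τ : SignedMeasure X) {η : X → ℝ} {C : ℝ}
    (hC : ∀ x, ‖η x‖ ≤ C) : ‖∫ᵛ x, η x ∂•τ‖ₑ ≤ ENNReal.ofReal C * τ.variation univ :=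
  enorm_integral_le_mul_variation_of_norm_le_indicator τ MeasurableSet.univ
    fun x => by simpa only [indicator_univ] using hC x

variable {s : S → SignedMeasure K}

theorem measurable_apply_preimage (hs : ∀ B, MeasurableSet B → Measurable fun t => s t B)
    {E : Set (S × K)} (hE : MeasurableSet E) : Measurable fun t => s t (Prod.mk t ⁻¹' E) := by
  induction E, hE using MeasurableSpace.induction_on_inter generateFrom_prod.symm
    isPiSystem_prod with
  | empty => simp
  | basic E hE =>
    obtain ⟨A, hA, B, hB, rfl⟩ := hE
    classical
    have hind : (fun t => s t (Prod.mk t ⁻¹' A ×ˢ B)) = A.indicator fun t => s t B := by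
      ext t
      by_cases ht : t ∈ A <;> simp [ht]
    rw [hind]
    exact (hs B hB).indicator hA
  | compl E hE ih =>
    have hcompl : (fun t => s t (Prod.mk t ⁻¹' Eᶜ)) =
        fun t => s t univ - s t (Prod.mk t ⁻¹' E) := by
      ext t
      rw [preimage_compl, VectorMeasure.of_compl (measurable_prodMk_left hE)]
    rw [hcompl]
    exact (hs univ MeasurableSet.univ).sub ih
  | iUnion f hd hf ih =>
    refine measurable_of_tendsto_metrizable
      (f := fun n t => ∑ k ∈ Finset.range n, s t (Prod.mk t ⁻¹' f k))
      (fun n => Finset.measurable_sum _ fun k _ => ih k) (tendsto_pi_nhds.2 fun t => ?_)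
    rw [preimage_iUnion]
    refine (VectorMeasure.hasSum_of_disjoint_iUnion (v := s t)
      (fun k => measurable_prodMk_left (hf k)) fun a b hab => ?_).tendsto_sum_nat
    exact (hd hab).preimage _

theorem measurable_integral_simpleFunc (hs : ∀ B, MeasurableSet B → Measurable fun t => s t B)
    (η : SimpleFunc (S × K) ℝ) : Measurable fun t => ∫ᵛ x, η (t, x) ∂•(s t) := by
  induction η using SimpleFunc.induction with
  | @const c E hE =>
    have hconst : (fun t => ∫ᵛ x, (SimpleFunc.piecewise E hE (SimpleFunc.const _ c)
        (SimpleFunc.const _ 0)) (t, x) ∂•(s t)) = fun t => c * s t (Prod.mk t ⁻¹' E) := by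
      ext t
      rw [← integral_indicator_const_eq_mul _ (measurable_prodMk_left hE)]
      congr 1 with x
    rw [hconst]
    exact (measurable_apply_preimage hs hE).const_mul c
  | @add f g _ hf hg =>
    have hint : ∀ (f : SimpleFunc (S × K) ℝ) (t : S), (s t).Integrable fun x => f (t, x) :=
      fun f t => by
        obtain ⟨C, hC⟩ := f.exists_forall_norm_le
        exact integrable_of_norm_le
          (f.measurable.comp measurable_prodMk_left).stronglyMeasurable fun x => hC _
    have hadd : (fun t => ∫ᵛ x, (f + g) (t, x) ∂•(s t)) =
        fun t => ∫ᵛ x, f (t, x) ∂•(s t) + ∫ᵛ x, g (t, x) ∂•(s t) :=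
      funext fun t => VectorMeasure.integral_fun_add (hint f t) (hint g t)
    rw [hadd]
    exact hf.add hg

theorem measurable_integral_family (hs : ∀ B, MeasurableSet B → Measurable fun t => s t B)
    {η : S × K → ℝ} (hη : Measurable η) {C : ℝ} (hC : ∀ p, ‖η p‖ ≤ C) :
    Measurable fun t => ∫ᵛ x, η (t, x) ∂•(s t) := by
  have hη' := hη.stronglyMeasurable
  refine measurable_of_tendsto_metrizable
    (fun n => measurable_integral_simpleFunc hs (hη'.approxBounded C n))
    (tendsto_pi_nhds.2 fun t => ?_)
  exact VectorMeasure.tendsto_integral_of_dominated_convergence (fun _ => C)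
    (fun n => ((hη'.approxBounded C n).measurable.comp
      measurable_prodMk_left).aestronglyMeasurable)
    (integrable_const _)
    (fun n => ae_of_all _ fun x => hη'.norm_approxBounded_le ((norm_nonneg _).trans (hC (t, x))) n
      (t, x))
    (ae_of_all _ fun x => hη'.tendsto_approxBounded_of_norm_le (hC (t, x)))

theorem integrable_integral_family {m : Measure S}
    (hs : ∀ B, MeasurableSet B → Measurable fun t => s t B)
    (hfin : ∫⁻ t, (s t).variation univ ∂m < ∞) {η : S × K → ℝ} (hη : Measurable η)
    {C : ℝ} (hC : ∀ p, ‖η p‖ ≤ C) : Integrable (fun t => ∫ᵛ x, η (t, x) ∂•(s t)) m := by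
  refine ⟨(measurable_integral_family hs hη hC).aestronglyMeasurable, ?_⟩
  refine (lintegral_mono fun t =>
    enorm_integral_le_mul_variation (s t) fun x => hC (t, x)).trans_lt ?_
  rw [lintegral_const_mul' _ _ ENNReal.ofReal_ne_top]
  exact ENNReal.mul_lt_top ENNReal.ofReal_lt_top hfin

/-- `τ = ∫ s_t dt` as signed measures on `[0,1] × K`. It suffices to test with bounded functions. -/
structure IsSignedDisintegration (τ : SignedMeasure (I × K)) (s : I → SignedMeasure K) : Prop where
  measurable : ∀ B, MeasurableSet B → Measurable fun t => s t B
  finite : ∫⁻ t, (s t).variation univ < ∞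
  eq : ∀ η : I × K → ℝ, Measurable η → (∃ C, ∀ p, ‖η p‖ ≤ C) →
    ∫ᵛ p, η p ∂•τ = ∫ t : I, ∫ᵛ x, η (t, x) ∂•(s t)

theorem IsSignedDisintegration.apply_eq {τ : SignedMeasure (I × K)} {s : I → SignedMeasure K}
    (h : IsSignedDisintegration τ s) {E : Set (I × K)} (hE : MeasurableSet E) :
    τ E = ∫ t : I, ∫ᵛ x, E.indicator (fun _ => (1 : ℝ)) (t, x) ∂•(s t) := by
  rw [← h.eq _ (measurable_const.indicator hE) ⟨1, norm_indicator_one_le E⟩,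
    integral_indicator_const_eq_mul _ hE, one_mul]

theorem IsSignedDisintegration.variation_le {τ : SignedMeasure (I × K)} {s : I → SignedMeasure K}
    (h : IsSignedDisintegration τ s) {J : Set I} (hJ : MeasurableSet J) :
    τ.variation (J ×ˢ univ) ≤ 2 * ∫⁻ t in J, (s t).variation univ := by
  refine le_of_forall_lt fun a ha => ?_
  obtain ⟨E, hEJ, hE, haE⟩ := τ.exists_subset_lt_enorm_apply_of_lt_variation
    (hJ.prod MeasurableSet.univ) ha
  refine haE.trans_le ?_
  gcongr
  rw [h.apply_eq hE, ← lintegral_indicator hJ]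
  refine (enorm_integral_le_lintegral_enorm _).trans (lintegral_mono fun t => ?_)
  by_cases ht : t ∈ J
  · rw [indicator_of_mem ht]
    simpa only [ENNReal.ofReal_one, one_mul] using
      enorm_integral_le_mul_variation (s t) fun x => norm_indicator_one_le E (t, x)
  · have hzero : ∀ x, E.indicator (fun _ => (1 : ℝ)) (t, x) = 0 := fun x =>
      indicator_of_notMem (fun hx => ht (hEJ hx).1) _
    simp [hzero]

variable {d : ℕ} {D : Set (Vec d)} {T : Triple D} {c : Curve D}

theorem IsDisintegration.isSignedDisintegration_source (h : IsDisintegration T c) :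
    IsSignedDisintegration T.source c.source :=
  ⟨h.measurable_source, h.finite_source, fun η hη ⟨_, hC⟩ =>
    h.source_eq η (integrable_of_norm_le hη.stronglyMeasurable hC)⟩

theorem IsDisintegration.measurable_component_momentum (h : IsDisintegration T c) (i : Fin d)
    (B : Set (Cl D)) (hB : MeasurableSet B) :
    Measurable fun t => component (c.momentum t) i B := by
  simp_rw [component_apply]
  exact (EuclideanSpace.proj (𝕜 := ℝ) i).continuous.measurable.comp (h.measurable_momentum B hB)

theorem IsDisintegration.lintegral_variation_component_momentum_lt_top
    (h : IsDisintegration T c) (i : Fin d) :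
    ∫⁻ t, (component (c.momentum t) i).variation univ < ∞ :=
  (lintegral_mono fun _ => Measure.le_iff'.1 (variation_component_le _ i) univ).trans_lt
    h.finite_momentum

theorem IsDisintegration.isSignedDisintegration_component_momentum (h : IsDisintegration T c)
    (i : Fin d) :
    IsSignedDisintegration (component T.momentum i) fun t => component (c.momentum t) i := by
  refine ⟨h.measurable_component_momentum i, h.lintegral_variation_component_momentum_lt_top i,
    fun η hη ⟨C, hC⟩ => ?_⟩
  have hηT : T.momentum.Integrable η := integrable_of_norm_le hη.stronglyMeasurable hC
  have hηt : ∀ t, (c.momentum t).Integrable fun x => η (t, x) := fun t =>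
    integrable_of_norm_le (hη.comp measurable_prodMk_left).stronglyMeasurable
      fun x => hC _
  have hint : Integrable fun t => ∫ᵛ x, η (t, x) ∂•(c.momentum t) := by
    refine Integrable.of_eval_piLp fun j => ?_
    simp_rw [integral_component (hηt _)]
    exact integrable_integral_family (h.measurable_component_momentum j)
      (h.lintegral_variation_component_momentum_lt_top j) hη hC
  rw [← integral_component hηT, h.momentum_eq η hηT]
  refine ((EuclideanSpace.proj (𝕜 := ℝ) i).integral_comp_comm hint).symm.trans ?_
  exact integral_congr_ae (ae_of_all _ fun t => integral_component (hηt t) i)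

end Families

section WeakDerivative

theorem setIntegral_Ici_unitInterval (W : ℝ → ℝ) (s : I) :
    ∫ t : I in Ici s, W t = ∫ x in (s : ℝ)..1, W x := by
  have hcomp : (Ici s).indicator (fun t : I => W t) = fun t : I => (Ici (s : ℝ)).indicator W t :=
    rfl
  have hIcc : Icc (0 : ℝ) 1 ∩ Ici ↑s = Icc ↑s 1 := by
    rw [inter_comm, ← Ici_inter_Iic, ← inter_assoc, Ici_inter_Ici, Ici_inter_Iic,
      sup_of_le_left s.2.1]
  rw [← integral_indicator measurableSet_Ici, hcomp,
    integral_subtype measurableSet_Icc (f := (Ici (s : ℝ)).indicator W),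
    setIntegral_indicator measurableSet_Ici, hIcc, intervalIntegral.integral_of_le s.2.2,
    integral_Icc_eq_integral_Ioc]

theorem continuous_setIntegral_Iic {G : I → ℝ} (hG : Integrable G) :
    Continuous fun t => ∫ s in Iic t, G s := by
  simp_rw [← integral_indicator measurableSet_Iic]
  refine continuous_iff_continuousAt.2 fun t₀ => ?_
  refine continuousAt_of_dominated (bound := fun s => ‖G s‖)
    (Eventually.of_forall fun t => (hG.indicator measurableSet_Iic).aestronglyMeasurable)
    (Eventually.of_forall fun t => ae_of_all _ fun s => norm_indicator_le_norm_self _ _)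
    hG.norm ?_
  have hne : ∀ᵐ s : I, s ≠ t₀ := by simp [ae_iff]
  filter_upwards [hne] with s hs
  rcases lt_or_gt_of_ne hs with hlt | hgt
  · refine ContinuousAt.congr (f := fun _ => G s) continuousAt_const ?_
    filter_upwards [Ioi_mem_nhds hlt] with t ht
    exact (indicator_of_mem (mem_Iic.2 (mem_Ioi.1 ht).le) G).symm
  · refine ContinuousAt.congr (f := fun _ => (0 : ℝ)) continuousAt_const ?_
    filter_upwards [Iio_mem_nhds hgt] with t ht
    exact (indicator_of_notMem (notMem_Iic.2 (mem_Iio.1 ht)) G).symm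

theorem integral_mul_setIntegral_Iic {w G : I → ℝ} (hw : Continuous w) (hG : Integrable G) :
    ∫ t, w t * ∫ s in Iic t, G s = ∫ s, G s * ∫ t in Ici s, w t := by
  have hwi : Integrable w := integrable_continuousMap ⟨w, hw⟩
  have hle : MeasurableSet {p : I × I | p.2 ≤ p.1} := measurableSet_le measurable_snd measurable_fst
  have hswap := integral_integral_swap (μ := volume) (ν := volume)
    (f := fun t s : I => {p : I × I | p.2 ≤ p.1}.indicator (fun p => w p.1 * G p.2) (t, s))
    ((hwi.mul_prod hG).indicator hle)
  convert hswap using 2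
  · ext t
    rw [← integral_indicator measurableSet_Iic, ← integral_const_mul]
    congr 1 with s
    by_cases h : s ≤ t <;> simp [indicator, h]
  · ext s
    rw [← integral_indicator measurableSet_Ici, ← integral_const_mul]
    congr 1 with t
    by_cases h : s ≤ t <;> simp [indicator, h, mul_comm]

theorem eq_zero_of_integral_sq_eq_zero {w : I → ℝ} (hw : Continuous w) (h : ∫ t, w t ^ 2 = 0)
    (t : I) : w t = 0 := by
  set W : ℝ → ℝ := IccExtend zero_le_one w
  have hW : ∀ t : I, W t = w t := IccExtend_val _ _
  have hWsq : Continuous fun x => W x ^ 2 := hw.Icc_extend'.pow 2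
  have hint : ∫ x in Icc (0 : ℝ) 1, W x ^ 2 = 0 := by
    rw [← integral_subtype measurableSet_Icc (f := fun x => W x ^ 2)]
    simpa only [hW] using h
  have hae := (setIntegral_eq_zero_iff_of_nonneg_ae (ae_of_all _ fun x => sq_nonneg (W x))
    (hWsq.continuousOn.integrableOn_compact isCompact_Icc)).1 hint
  have hzero := Measure.eqOn_Icc_of_ae_eq volume (zero_ne_one (α := ℝ)) hae hWsq.continuousOn
    continuousOn_const t.2
  simpa [hW] using hzero

theorem exists_contDiff_deriv_eq {w : I → ℝ} (hw : Continuous w) :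
    ∃ ψ : ℝ → ℝ, ContDiff ℝ 1 ψ ∧ ψ 1 = 0 ∧
      ∀ t : I, deriv ψ t = w t ∧ ∫ s in Ici t, w s = -ψ t := by
  set W : ℝ → ℝ := IccExtend zero_le_one w
  have hW : ∀ t : I, W t = w t := IccExtend_val _ _
  have hWc : Continuous W := hw.Icc_extend'
  set ψ : ℝ → ℝ := fun u => ∫ x in (1 : ℝ)..u, W x
  have hψ : ∀ u, HasDerivAt ψ (W u) u := fun u => (hWc.integral_hasStrictDerivAt 1 u).hasDerivAt
  have hderiv : deriv ψ = W := funext fun u => (hψ u).deriv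
  refine ⟨ψ, contDiff_one_iff_deriv.2 ⟨fun u => (hψ u).differentiableAt, hderiv ▸ hWc⟩,
    intervalIntegral.integral_same, fun t => ⟨by rw [hderiv, hW], ?_⟩⟩
  simp_rw [← hW]
  rw [setIntegral_Ici_unitInterval, intervalIntegral.integral_symm]

/- Testing with the primitive of the continuous function `w = F - A - ∫₀ᵗ G` vanishing at `t = 1`
yields `∫ w² = 0`. -/
theorem eq_add_setIntegral_of_weak_derivative {F G : I → ℝ} (hF : Continuous F) (hG : Integrable G)
    {A B : ℝ} (h : ∀ ψ : ℝ → ℝ, ContDiff ℝ 1 ψ →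
      0 = (∫ t : I, (deriv ψ t * F t + ψ t * G t)) - ψ 1 * B + ψ 0 * A) (t : I) :
    F t = A + ∫ s in Iic t, G s := by
  have hprim : Continuous fun t => ∫ s in Iic t, G s := continuous_setIntegral_Iic hG
  set w : I → ℝ := fun t => F t - (A + ∫ s in Iic t, G s)
  have hw : Continuous w := hF.sub (continuous_const.add hprim)
  obtain ⟨ψ, hψ, hψ1, hψw⟩ := exists_contDiff_deriv_eq hw
  have hwF : Integrable fun t => w t * F t := integrable_continuousMap ⟨_, hw.mul hF⟩
  have hwA : Integrable fun t => A * w t := integrable_continuousMap ⟨_, hw.const_mul A⟩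
  have hwG : Integrable fun t => w t * ∫ s in Iic t, G s :=
    integrable_continuousMap ⟨_, hw.mul hprim⟩
  have hψG : Integrable fun t : I => ψ t * G t :=
    integrable_continuousMap_mul hG ⟨_, hψ.continuous.comp continuous_subtype_val⟩
  have hmean : ∫ t, w t = -ψ 0 := by
    rw [← setIntegral_univ]
    exact Ici_bot (α := I) ▸ (hψw 0).2
  have hparts : ∫ t, w t * ∫ s in Iic t, G s = -∫ s : I, ψ s * G s := by
    rw [integral_mul_setIntegral_Iic hw hG, ← integral_neg]
    simp only [(hψw _).2, mul_neg, mul_comm]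
  have htest : ∫ t, w t * F t = -(∫ t : I, ψ t * G t) - ψ 0 * A := by
    have hψ' := h ψ hψ
    simp only [(hψw _).1] at hψ'
    rw [hψ1, integral_add hwF hψG] at hψ'
    linarith
  have hsq : ∫ t, w t ^ 2 = 0 := by
    have hexp : (fun t => w t ^ 2) = fun t => w t * F t - (A * w t + w t * ∫ s in Iic t, G s) := by
      ext t
      ring
    have hAG : Integrable fun t => A * w t + w t * ∫ s in Iic t, G s := hwA.add hwG
    rw [hexp, integral_sub hwF hAG, integral_add hwA hwG, integral_const_mul, htest, hmean, hparts]
    ring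
  exact sub_eq_zero.1 (eq_zero_of_integral_sq_eq_zero hw hsq t)

end WeakDerivative

section ContinuityEquation

variable {d : ℕ} {D : Set (Vec d)}

theorem compactSpace_of_isBounded (hD : Bornology.IsBounded D) : CompactSpace (Cl D) :=
  isCompact_iff_compactSpace.1 hD.isCompact_closure

theorem isFiniteMeasure_leb (hD : Bornology.IsBounded D) : IsFiniteMeasure (leb D) := by
  refine ⟨?_⟩
  rw [leb, comap_subtype_coe_apply isClosed_closure.measurableSet, image_univ, Subtype.range_coe]
  exact hD.isCompact_closure.measure_lt_top

theorem continuous_gradient {g : Vec d → ℝ} (hg : ContDiff ℝ 1 g) : Continuous (gradient g) :=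
  (InnerProductSpace.toDual ℝ (Vec d)).symm.continuous.comp (hg.continuous_fderiv one_ne_zero)

theorem gradient_const_mul {g : Vec d → ℝ} {x : Vec d} (hg : DifferentiableAt ℝ g x) (a : ℝ) :
    gradient (fun y => a * g y) x = a • gradient g x := by
  simp only [gradient, fderiv_const_mul hg, map_smulₛₗ, conj_trivial]

theorem integrable_inner_integral_family {S K : Type*} [MeasurableSpace S] [MeasurableSpace K]
    {m : Measure S} {ν : S → VectorMeasure K (Vec d)}
    (hν : ∀ B, MeasurableSet B → Measurable fun t => ν t B)
    (hfin : ∫⁻ t, (ν t).variation univ ∂m < ∞) {η : S × K → Vec d} (hη : Measurable η)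
    {C : ℝ} (hC : ∀ p, ‖η p‖ ≤ C) :
    Integrable (fun t => ∫ᵛ x, η (t, x) ∂[innerSL ℝ; ν t]) m := by
  have hproj : ∀ i : Fin d, Measurable fun v : Vec d => v i := fun i =>
    (EuclideanSpace.proj (𝕜 := ℝ) i).continuous.measurable
  have hsum : ∀ t, ∫ᵛ x, η (t, x) ∂[innerSL ℝ; ν t] = ∑ i, ∫ᵛ x, η (t, x) i ∂•component (ν t) i :=
    fun t => integral_inner_eq_sum (integrable_of_norm_le
      (hη.comp measurable_prodMk_left).stronglyMeasurable fun x => hC (t, x))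
  simp_rw [hsum]
  refine integrable_finsetSum _ fun i _ => integrable_integral_family (η := fun p => η p i)
    (fun B hB => ?_) ?_ ((hproj i).comp hη) fun p => (PiLp.norm_apply_le _ i).trans (hC p)
  · simp_rw [component_apply]
    exact (hproj i).comp (hν B hB)
  · exact (lintegral_mono fun t =>
      Measure.le_iff'.1 (variation_component_le (ν t) i) univ).trans_lt hfin

theorem continuous_integral_mass {S K : Type*} [TopologicalSpace S] [MeasurableSpace K]
    [TopologicalSpace K] [OpensMeasurableSpace K] [CompactSpace K] {μ : S → FiniteMeasure K}
    (hμ : Continuous μ) (g : C(K, ℝ)) : Continuous fun t => ∫ x, g x ∂(μ t : Measure K) :=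
  continuous_iff_continuousAt.2 fun t => FiniteMeasure.tendsto_iff_forall_integral_tendsto.1
    (hμ.tendsto t) (BoundedContinuousFunction.mkOfCompact g)

/-- The flux `∫ ∇g · dν_t + ∫ g dζ_t` of the observable `g`. Along a weak solution it is the weak
time derivative of `∫ g dμ_t`. -/
def flux (c : Curve D) (g : Vec d → ℝ) (t : I) : ℝ :=
  (∫ᵛ x : Cl D, gradient g (x : Vec d) ∂[innerSL ℝ; c.momentum t])
    + ∫ᵛ x : Cl D, g (x : Vec d) ∂•(c.source t)

variable [CompactSpace (Cl D)] {T : Triple D} {c : Curve D}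

theorem IsDisintegration.integrable_inner (h : IsDisintegration T c) (F : C(Cyl D, Vec d)) :
    Integrable fun t => ∫ᵛ x, F (t, x) ∂[innerSL ℝ; c.momentum t] :=
  integrable_inner_integral_family h.measurable_momentum h.finite_momentum F.continuous.measurable
    F.norm_coe_le_norm

theorem IsDisintegration.integrable_source (h : IsDisintegration T c) (G : C(Cyl D, ℝ)) :
    Integrable fun t => ∫ᵛ x, G (t, x) ∂•(c.source t) :=
  integrable_integral_family h.measurable_source h.finite_source G.continuous.measurable
    G.norm_coe_le_norm

theorem IsDisintegration.integrable_flux (h : IsDisintegration T c) {g : Vec d → ℝ}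
    (hg : ContDiff ℝ 1 g) : Integrable (flux c g) := by
  have hspace : Continuous fun p : Cyl D => (p.2 : Vec d) :=
    continuous_subtype_val.comp continuous_snd
  exact (h.integrable_inner ⟨fun p => gradient g p.2, (continuous_gradient hg).comp hspace⟩).add
    (h.integrable_source ⟨fun p => g p.2, hg.continuous.comp hspace⟩)

theorem IsWeakSolution.integral_mass_eq {μA μB : FiniteMeasure (Cl D)}
    (h : IsWeakSolution μA μB T c) {g : Vec d → ℝ} (hg : ContDiff ℝ 1 g) (t : I) :
    ∫ x : Cl D, g x ∂(c.mass t : Measure (Cl D)) =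
      ∫ x : Cl D, g x ∂(μA : Measure (Cl D)) + ∫ s in Iic t, flux c g s := by
  refine eq_add_setIntegral_of_weak_derivative
    (F := fun t => ∫ x : Cl D, g x ∂(c.mass t : Measure (Cl D)))
    (B := ∫ x : Cl D, g x ∂(μB : Measure (Cl D)))
    (continuous_integral_mass h.disintegration.continuous_mass
      ⟨fun x : Cl D => g x, hg.continuous.comp continuous_subtype_val⟩)
    (h.disintegration.integrable_flux hg) (fun ψ hψ => ?_) t
  have htest := h.equation (fun p => ψ p.1 * g p.2)
    ((hψ.comp contDiff_fst).mul (hg.comp contDiff_snd))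
  simp only [gradient_const_mul (hg.differentiable one_ne_zero _), integral_const_mul,
    VectorMeasure.integral_fun_smul, deriv_mul_const (hψ.differentiable one_ne_zero _)] at htest
  refine htest.trans ?_
  congr 3
  ext t
  have hsource : ∫ᵛ x : Cl D, ψ t * g x ∂•(c.source t) = ψ t * ∫ᵛ x : Cl D, g x ∂•(c.source t) :=
    VectorMeasure.integral_fun_smul _ _ (ψ t) _
  rw [hsource, flux, smul_eq_mul]
  ring

end ContinuityEquation

section UniformIntegrability

variable {K : Type*} [MeasurableSpace K]

/-- `b` is a modulus of absolute continuity in time for the measure `P` on `[0,1] × K`: the mass of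
`P` over a set `J` of times is at most `ε + b ε |J|`. Measures sharing a modulus have uniformly
absolutely continuous time marginals. -/
def HasTimeModulus (b : ℝ → NNReal) (P : Measure (I × K)) : Prop :=
  ∀ ε : ℝ, 0 < ε → ∀ J : Set I, MeasurableSet J →
    P (J ×ˢ univ) ≤ ENNReal.ofReal ε + b ε * volume J

variable {b b' : ℝ → NNReal} {P Q : Measure (I × K)}

theorem HasTimeModulus.mono (h : HasTimeModulus b P) (hb : b ≤ b') (hQ : Q ≤ P) :
    HasTimeModulus b' Q := fun ε hε J hJ => by
  refine (Measure.le_iff'.1 hQ _).trans ((h ε hε J hJ).trans ?_)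
  gcongr
  exact hb ε

theorem HasTimeModulus.add (hP : HasTimeModulus b P) (hQ : HasTimeModulus b' Q) :
    HasTimeModulus (fun ε => b (ε / 2) + b' (ε / 2)) (P + Q) := fun ε hε J hJ => by
  rw [Measure.add_apply]
  refine (add_le_add (hP (ε / 2) (half_pos hε) J hJ)
    (hQ (ε / 2) (half_pos hε) J hJ)).trans_eq ?_
  rw [add_add_add_comm, ← ENNReal.ofReal_add (half_pos hε).le (half_pos hε).le, add_halves,
    ENNReal.coe_add, add_mul]

theorem HasTimeModulus.measure_univ_le (h : HasTimeModulus b P) : P univ ≤ (1 + b 1 : NNReal) := by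
  simpa using h 1 one_pos univ MeasurableSet.univ

theorem HasTimeModulus.fst_absolutelyContinuous (h : HasTimeModulus b P) : P.fst ≪ volume := by
  refine Measure.AbsolutelyContinuous.mk fun J hJ hJ0 => ?_
  rw [Measure.fst_apply hJ, ← prod_univ, ← le_zero_iff]
  refine ENNReal.le_of_forall_pos_le_add fun ε hε _ => ?_
  simpa [hJ0] using h ε (NNReal.coe_pos.2 hε) J hJ

theorem measure_le_of_tendsto_of_isOpen {Y : Type*} [PseudoMetricSpace Y] [MeasurableSpace Y]
    [BorelSpace Y] {P : ℕ → FiniteMeasure Y} {P' : FiniteMeasure Y} (hP : Tendsto P atTop (𝓝 P'))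
    {U : Set Y} (hU : IsOpen U) {a : ℝ≥0∞} (ha : ∀ n, (P n : Measure Y) U ≤ a) :
    (P' : Measure Y) U ≤ a := by
  refine le_of_forall_lt fun m hm => ?_
  obtain ⟨F, hFU, hF, hmF⟩ := hU.exists_lt_isClosed hm
  obtain ⟨ψ, hψ0, hψ1, hψ⟩ := exists_bounded_zero_one_of_closed hU.isClosed_compl hF
    (disjoint_compl_left.mono_right hFU)
  have hlim := ENNReal.tendsto_ofReal (FiniteMeasure.tendsto_iff_forall_integral_tendsto.1 hP ψ)
  have hupper : ∀ n, ENNReal.ofReal (∫ y, ψ y ∂(P n : Measure Y)) ≤ a := fun n => by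
    refine (ofReal_integral_le_lintegral _).trans (le_trans ?_ (ha n))
    rw [← lintegral_indicator_one hU.measurableSet]
    refine lintegral_mono fun y => ?_
    by_cases hy : y ∈ U
    · simpa [hy] using (hψ y).2
    · simp [hy, hψ0 hy]
  have hlower : (P' : Measure Y) F ≤ ENNReal.ofReal (∫ y, ψ y ∂(P' : Measure Y)) := by
    rw [ofReal_integral_eq_lintegral_ofReal (ψ.integrable _) (ae_of_all _ fun y => (hψ y).1),
      ← lintegral_indicator_one hF.measurableSet]
    refine lintegral_mono fun y => ?_
    by_cases hy : y ∈ F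
    · simp [hy, hψ1 hy]
    · simp [hy]
  exact hmF.trans_le (hlower.trans (le_of_tendsto hlim (Eventually.of_forall hupper)))

variable [MetricSpace K] [CompactSpace K] [BorelSpace K]

theorem HasTimeModulus.of_tendsto {P : ℕ → FiniteMeasure (I × K)} {P' : FiniteMeasure (I × K)}
    (h : ∀ n, HasTimeModulus b (P n : Measure (I × K))) (hP : Tendsto P atTop (𝓝 P')) :
    HasTimeModulus b (P' : Measure (I × K)) := fun ε hε J _ => by
  have hcont : Tendsto (fun v => ENNReal.ofReal ε + b ε * v) (𝓝[>] volume J)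
      (𝓝 (ENNReal.ofReal ε + b ε * volume J)) :=
    (ENNReal.Tendsto.const_mul tendsto_id (Or.inr ENNReal.coe_ne_top)).const_add _
      |>.mono_left nhdsWithin_le_nhds
  have : (𝓝[>] volume J).NeBot := nhdsGT_neBot_of_exists_gt ⟨∞, measure_lt_top volume J⟩
  refine ge_of_tendsto hcont (eventually_mem_nhdsWithin.mono fun v hv => ?_)
  obtain ⟨U, hJU, hU, hUv⟩ := J.exists_isOpen_lt_of_lt v hv
  calc (P' : Measure (I × K)) (J ×ˢ univ)
      ≤ (P' : Measure (I × K)) (U ×ˢ univ) := measure_mono (prod_mono_left hJU)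
    _ ≤ ENNReal.ofReal ε + b ε * volume U :=
        measure_le_of_tendsto_of_isOpen hP (hU.prod isOpen_univ) fun n =>
          h n ε hε U hU.measurableSet
    _ ≤ ENNReal.ofReal ε + b ε * v := by gcongr

theorem exists_subseq_tendsto_finiteMeasure {ι Y : Type*} [Finite ι] [MetricSpace Y]
    [CompactSpace Y] [MeasurableSpace Y] [BorelSpace Y] (P : ℕ → ι → FiniteMeasure Y)
    {M : ι → NNReal} (hM : ∀ n i, (P n i).mass ≤ M i) :
    ∃ (φ : ℕ → ℕ) (P' : ι → FiniteMeasure Y), StrictMono φ ∧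
      ∀ i, Tendsto (fun n => P (φ n) i) atTop (𝓝 (P' i)) := by
  cases isEmpty_or_nonempty Y with
  | inl _ =>
    have : Subsingleton (FiniteMeasure Y) := Subtype.val_injective.subsingleton
    exact ⟨id, P 0, strictMono_id, fun i => by
      simp only [Subsingleton.elim _ (P 0 i), tendsto_const_nhds]⟩
  | inr _ =>
    have := Fintype.ofFinite ι
    obtain ⟨⟨Q, m⟩, φ, hφ, hlim⟩ := CompactSpace.tendsto_subseq
      (X := (ι → ProbabilityMeasure Y) × ((i : ι) → Icc (0 : NNReal) (M i)))
      fun n => (fun i => (P n i).normalize, fun i => ⟨(P n i).mass, zero_le, hM n i⟩)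
    have hQ : ∀ i, Tendsto (fun n => (P (φ n) i).normalize) atTop (𝓝 (Q i)) :=
      tendsto_pi_nhds.1 hlim.fst_nhds
    have hm : ∀ i, Tendsto (fun n => (P (φ n) i).mass) atTop (𝓝 (m i : NNReal)) := fun i =>
      (continuous_subtype_val.tendsto _).comp (tendsto_pi_nhds.1 hlim.snd_nhds i)
    refine ⟨φ, fun i => (m i : NNReal) • (Q i).toFiniteMeasure, hφ, fun i => ?_⟩
    have hsmul := (hm i).smul ((ProbabilityMeasure.toFiniteMeasure_continuous.tendsto _).comp
      (hQ i))
    refine hsmul.congr fun n => ?_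
    exact (FiniteMeasure.self_eq_mass_smul_normalize _).symm

theorem integral_toSignedMeasure_sub {Y : Type*} [MeasurableSpace Y] {A B : Measure Y}
    [IsFiniteMeasure A] [IsFiniteMeasure B] {f : Y → ℝ} (hA : Integrable f A)
    (hB : Integrable f B) :
    ∫ᵛ y, f y ∂•(A.toSignedMeasure - B.toSignedMeasure) = ∫ y, f y ∂A - ∫ y, f y ∂B := by
  have hflip : (ContinuousLinearMap.lsmul ℝ ℝ : ℝ →L[ℝ] ℝ →L[ℝ] ℝ).flip =
      ContinuousLinearMap.lsmul ℝ ℝ := by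
    ext
    simp
  have hint : ∀ {P : Measure Y} [IsFiniteMeasure P], Integrable f P →
      P.toSignedMeasure.Integrable f := fun h => by
    rwa [VectorMeasure.Integrable, Measure.variation_toSignedMeasure]
  rw [VectorMeasure.integral_sub_vectorMeasure (hint hA) (hint hB), ← hflip,
    VectorMeasure.integral_toSignedMeasure, VectorMeasure.integral_toSignedMeasure]

theorem exists_subseq_tendsto_signedMeasure {ι : Type*} [Finite ι]
    {τ : ι → ℕ → SignedMeasure (I × K)} {b : ι → ℝ → NNReal}
    (h : ∀ i n, HasTimeModulus (b i) (τ i n).variation) :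
    ∃ (φ : ℕ → ℕ) (τ' : ι → SignedMeasure (I × K)), StrictMono φ ∧
      ∀ i, (∃ b', HasTimeModulus b' (τ' i).variation) ∧ ∀ f : C(I × K, ℝ),
        Tendsto (fun n => ∫ᵛ p, f p ∂•(τ i (φ n))) atTop (𝓝 (∫ᵛ p, f p ∂•(τ' i))) := by
  set P : ℕ → ι × Bool → FiniteMeasure (I × K) := fun n p =>
    bif p.2 then ⟨(τ p.1 n).toJordanDecomposition.posPart, inferInstance⟩
    else ⟨(τ p.1 n).toJordanDecomposition.negPart, inferInstance⟩
  have hmod : ∀ p n, HasTimeModulus (b p.1) (P n p : Measure (I × K)) := fun ⟨i, s⟩ n => by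
    refine (h i n).mono le_rfl ?_
    rw [← SignedMeasure.totalVariation_eq_variation, SignedMeasure.totalVariation]
    cases s
    · exact Measure.le_add_left le_rfl
    · exact Measure.le_add_right le_rfl
  obtain ⟨φ, P', hφ, hlim⟩ := exists_subseq_tendsto_finiteMeasure P fun n p =>
    ENNReal.coe_le_coe.1 ((P n p).ennreal_mass.trans_le (hmod p n).measure_univ_le)
  refine ⟨φ, fun i => (P' (i, true) : Measure (I × K)).toSignedMeasure
    - (P' (i, false) : Measure (I × K)).toSignedMeasure, hφ, fun i => ⟨?_, fun f => ?_⟩⟩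
  · have hmod' : ∀ s, HasTimeModulus (b i) (P' (i, s) : Measure (I × K)) := fun s =>
      .of_tendsto (fun n => hmod (i, s) (φ n)) (hlim (i, s))
    refine ⟨_, ((hmod' true).add (hmod' false)).mono le_rfl
      (VectorMeasure.variation_sub_le.trans ?_)⟩
    rw [Measure.variation_toSignedMeasure, Measure.variation_toSignedMeasure]
  · rw [integral_toSignedMeasure_sub (integrable_continuousMap f) (integrable_continuousMap f)]
    have hlim' := fun s => FiniteMeasure.tendsto_iff_forall_integral_tendsto.1 (hlim (i, s))
      (BoundedContinuousFunction.mkOfCompact f)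
    refine ((hlim' true).sub (hlim' false)).congr fun n => ?_
    rw [← (τ i (φ n)).toSignedMeasure_toJordanDecomposition, JordanDecomposition.toSignedMeasure,
      integral_toSignedMeasure_sub (integrable_continuousMap f) (integrable_continuousMap f)]
    rfl

theorem norm_indicator_sub_mul_le {Y : Type*} {S U : Set Y} {ψ : Y → ℝ} (hψ0 : EqOn ψ 0 Uᶜ)
    (hψ1 : EqOn ψ 1 S) (hψ : ∀ y, ψ y ∈ Icc (0 : ℝ) 1) {f : Y → ℝ} {C : ℝ}
    (hC : ∀ y, ‖f y‖ ≤ C) (y : Y) :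
    ‖S.indicator f y - ψ y * f y‖ ≤ (U \ S).indicator (fun _ => C) y := by
  by_cases hS : y ∈ S
  · simp [hS, hψ1 hS]
  · by_cases hU : y ∈ U
    · simpa [hS, hU, abs_of_nonneg (hψ y).1] using
        (mul_le_of_le_one_left (abs_nonneg _) (hψ y).2).trans (hC y)
    · simp [hS, hU, hψ0 hU]

theorem exists_abs_integral_indicator_sub_le {S : Set I} (hS : IsClosed S) (f : C(I × K, ℝ))
    (b : ℝ → NNReal) {ε : ℝ} (hε : 0 < ε) :
    ∃ g : C(I × K, ℝ), ∀ θ : SignedMeasure (I × K), HasTimeModulus b θ.variation →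
      |∫ᵛ p, (S ×ˢ univ).indicator f p ∂•θ - ∫ᵛ p, g p ∂•θ| ≤ ε := by
  set C := ‖f‖ + 1
  have hC : 0 < C := by positivity
  have hfC : ∀ p, ‖f p‖ ≤ C := fun p =>
    (f.norm_coe_le_norm p).trans (le_add_of_nonneg_right zero_le_one)
  set e := ε / (2 * C) with he
  have he0 : 0 < e := by positivity
  obtain ⟨U, hSU, hU, -, hUS⟩ := hS.measurableSet.exists_isOpen_sdiff_lt (measure_ne_top volume S)
    (ENNReal.div_pos (ENNReal.ofReal_pos.2 he0).ne' (ENNReal.coe_ne_top (r := b e))).ne'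
  obtain ⟨ψ, hψ0, hψ1, hψ⟩ := exists_continuous_zero_one_of_isClosed hU.isClosed_compl hS
    (disjoint_compl_left.mono_right hSU)
  have hmeas : MeasurableSet ((U \ S) ×ˢ (univ : Set K)) :=
    (hU.measurableSet.diff hS.measurableSet).prod MeasurableSet.univ
  refine ⟨ψ.comp ContinuousMap.fst * f, fun θ hθ => ?_⟩
  have hvar : θ.variation ((U \ S) ×ˢ univ) ≤ ENNReal.ofReal e + ENNReal.ofReal e := by
    refine (hθ e he0 _ (hU.measurableSet.diff hS.measurableSet)).trans ?_
    gcongr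
    exact (mul_le_mul_right hUS.le _).trans ENNReal.mul_div_le
  have hbound : ∀ p : I × K, ‖(S ×ˢ univ).indicator f p - ψ p.1 * f p‖
      ≤ ((U \ S) ×ˢ univ).indicator (fun _ => C) p := fun p => by
    rw [prod_univ, prod_univ]
    exact norm_indicator_sub_mul_le (ψ := fun p : I × K => ψ p.1) (fun _ hp => hψ0 hp)
      (fun _ hp => hψ1 hp) (fun p => hψ p.1) hfC p
  have hint : θ.Integrable ((S ×ˢ univ).indicator f) :=
    Integrable.indicator (integrable_continuousMap f) (hS.measurableSet.prod MeasurableSet.univ)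
  rw [← VectorMeasure.integral_fun_sub hint (integrable_continuousMap _), ← Real.norm_eq_abs,
    ← ENNReal.ofReal_le_ofReal_iff hε.le, ofReal_norm]
  calc _ ≤ ENNReal.ofReal C * θ.variation ((U \ S) ×ˢ univ) :=
        enorm_integral_le_mul_variation_of_norm_le_indicator θ hmeas hbound
    _ ≤ ENNReal.ofReal C * (ENNReal.ofReal e + ENNReal.ofReal e) := by gcongr
    _ = ENNReal.ofReal ε := by
        rw [← ENNReal.ofReal_add he0.le he0.le, ← ENNReal.ofReal_mul hC.le, he]
        congr 1
        field_simp
        norm_num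

theorem tendsto_integral_indicator {τ : ℕ → SignedMeasure (I × K)} {τ' : SignedMeasure (I × K)}
    (h : ∀ n, HasTimeModulus b (τ n).variation) (h' : HasTimeModulus b' τ'.variation)
    (hlim : ∀ f : C(I × K, ℝ), Tendsto (fun n => ∫ᵛ p, f p ∂•(τ n)) atTop (𝓝 (∫ᵛ p, f p ∂•τ')))
    {S : Set I} (hS : IsClosed S) (f : C(I × K, ℝ)) :
    Tendsto (fun n => ∫ᵛ p, (S ×ˢ univ).indicator f p ∂•(τ n)) atTop
      (𝓝 (∫ᵛ p, (S ×ˢ univ).indicator f p ∂•τ')) := by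
  refine Metric.tendsto_atTop.2 fun ε hε => ?_
  obtain ⟨g, hg⟩ := exists_abs_integral_indicator_sub_le hS f (b ⊔ b') (ε := ε / 3) (by positivity)
  obtain ⟨N, hN⟩ := Metric.tendsto_atTop.1 (hlim g) (ε / 3) (by positivity)
  refine ⟨N, fun n hn => ?_⟩
  have hn' := abs_le.1 (hg (τ n) ((h n).mono le_sup_left le_rfl))
  have hlim' := abs_le.1 (hg τ' (h'.mono le_sup_right le_rfl))
  have hN' := abs_lt.1 (hN n hn)
  rw [Real.dist_eq, abs_lt]
  constructor <;> linarith [hn'.1, hn'.2, hlim'.1, hlim'.2, hN'.1, hN'.2]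

end UniformIntegrability

section Bounds

theorem setLIntegral_le_mul_add {S : Type*} [MeasurableSpace S] {m : Measure S} {f E : S → ℝ≥0∞}
    {a b : ℝ≥0∞} (ha : a ≠ ∞) (h : ∀ t, f t ≤ a * E t + b) (J : Set S) :
    ∫⁻ t in J, f t ∂m ≤ a * (∫⁻ t, E t ∂m) + b * m J := by
  refine (lintegral_mono fun t => h t).trans ?_
  rw [lintegral_add_right _ measurable_const, lintegral_const_mul' _ _ ha, setLIntegral_const]
  gcongr
  exact Measure.restrict_le_self

theorem ofReal_div_mul_le {ε : ℝ} (hε : 0 ≤ ε) (C : NNReal) :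
    ENNReal.ofReal (ε / (C + 1)) * C ≤ ENNReal.ofReal ε := by
  rw [← ENNReal.ofReal_coe_nnreal, ← ENNReal.ofReal_mul (by positivity)]
  refine ENNReal.ofReal_le_ofReal ?_
  rw [div_mul_eq_mul_div, div_le_iff₀ (by positivity)]
  gcongr
  exact le_add_of_nonneg_right zero_le_one

theorem IsSignedDisintegration.exists_hasTimeModulus {K ι : Type*} [MeasurableSpace K]
    {τ : ι → SignedMeasure (I × K)} {s : ι → I → SignedMeasure K}
    (h : ∀ n, IsSignedDisintegration (τ n) (s n)) {E : ι → I → ℝ≥0∞} {C : NNReal}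
    (hE : ∀ n, ∫⁻ t, E n t ≤ C)
    (hs : ∀ ε > 0, ∃ b : NNReal, ∀ n t, (s n t).variation univ ≤ ENNReal.ofReal ε * E n t + b) :
    ∃ b, ∀ n, HasTimeModulus b (τ n).variation := by
  choose! b hb using hs
  refine ⟨fun ε => 2 * b (ε / 2 / (C + 1)), fun n ε hε J hJ => ?_⟩
  set e := ε / 2 / (C + 1)
  have he : 0 < e := by positivity
  calc (τ n).variation (J ×ˢ univ)
      ≤ 2 * ∫⁻ t in J, (s n t).variation univ := (h n).variation_le hJ
    _ ≤ 2 * (ENNReal.ofReal e * (∫⁻ t, E n t) + b e * volume J) := by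
        gcongr
        exact setLIntegral_le_mul_add ENNReal.ofReal_ne_top (hb e he n) J
    _ ≤ 2 * (ENNReal.ofReal (ε / 2) + b e * volume J) := by
        gcongr
        exact (mul_le_mul_right (hE n) _).trans (ofReal_div_mul_le (half_pos hε).le C)
    _ = ENNReal.ofReal ε + (2 * b e : NNReal) * volume J := by
        rw [mul_add, ← mul_assoc, ENNReal.coe_mul, ENNReal.coe_ofNat, ← ENNReal.ofReal_ofNat 2,
          ← ENNReal.ofReal_mul zero_le_two, mul_div_cancel₀ _ two_ne_zero]

variable {d : ℕ} {r : ℝ → ℝ} {δ : ℝ}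

theorem sourceAction_le_mul_energyDensity {X : Type*} [MeasurableSpace X] (hδ : 0 < δ)
    (l : Measure X) (μ : FiniteMeasure X) (ν : VectorMeasure X (Vec d)) (ζ : SignedMeasure X) :
    sourceAction r l μ ν ζ ≤ ENNReal.ofReal δ * energyDensity δ r l μ ν ζ :=
  calc sourceAction r l μ ν ζ
      = ENNReal.ofReal δ * (ENNReal.ofReal (1 / δ) * sourceAction r l μ ν ζ) := by
        rw [← mul_assoc, ← ENNReal.ofReal_mul hδ.le, mul_one_div_cancel hδ.ne',
          ENNReal.ofReal_one, one_mul]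
    _ ≤ ENNReal.ofReal δ * energyDensity δ r l μ ν ζ := by
        gcongr
        exact le_add_self

theorem IsCoercivePenalty.exists_variation_le_mul_energyDensity_add {X : Type*}
    [MeasurableSpace X] (hr : IsCoercivePenalty r) (d : ℕ) (hδ : 0 < δ) (l : Measure X)
    [IsFiniteMeasure l] {ε : ℝ} (hε : 0 < ε) :
    ∃ b : NNReal, ∀ (μ : FiniteMeasure X) (ν : VectorMeasure X (Vec d)) (ζ : SignedMeasure X),
      ζ.variation univ ≤ ENNReal.ofReal ε * energyDensity δ r l μ ν ζ + b := by
  obtain ⟨κ, C, hκ, hκC⟩ := hr.exists_abs_le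
  set e := ε / ((κ * δ).toNNReal + 1)
  have he : 0 < e := by positivity
  set b := ENNReal.ofReal κ * ENNReal.ofReal (1 / e) + ENNReal.ofReal C * l univ
  have hb : b ≠ ∞ := by finiteness
  refine ⟨b.toNNReal, fun μ ν ζ => ?_⟩
  have hcoef : ENNReal.ofReal e * ENNReal.ofReal (κ * δ) ≤ ENNReal.ofReal ε :=
    ofReal_div_mul_le hε.le _
  calc ζ.variation univ
      ≤ ENNReal.ofReal κ * (ENNReal.ofReal e * sourceAction r l μ ν ζ + ENNReal.ofReal (1 / e))
        + ENNReal.ofReal C * l univ := variation_le_mul_sourceAction_add hκ hκC he l μ ν ζ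
    _ = ENNReal.ofReal κ * (ENNReal.ofReal e * sourceAction r l μ ν ζ) + b := by
        rw [mul_add, add_assoc]
    _ ≤ ENNReal.ofReal κ * (ENNReal.ofReal e * (ENNReal.ofReal δ * energyDensity δ r l μ ν ζ))
        + b := by
        gcongr
        exact sourceAction_le_mul_energyDensity hδ l μ ν ζ
    _ = ENNReal.ofReal e * ENNReal.ofReal (κ * δ) * energyDensity δ r l μ ν ζ + b := by
        rw [ENNReal.ofReal_mul hκ]
        ring
    _ ≤ ENNReal.ofReal ε * energyDensity δ r l μ ν ζ + b.toNNReal := by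
        rw [ENNReal.coe_toNNReal hb]
        gcongr

variable {D : Set (Vec d)} {ι : Type*} {T : ι → Triple D} {c : ι → Curve D} {C : NNReal}

theorem exists_hasTimeModulus_source [IsFiniteMeasure (leb D)] (hr : IsCoercivePenalty r)
    (hδ : 0 < δ) (hT : ∀ n, IsDisintegration (T n) (c n)) (hC : ∀ n, pathEnergy δ r (c n) ≤ C) :
    ∃ b, ∀ n, HasTimeModulus b (T n).source.variation :=
  IsSignedDisintegration.exists_hasTimeModulus (fun n => (hT n).isSignedDisintegration_source) hC
    fun _ hε => (hr.exists_variation_le_mul_energyDensity_add d hδ (leb D) hε).imp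
      fun _ hb _ _ => hb _ _ _

theorem exists_hasTimeModulus_component_momentum
    (hT : ∀ n, IsDisintegration (T n) (c n)) (hC : ∀ n, pathEnergy δ r (c n) ≤ C)
    {M : NNReal} (hM : ∀ n t, ((c n).mass t).mass ≤ M) (i : Fin d) :
    ∃ b, ∀ n, HasTimeModulus b (component (T n).momentum i).variation := by
  refine IsSignedDisintegration.exists_hasTimeModulus
    (fun n => (hT n).isSignedDisintegration_component_momentum i) hC fun ε hε => ?_
  refine ⟨(2 / ε).toNNReal * M, fun n t => ?_⟩
  calc (component ((c n).momentum t) i).variation univ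
      ≤ ((c n).momentum t).variation univ := Measure.le_iff'.1 (variation_component_le _ i) univ
    _ ≤ ENNReal.ofReal ε * transportAction (leb D) ((c n).mass t) ((c n).momentum t)
          ((c n).source t) + ENNReal.ofReal (2 / ε) * ((c n).mass t : Measure (Cl D)) univ :=
        variation_le_mul_transportAction_add hε _ _ _ _
    _ ≤ _ := by
        rw [ENNReal.coe_mul, ← FiniteMeasure.ennreal_mass]
        gcongr
        · exact le_self_add
        · exact le_rfl
        · exact hM n t

theorem enorm_flux_one_le (c : Curve D) (t : I) :
    ‖flux c (fun _ => 1) t‖ₑ ≤ (c.source t).variation univ := by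
  have hflux : flux c (fun _ => 1) t = ∫ᵛ _ : Cl D, (1 : ℝ) ∂•(c.source t) := by
    simp only [flux, gradient_fun_const, VectorMeasure.integral_zero, zero_add]
  rw [hflux]
  simpa using enorm_integral_le_mul_variation (c.source t) (η := fun _ => (1 : ℝ)) (C := 1)
    fun _ => norm_one.le

theorem exists_mass_le [CompactSpace (Cl D)] [IsFiniteMeasure (leb D)] (hr : IsCoercivePenalty r)
    (hδ : 0 < δ) {μA μB : FiniteMeasure (Cl D)} (hT : ∀ n, IsWeakSolution μA μB (T n) (c n))
    (hC : ∀ n, pathEnergy δ r (c n) ≤ C) : ∃ M : NNReal, ∀ n t, ((c n).mass t).mass ≤ M := by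
  obtain ⟨b, hb⟩ := hr.exists_variation_le_mul_energyDensity_add d hδ (leb D) one_pos
  refine ⟨μA.mass + (C + b), fun n t => ?_⟩
  have hbalance := (hT n).integral_mass_eq (g := fun _ => 1) contDiff_const t
  simp only [integral_const, smul_eq_mul, mul_one] at hbalance
  have hflux : ‖∫ s in Iic t, flux (c n) (fun _ => 1) s‖ₑ ≤ (C + b : NNReal) := by
    refine (enorm_integral_le_lintegral_enorm _).trans ((setLIntegral_le_mul_add
      ENNReal.ofReal_ne_top (fun s => (enorm_flux_one_le (c n) s).trans
        (hb ((c n).mass s) ((c n).momentum s) ((c n).source s))) _).trans ?_)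
    rw [ENNReal.ofReal_one, one_mul, ENNReal.coe_add]
    exact add_le_add (hC n) (mul_le_of_le_one_right zero_le prob_le_one)
  rw [← ofReal_norm, ENNReal.ofReal_le_coe] at hflux
  rw [← NNReal.coe_le_coe, NNReal.coe_add]
  exact hbalance.trans_le (add_le_add_right ((le_abs_self _).trans hflux) _)

end Bounds

section Disintegration

open ProbabilityTheory

variable {S K : Type*} [MeasurableSpace S] [MeasurableSpace K] {m : Measure S}

theorem exists_kernel_of_fst_absolutelyContinuous [SigmaFinite m] [StandardBorelSpace K]
    [Nonempty K] (l : Measure (S × K)) [IsFiniteMeasure l] (hl : l.fst ≪ m) :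
    ∃ κ : Kernel S K, IsSFiniteKernel κ ∧ (∀ t, IsFiniteMeasure (κ t)) ∧ l = m ⊗ₘ κ := by
  set ρ : S → NNReal := fun t => (l.fst.rnDeriv m t).toNNReal
  have hρ : Measurable ρ := (Measure.measurable_rnDeriv _ _).ennreal_toNNReal
  have hfst : l.fst = m.withDensity fun t => (ρ t : ℝ≥0∞) := by
    conv_lhs => rw [← Measure.withDensity_rnDeriv_eq _ _ hl]
    refine withDensity_congr_ae ?_
    filter_upwards [Measure.rnDeriv_lt_top l.fst m] with t ht
    exact (ENNReal.coe_toNNReal ht.ne).symm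
  set κ : Kernel S K := l.condKernel.withDensity fun t _ => (ρ t : ℝ≥0∞) with hκ
  have hκt : ∀ t, κ t = (ρ t : ℝ≥0∞) • l.condKernel t := fun t => by
    rw [hκ, Kernel.withDensity_apply _ (hρ.comp measurable_fst).coe_nnreal_ennreal,
      withDensity_const]
  have hsfinite : IsSFiniteKernel κ :=
    Kernel.IsSFiniteKernel.withDensity _ fun _ _ => ENNReal.coe_ne_top
  refine ⟨κ, hsfinite, fun t => ⟨?_⟩, Measure.ext_of_lintegral _ fun f hf => ?_⟩
  · rw [hκt, Measure.smul_apply, smul_eq_mul]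
    exact ENNReal.mul_lt_top ENNReal.coe_lt_top (measure_lt_top _ _)
  · conv_lhs => rw [← Measure.disintegrate l l.condKernel]
    rw [Measure.lintegral_compProd hf, Measure.lintegral_compProd hf, hfst,
      lintegral_withDensity_eq_lintegral_mul _ hρ.coe_nnreal_ennreal
        hf.lintegral_kernel_prod_right']
    refine lintegral_congr fun t => ?_
    rw [hκt, lintegral_smul_measure, Pi.mul_apply, smul_eq_mul]

variable {E : Type*} [NormedAddCommGroup E] [NormedSpace ℝ E]

theorem variation_withDensityᵥ_le [CompleteSpace E] {X : Type*} [MeasurableSpace X]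
    {l : Measure X} {h : X → E} (hh : Integrable h l) (hb : ∀ x, ‖h x‖ ≤ 1) :
    (l.withDensityᵥ h).variation ≤ l := by
  rw [Measure.variation_withDensityᵥ hh]
  conv_rhs => rw [← withDensity_one (μ := l)]
  refine withDensity_mono (ae_of_all _ fun x => ?_)
  change ‖h x‖ₑ ≤ 1
  rw [← ofReal_norm, ← ENNReal.ofReal_one]
  exact ENNReal.ofReal_le_ofReal (hb x)

variable [MeasurableSpace E] [BorelSpace E]

theorem exists_bounded_withDensityᵥ_eq [CompleteSpace E] {X : Type*} [MeasurableSpace X]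
    {l : Measure X} [SigmaFinite l] {k : X → E} (hk : Integrable k l) (hkm : Measurable k)
    (hv : (l.withDensityᵥ k).variation = l) :
    ∃ h : X → E, Measurable h ∧ (∀ x, ‖h x‖ ≤ 1) ∧ l.withDensityᵥ h = l.withDensityᵥ k := by
  have hball : MeasurableSet {x | ‖k x‖ ≤ 1} := measurableSet_le hkm.norm measurable_const
  have hdensity : l.withDensity (fun x => ‖k x‖ₑ) = l.withDensity 1 := by
    rw [← Measure.variation_withDensityᵥ hk, hv, withDensity_one]
  have hnorm := (withDensity_eq_iff_of_sigmaFinite hkm.enorm.aemeasurable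
    measurable_one.aemeasurable).1 hdensity
  refine ⟨{x | ‖k x‖ ≤ 1}.indicator k, hkm.indicator hball, fun x => ?_,
    WithDensityᵥEq.congr_ae ?_⟩
  · by_cases hx : x ∈ {x | ‖k x‖ ≤ 1}
    · rwa [indicator_of_mem hx]
    · rw [indicator_of_notMem hx, norm_zero]
      exact zero_le_one
  · filter_upwards [hnorm] with x hx
    rw [← ofReal_norm] at hx
    have hx' : x ∈ {x | ‖k x‖ ≤ 1} := (ENNReal.ofReal_eq_one.1 hx).le
    exact indicator_of_mem hx' k

variable [SecondCountableTopology E]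

theorem measurable_withDensityᵥ_apply (κ : Kernel S K) [IsSFiniteKernel κ] {h : S × K → E}
    (hm : Measurable h) (hi : ∀ t, Integrable (fun x => h (t, x)) (κ t)) {B : Set K}
    (hB : MeasurableSet B) : Measurable fun t => (κ t).withDensityᵥ (fun x => h (t, x)) B := by
  have hind : ∀ t, (κ t).withDensityᵥ (fun x => h (t, x)) B =
      ∫ x, (univ ×ˢ B).indicator h (t, x) ∂(κ t) := fun t => by
    rw [withDensityᵥ_apply (hi t) hB, ← integral_indicator hB]
    congr 1 with x
    by_cases hx : x ∈ B <;> simp [hx, indicator]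
  simp_rw [hind]
  exact (StronglyMeasurable.integral_kernel_prod_right' (κ := κ)
    (hm.indicator (MeasurableSet.univ.prod hB)).stronglyMeasurable).measurable

variable [CompleteSpace E]

theorem integral_withDensityᵥ_compProd [SFinite m] (κ : Kernel S K) [IsSFiniteKernel κ]
    [∀ t, IsFiniteMeasure (κ t)] [IsFiniteMeasure (m ⊗ₘ κ)] {h : S × K → E} (hm : Measurable h)
    (hb : ∀ p, ‖h p‖ ≤ 1) {η : S × K → ℝ} (hη : Integrable η (m ⊗ₘ κ)) :
    ∫ᵛ p, η p ∂•((m ⊗ₘ κ).withDensityᵥ h) =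
      ∫ t, ∫ᵛ x, η (t, x) ∂•((κ t).withDensityᵥ fun x => h (t, x)) ∂m := by
  have hi : Integrable h (m ⊗ₘ κ) := integrable_of_norm_le hm.stronglyMeasurable hb
  have hit : ∀ t, Integrable (fun x => h (t, x)) (κ t) := fun t =>
    integrable_of_norm_le (hm.comp measurable_prodMk_left).stronglyMeasurable fun x => hb (t, x)
  have hηh : Integrable (fun p => η p • h p) (m ⊗ₘ κ) :=
    hη.smul_of_top_left (memLp_top_of_bound hm.aestronglyMeasurable 1 (ae_of_all _ hb))
  rw [integral_withDensityᵥ hi _ (hη.mono_measure (variation_withDensityᵥ_le hi hb))]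
  refine (Measure.integral_compProd hηh).trans (integral_congr_ae ?_)
  filter_upwards [((Measure.integrable_compProd_iff hη.1).1 hη).1] with t ht
  rw [integral_withDensityᵥ (hit t) _
    (ht.mono_measure (variation_withDensityᵥ_le (hit t) fun x => hb (t, x)))]
  rfl

theorem exists_disintegration_withDensityᵥ [SigmaFinite m] [StandardBorelSpace K]
    (l : Measure (S × K)) [IsFiniteMeasure l] (hl : l.fst ≪ m) {h : S × K → E}
    (hm : Measurable h) (hb : ∀ p, ‖h p‖ ≤ 1) :
    ∃ s : S → VectorMeasure K E, (∀ B, MeasurableSet B → Measurable fun t => s t B) ∧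
      ∫⁻ t, (s t).variation univ ∂m < ∞ ∧ ∀ η : S × K → ℝ, Integrable η l →
        ∫ᵛ p, η p ∂•(l.withDensityᵥ h) = ∫ t, ∫ᵛ x, η (t, x) ∂•(s t) ∂m := by
  cases isEmpty_or_nonempty K with
  | inl _ =>
    refine ⟨fun _ => 0, fun _ _ => measurable_const, by simp, fun η _ => ?_⟩
    have hzero : l.withDensityᵥ h = 0 := VectorMeasure.ext fun i _ => by
      rw [Set.eq_empty_of_isEmpty i, VectorMeasure.empty, VectorMeasure.empty]
    simp [hzero]
  | inr _ =>
    obtain ⟨κ, _, _, rfl⟩ := exists_kernel_of_fst_absolutelyContinuous l hl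
    have hi : ∀ t, Integrable (fun x => h (t, x)) (κ t) := fun t =>
      integrable_of_norm_le (hm.comp measurable_prodMk_left).stronglyMeasurable fun x => hb (t, x)
    refine ⟨fun t => (κ t).withDensityᵥ fun x => h (t, x),
      fun B hB => measurable_withDensityᵥ_apply κ hm hi hB, ?_,
      fun η hη => integral_withDensityᵥ_compProd κ hm hb hη⟩
    calc ∫⁻ t, ((κ t).withDensityᵥ fun x => h (t, x)).variation univ ∂m
        ≤ ∫⁻ t, κ t univ ∂m := lintegral_mono fun t =>
          Measure.le_iff'.1 (variation_withDensityᵥ_le (hi t) fun x => hb (t, x)) univ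
      _ = (m ⊗ₘ κ) univ := by simp [Measure.compProd_apply]
      _ < ∞ := measure_lt_top _ _

theorem exists_bounded_density {d : ℕ} (ν : VectorMeasure K (Vec d)) :
    ∃ h : K → Vec d, Measurable h ∧ (∀ x, ‖h x‖ ≤ 1) ∧ ν.variation.withDensityᵥ h = ν := by
  have hν := withDensityᵥ_vecDensity_variation ν
  obtain ⟨h, hm, hb, hh⟩ := exists_bounded_withDensityᵥ_eq (integrable_vecDensity ν ν.variation)
    (measurable_vecDensity ν ν.variation) (by rw [hν])
  exact ⟨h, hm, hb, hh.trans hν⟩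

theorem exists_bounded_density_signedMeasure (τ : SignedMeasure K) :
    ∃ h : K → ℝ, Measurable h ∧ (∀ x, ‖h x‖ ≤ 1) ∧ τ.variation.withDensityᵥ h = τ := by
  have hτ := withDensityᵥ_rnDeriv_of_variation_absolutelyContinuous τ
    (Measure.AbsolutelyContinuous.refl τ.variation)
  obtain ⟨h, hm, hb, hh⟩ := exists_bounded_withDensityᵥ_eq
    (SignedMeasure.integrable_rnDeriv τ τ.variation)
    (SignedMeasure.measurable_rnDeriv τ τ.variation) (by rw [hτ])
  exact ⟨h, hm, hb, hh.trans hτ⟩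

end Disintegration

section MassCurves

open ProbabilityTheory

variable {S K : Type*} [TopologicalSpace S] [MeasurableSpace S] [OpensMeasurableSpace S]
  [MeasurableSpace K] [TopologicalSpace K] [BorelSpace K] {μ : S → FiniteMeasure K}

theorem measurable_coe_of_continuous [HasOuterApproxClosed K] (hμ : Continuous μ) :
    Measurable fun t => (μ t : Measure K) := by
  have hcont : ∀ f : BoundedContinuousFunction K NNReal,
      Continuous fun t => ∫⁻ x, f x ∂(μ t : Measure K) := fun f => by
    simp_rw [← FiniteMeasure.testAgainstNN_coe_eq]
    exact ENNReal.continuous_coe.comp ((FiniteMeasure.continuous_testAgainstNN_eval f).comp hμ)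
  have huniv : Continuous fun t => (μ t : Measure K) univ := by simpa using hcont 1
  refine Measurable.measure_of_isPiSystem (S := {F | IsClosed F})
    ((BorelSpace.measurable_eq (α := K)).trans borel_eq_generateFrom_isClosed)
    isPiSystem_isClosed (fun F hF => ?_) huniv.measurable
  exact measurable_of_tendsto_metrizable (fun n => (hcont (hF.apprSeq n)).measurable)
    (tendsto_pi_nhds.2 fun t => HasOuterApproxClosed.tendsto_lintegral_apprSeq hF (μ t : Measure K))

variable [CompactSpace S]

theorem exists_isFiniteKernel_of_continuous [HasOuterApproxClosed K] (hμ : Continuous μ) :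
    ∃ κ : Kernel S K, IsFiniteKernel κ ∧ ∀ t, κ t = (μ t : Measure K) := by
  let mass : C(S, ℝ) := ⟨fun t => (μ t).mass,
    NNReal.continuous_coe.comp (FiniteMeasure.continuous_mass.comp hμ)⟩
  refine ⟨⟨fun t => (μ t : Measure K), measurable_coe_of_continuous hμ⟩,
    ⟨ENNReal.ofReal ‖mass‖, ENNReal.ofReal_lt_top, fun t => ?_⟩, fun _ => rfl⟩
  refine FiniteMeasure.ennreal_mass.symm.trans_le ?_
  rw [← ENNReal.ofReal_coe_nnreal]
  exact ENNReal.ofReal_le_ofReal ((le_abs_self _).trans (mass.norm_coe_le_norm t))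

variable {m : Measure S} [IsFiniteMeasure m]

theorem exists_mass_of_continuous [HasOuterApproxClosed K] (hμ : Continuous μ) :
    ∃ P : FiniteMeasure (S × K), ∀ η : S × K → ℝ, Integrable η (P : Measure (S × K)) →
      ∫ p, η p ∂(P : Measure (S × K)) = ∫ t, ∫ x, η (t, x) ∂(μ t : Measure K) ∂m := by
  obtain ⟨κ, _, hκ⟩ := exists_isFiniteKernel_of_continuous hμ
  simp_rw [← hκ]
  exact ⟨⟨m ⊗ₘ κ, inferInstance⟩, fun η hη => Measure.integral_compProd hη⟩

theorem integrable_integral_mass {S K : Type*} [MetricSpace S] [CompactSpace S]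
    [MeasurableSpace S] [BorelSpace S] [MetricSpace K] [CompactSpace K] [MeasurableSpace K]
    [BorelSpace K] {m : Measure S} [IsFiniteMeasure m] {μ : S → FiniteMeasure K}
    (hμ : Continuous μ) (η : C(S × K, ℝ)) :
    Integrable (fun t => ∫ x, η (t, x) ∂(μ t : Measure K)) m := by
  obtain ⟨κ, _, hκ⟩ := exists_isFiniteKernel_of_continuous hμ
  simp_rw [← hκ]
  exact (integrable_continuousMap (l := m ⊗ₘ κ) η).integral_compProd

end MassCurves

section Limit

/-- The algebra of restrictions to `K` of the `C^1` functions on the ambient space. -/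
def contDiffRestriction {E : Type*} [NormedAddCommGroup E] [NormedSpace ℝ E] (K : Set E) :
    Subalgebra ℝ C(K, ℝ) where
  carrier := {f | ∃ g : E → ℝ, ContDiff ℝ 1 g ∧ ∀ x : K, f x = g x}
  mul_mem' := by
    rintro _ _ ⟨g, hg, h⟩ ⟨g', hg', h'⟩
    exact ⟨g * g', hg.mul hg', fun x => by simp [h, h']⟩
  add_mem' := by
    rintro _ _ ⟨g, hg, h⟩ ⟨g', hg', h'⟩
    exact ⟨g + g', hg.add hg', fun x => by simp [h, h']⟩
  algebraMap_mem' a := ⟨fun _ => a, contDiff_const, fun _ => rfl⟩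

theorem dense_contDiffRestriction {E : Type*} [NormedAddCommGroup E] [NormedSpace ℝ E] (K : Set E)
    [CompactSpace K] : Dense (contDiffRestriction K : Set C(K, ℝ)) := by
  have hsep : (contDiffRestriction K).SeparatesPoints := fun x y hxy => by
    obtain ⟨f, hf⟩ := SeparatingDual.exists_separating_of_ne (R := ℝ) (Subtype.coe_ne_coe.2 hxy)
    exact ⟨_, ⟨⟨fun x : K => f x, by fun_prop⟩, ⟨f, f.contDiff, fun _ => rfl⟩, rfl⟩, hf⟩
  rw [dense_iff_closure_eq, ← Subalgebra.topologicalClosure_coe,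
    ContinuousMap.subalgebra_topologicalClosure_eq_top_of_separatesPoints _ hsep, Algebra.coe_top]

variable {K : Type*} [MetricSpace K] [CompactSpace K] [MeasurableSpace K]

theorem norm_integral_mass_le (μ : FiniteMeasure K) (f : C(K, ℝ)) :
    ‖∫ x, f x ∂(μ : Measure K)‖ ≤ ‖f‖ * μ.mass :=
  norm_integral_le_of_norm_le_const (ae_of_all _ f.norm_coe_le_norm)

variable [BorelSpace K]

theorem lipschitzWith_integral_mass {μ : FiniteMeasure K} {M : NNReal} (hM : μ.mass ≤ M) :
    LipschitzWith M fun f : C(K, ℝ) => ∫ x, f x ∂(μ : Measure K) :=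
  LipschitzWith.of_dist_le_mul fun f g => by
    rw [dist_eq_norm, dist_eq_norm, mul_comm,
      ← integral_sub (integrable_continuousMap f) (integrable_continuousMap g)]
    refine (norm_integral_mass_le μ (f - g)).trans ?_
    gcongr

theorem tendsto_finiteMeasure_of_dense {A : Set C(K, ℝ)} (hA : Dense A) {γ : Type*}
    {F : Filter γ} {μs : γ → FiniteMeasure K} {μ : FiniteMeasure K} {M : NNReal}
    (hM : ∀ i, (μs i).mass ≤ M)
    (h : ∀ f ∈ A, Tendsto (fun i => ∫ x, f x ∂(μs i : Measure K)) F
      (𝓝 (∫ x, f x ∂(μ : Measure K)))) : Tendsto μs F (𝓝 μ) := by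
  refine FiniteMeasure.tendsto_iff_forall_integral_tendsto.2 fun f => ?_
  have hclosed := (LipschitzWith.uniformEquicontinuous _ M fun i =>
    lipschitzWith_integral_mass (hM i)).equicontinuous.isClosed_setOfPred_tendsto (l := F)
      (lipschitzWith_integral_mass (le_refl μ.mass)).continuous
  exact hclosed.closure_subset_iff.2 h (hA f.toContinuousMap)

theorem exists_tendsto_finiteMeasure_of_dense {A : Set C(K, ℝ)} (hA : Dense A)
    {μs : ℕ → FiniteMeasure K} {M : NNReal} (hM : ∀ n, (μs n).mass ≤ M)
    (h : ∀ f ∈ A, ∃ L, Tendsto (fun n => ∫ x, f x ∂(μs n : Measure K)) atTop (𝓝 L)) :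
    ∃ μ : FiniteMeasure K, μ.mass ≤ M ∧ Tendsto μs atTop (𝓝 μ) := by
  obtain ⟨φ, P, hφ, hP⟩ := exists_subseq_tendsto_finiteMeasure (ι := Unit) (fun n _ => μs n)
    fun n _ => hM n
  refine ⟨P (), le_of_tendsto ((FiniteMeasure.continuous_mass.tendsto _).comp (hP ()))
    (Eventually.of_forall fun n => hM _), tendsto_finiteMeasure_of_dense hA hM fun f hf => ?_⟩
  obtain ⟨L, hL⟩ := h f hf
  have hsub := FiniteMeasure.tendsto_iff_forall_integral_tendsto.1 (hP ())
    (BoundedContinuousFunction.mkOfCompact f)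
  rwa [← tendsto_nhds_unique hsub (hL.comp hφ.tendsto_atTop)] at hL

theorem exists_component_eq {d : ℕ} {X : Type*} [MeasurableSpace X]
    (τ : Fin d → SignedMeasure X) : ∃ ν : VectorMeasure X (Vec d), ∀ i, component ν i = τ i := by
  refine ⟨⟨fun s => WithLp.toLp 2 fun i => τ i s, ?_, fun s hs => ?_, fun f hf hd => ?_⟩,
    fun i => ?_⟩
  · ext i
    simp
  · ext i
    simp [VectorMeasure.not_measurable _ hs]
  · have hsum : HasSum (fun k i => τ i (f k)) fun i => τ i (⋃ k, f k) :=
      Pi.hasSum.2 fun i => VectorMeasure.hasSum_of_disjoint_iUnion hf hd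
    exact hsum.map (WithLp.linearEquiv 2 ℝ (Fin d → ℝ)).symm.toAddMonoidHom
      (PiLp.continuous_toLp 2 _)
  · ext s _
    rfl

end Limit

section TimeIntegrals

theorem IsSignedDisintegration.setIntegral_eq {K : Type*} [MeasurableSpace K]
    {τ : SignedMeasure (I × K)} {s : I → SignedMeasure K} (h : IsSignedDisintegration τ s)
    {S : Set I} (hS : MeasurableSet S) {η : I × K → ℝ} (hη : Measurable η) {C : ℝ}
    (hC : ∀ p, ‖η p‖ ≤ C) :
    ∫ t in S, ∫ᵛ x, η (t, x) ∂•(s t) = ∫ᵛ p, (S ×ˢ univ).indicator η p ∂•τ := by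
  rw [h.eq _ (hη.indicator (hS.prod MeasurableSet.univ))
    ⟨C, fun p => (norm_indicator_le_norm_self _ _).trans (hC p)⟩, ← integral_indicator hS]
  congr 1 with t
  by_cases ht : t ∈ S <;> simp [indicator, ht]

variable {d : ℕ} {D : Set (Vec d)} [CompactSpace (Cl D)] {T : Triple D} {c : Curve D}

theorem IsDisintegration.setIntegral_inner (h : IsDisintegration T c) {S : Set I}
    (hS : MeasurableSet S) (F : C(Cyl D, Vec d)) :
    ∫ t in S, ∫ᵛ x, F (t, x) ∂[innerSL ℝ; c.momentum t] =
      ∑ i, ∫ᵛ p, (S ×ˢ univ).indicator (fun p => F p i) p ∂•(component T.momentum i) := by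
  let Fi (i : Fin d) : C(Cyl D, ℝ) := ⟨fun p => F p i, by fun_prop⟩
  have hFi : ∀ i, Measurable (Fi i) := fun i => (Fi i).continuous.measurable
  have hν := h.isSignedDisintegration_component_momentum
  have hsum : ∀ t, ∫ᵛ x, F (t, x) ∂[innerSL ℝ; c.momentum t] =
      ∑ i, ∫ᵛ x, Fi i (t, x) ∂•component (c.momentum t) i := fun t =>
    integral_inner_eq_sum (integrable_continuousMap ⟨fun x => F (t, x), by fun_prop⟩)
  have hint : ∀ i, Integrable fun t => ∫ᵛ x, Fi i (t, x) ∂•component (c.momentum t) i := fun i =>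
    integrable_integral_family (hν i).measurable (hν i).finite (hFi i) (Fi i).norm_coe_le_norm
  simp_rw [hsum]
  rw [integral_finsetSum _ fun i _ => (hint i).restrict]
  exact Finset.sum_congr rfl fun i _ =>
    (hν i).setIntegral_eq hS (hFi i) (Fi i).norm_coe_le_norm

theorem IsDisintegration.setIntegral_flux (h : IsDisintegration T c) {g : Vec d → ℝ}
    (hg : ContDiff ℝ 1 g) {S : Set I} (hS : MeasurableSet S) :
    ∫ s in S, flux c g s =
      ∑ i, ∫ᵛ p, (S ×ˢ univ).indicator (fun p : Cyl D => gradient g p.2 i) p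
          ∂•(component T.momentum i)
        + ∫ᵛ p, (S ×ˢ univ).indicator (fun p : Cyl D => g p.2) p ∂•T.source := by
  have hspace : Continuous fun p : Cyl D => (p.2 : Vec d) :=
    continuous_subtype_val.comp continuous_snd
  let gradg : C(Cyl D, Vec d) := ⟨fun p => gradient g p.2, (continuous_gradient hg).comp hspace⟩
  let g' : C(Cyl D, ℝ) := ⟨fun p => g p.2, hg.continuous.comp hspace⟩
  have hmomentum := h.setIntegral_inner hS gradg
  have hsource := h.isSignedDisintegration_source.setIntegral_eq hS g'.continuous.measurable
    g'.norm_coe_le_norm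
  exact (integral_add (h.integrable_inner gradg).restrict (h.integrable_source g').restrict).trans
    (congrArg₂ (· + ·) hmomentum hsource)

end TimeIntegrals

section Compactness

variable {d : ℕ} {D : Set (Vec d)}

/-- The scalar components of the momentum and of the source of a triple. -/
def fluxComponent (T : Triple D) : Option (Fin d) → SignedMeasure (Cyl D)
  | none => T.source
  | some i => component T.momentum i

theorem exists_disintegration_of_hasTimeModulus (ν : VectorMeasure (Cyl D) (Vec d))
    (ζ : SignedMeasure (Cyl D)) (hν : ∀ i, ∃ b, HasTimeModulus b (component ν i).variation)
    (hζ : ∃ b, HasTimeModulus b ζ.variation) :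
    ∃ (s : I → VectorMeasure (Cl D) (Vec d)) (z : I → SignedMeasure (Cl D)),
      IsDisintegration ⟨0, ν, ζ⟩ ⟨fun _ => 0, s, z⟩ := by
  have hνfst : ν.variation.fst ≪ volume := by
    refine Measure.AbsolutelyContinuous.mk fun J hJ hJ0 => ?_
    have hcomp : ∀ i, (component ν i).variation (Prod.fst ⁻¹' J) = 0 := fun i => by
      obtain ⟨b, hb⟩ := hν i
      rw [← Measure.fst_apply hJ]
      exact hb.fst_absolutelyContinuous hJ0
    rw [Measure.fst_apply hJ]
    refine le_antisymm ((Measure.le_iff'.1 (variation_le_sum_component ν) _).trans ?_) zero_le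
    rw [Measure.finsetSum_apply]
    simp [hcomp]
  have : StandardBorelSpace (Cl D) := isClosed_closure.measurableSet.standardBorel
  obtain ⟨b, hb⟩ := hζ
  obtain ⟨h, hm, hh, hνh⟩ := exists_bounded_density ν
  obtain ⟨k, km, hk, hζk⟩ := exists_bounded_density_signedMeasure ζ
  obtain ⟨s, hs, hsfin, hsν⟩ := exists_disintegration_withDensityᵥ ν.variation hνfst hm hh
  obtain ⟨z, hz, hzfin, hzζ⟩ := exists_disintegration_withDensityᵥ ζ.variation
    hb.fst_absolutelyContinuous km hk
  rw [hνh] at hsν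
  rw [hζk] at hzζ
  exact ⟨s, z, continuous_const, hs, hsfin, hz, hzfin, fun η _ => by simp, hsν, hzζ⟩

theorem exists_continuous_tendsto_finiteMeasure_of_dense {S K : Type*} [TopologicalSpace S]
    [MetricSpace K] [CompactSpace K] [MeasurableSpace K] [BorelSpace K] {A : Set C(K, ℝ)}
    (hA : Dense A) {μs : ℕ → S → FiniteMeasure K} {M : NNReal} (hM : ∀ n t, (μs n t).mass ≤ M)
    (h : ∀ f ∈ A, ∃ F : S → ℝ, Continuous F ∧
      ∀ t, Tendsto (fun n => ∫ x, f x ∂(μs n t : Measure K)) atTop (𝓝 (F t))) :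
    ∃ μ : S → FiniteMeasure K, Continuous μ ∧
      ∀ t, Tendsto (fun n => μs n t) atTop (𝓝 (μ t)) := by
  choose μ hμM hμ using fun t => exists_tendsto_finiteMeasure_of_dense hA
    (μs := fun n => μs n t) (fun n => hM n t) fun f hf =>
      let ⟨F, _, hF⟩ := h f hf
      ⟨F t, hF t⟩
  refine ⟨μ, continuous_iff_continuousAt.2 fun t =>
    tendsto_finiteMeasure_of_dense hA hμM fun f hf => ?_, hμ⟩
  obtain ⟨F, hFc, hF⟩ := h f hf
  have hμF : ∀ t, ∫ x, f x ∂(μ t : Measure K) = F t := fun t =>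
    tendsto_nhds_unique (FiniteMeasure.tendsto_iff_forall_integral_tendsto.1 (hμ t)
      (BoundedContinuousFunction.mkOfCompact f)) (hF t)
  simp_rw [hμF]
  exact hFc.tendsto t

variable {μA μB : FiniteMeasure (Cl D)} {T : ℕ → Triple D} {c : ℕ → Curve D} {T' : Triple D}
  {c' : Curve D}

/-- Convergence of curves with values in measures: the masses converge weakly-* at all times, the
components of momentum and source converge weakly-* on the space-time cylinder. -/
structure ConvergesTo (T : ℕ → Triple D) (c : ℕ → Curve D) (T' : Triple D) (c' : Curve D) :
    Prop where
  mass : ∀ t, Tendsto (fun n => (c n).mass t) atTop (𝓝 (c'.mass t))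
  flux : ∀ o (f : C(Cyl D, ℝ)), Tendsto (fun n => ∫ᵛ p, f p ∂•(fluxComponent (T n) o)) atTop
    (𝓝 (∫ᵛ p, f p ∂•(fluxComponent T' o)))

variable [CompactSpace (Cl D)]

theorem tendsto_integral_mass_of_tendsto_flux (hT : ∀ n, IsWeakSolution μA μB (T n) (c n))
    (hT' : IsDisintegration T' c') {b b' : Option (Fin d) → ℝ → NNReal}
    (hb : ∀ o n, HasTimeModulus (b o) (fluxComponent (T n) o).variation)
    (hb' : ∀ o, HasTimeModulus (b' o) (fluxComponent T' o).variation)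
    (hlim : ∀ o (f : C(Cyl D, ℝ)), Tendsto (fun n => ∫ᵛ p, f p ∂•(fluxComponent (T n) o)) atTop
      (𝓝 (∫ᵛ p, f p ∂•(fluxComponent T' o)))) {g : Vec d → ℝ} (hg : ContDiff ℝ 1 g) (t : I) :
    Tendsto (fun n => ∫ x : Cl D, g x ∂((c n).mass t : Measure (Cl D))) atTop
      (𝓝 (∫ x : Cl D, g x ∂(μA : Measure (Cl D)) + ∫ s in Iic t, flux c' g s)) := by
  have hspace : Continuous fun p : Cyl D => (p.2 : Vec d) :=
    continuous_subtype_val.comp continuous_snd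
  have hindicator : ∀ o (f : C(Cyl D, ℝ)), Tendsto
      (fun n => ∫ᵛ p, (Iic t ×ˢ univ).indicator f p ∂•(fluxComponent (T n) o)) atTop
      (𝓝 (∫ᵛ p, (Iic t ×ˢ univ).indicator f p ∂•(fluxComponent T' o))) := fun o =>
    tendsto_integral_indicator (hb o) (hb' o) (hlim o) isClosed_Iic
  simp_rw [fun n => (hT n).integral_mass_eq hg t,
    fun n => (hT n).disintegration.setIntegral_flux hg (measurableSet_Iic (a := t)),
    hT'.setIntegral_flux hg (measurableSet_Iic (a := t))]
  exact tendsto_const_nhds.add ((tendsto_finsetSum _ fun i _ => hindicator (some i)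
    ⟨fun p : Cyl D => gradient g p.2 i, (EuclideanSpace.proj (𝕜 := ℝ) i).continuous.comp
      ((continuous_gradient hg).comp hspace)⟩).add
    (hindicator none ⟨fun p : Cyl D => g p.2, hg.continuous.comp hspace⟩))

theorem exists_subseq_convergesTo (hT : ∀ n, IsWeakSolution μA μB (T n) (c n)) {M : NNReal}
    (hM : ∀ n t, ((c n).mass t).mass ≤ M)
    (hflux : ∀ o, ∃ b, ∀ n, HasTimeModulus b (fluxComponent (T n) o).variation) :
    ∃ (φ : ℕ → ℕ) (T' : Triple D) (c' : Curve D), StrictMono φ ∧ IsDisintegration T' c' ∧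
      ConvergesTo (T ∘ φ) (c ∘ φ) T' c' := by
  choose b hb using hflux
  obtain ⟨φ, τ, hφ, hτ⟩ := exists_subseq_tendsto_signedMeasure hb
  obtain ⟨ν, hν⟩ := exists_component_eq fun i => τ (some i)
  have hτeq : ∀ m, fluxComponent ⟨m, ν, τ none⟩ = τ := fun m => by
    ext1 o
    cases o with
    | none => rfl
    | some i => exact hν i
  choose b' hb' using fun o => (hτ o).1
  have hlim := fun o => (hτ o).2
  obtain ⟨s, z, hsz⟩ := exists_disintegration_of_hasTimeModulus ν (τ none)
    (fun i => ⟨b' (some i), hν i ▸ hb' (some i)⟩) ⟨b' none, hb' none⟩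
  rw [← hτeq 0] at hb' hlim
  obtain ⟨μ, hμc, hμ⟩ := exists_continuous_tendsto_finiteMeasure_of_dense
    (dense_contDiffRestriction (closure D)) (μs := fun n => (c (φ n)).mass)
    (fun n => hM (φ n)) <| by
    rintro f ⟨g, hg, hfg⟩
    simp_rw [hfg]
    exact ⟨_, continuous_const.add (continuous_setIntegral_Iic (hsz.integrable_flux hg)),
      tendsto_integral_mass_of_tendsto_flux (fun n => hT (φ n)) hsz (fun o n => hb o (φ n)) hb'
        hlim hg⟩
  obtain ⟨m, hm⟩ := exists_mass_of_continuous (m := volume) hμc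
  refine ⟨φ, ⟨m, ν, τ none⟩, ⟨μ, s, z⟩, hφ, ⟨hμc, hsz.measurable_momentum, hsz.finite_momentum,
    hsz.measurable_source, hsz.finite_source, hm, hsz.momentum_eq, hsz.source_eq⟩, hμ, ?_⟩
  rwa [hτeq m, ← hτeq 0]

end Compactness

section CurvePairing

variable {d : ℕ} {D : Set (Vec d)}

theorem deriv_slice_eq {E : Type*} [NormedAddCommGroup E] [NormedSpace ℝ E] {η : ℝ × E → ℝ}
    (hη : Differentiable ℝ η) (t : ℝ) (x : E) :
    deriv (fun s : ℝ => η (s, x)) t = fderiv ℝ η (t, x) (1, 0) :=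
  ((hη (t, x)).hasFDerivAt.comp_hasDerivAt t
    ((hasDerivAt_id t).prodMk (hasDerivAt_const t x))).deriv

theorem gradient_slice_eq {E : Type*} [NormedAddCommGroup E] [InnerProductSpace ℝ E]
    [CompleteSpace E] {η : ℝ × E → ℝ} (hη : Differentiable ℝ η) (t : ℝ) (x : E) :
    gradient (fun y : E => η (t, y)) x = (InnerProductSpace.toDual ℝ E).symm
      ((fderiv ℝ η (t, x)).comp (ContinuousLinearMap.inr ℝ ℝ E)) :=
  congrArg _ ((hη (t, x)).hasFDerivAt.comp x (hasFDerivAt_prodMk_right t x)).fderiv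

theorem exists_coeff_eq_slices {η : ℝ × Vec d → ℝ} (hη : ContDiff ℝ 1 η) :
    ∃ L : C(Cyl D, Coeff d), ∀ (t : I) (x : Cl D),
      L (t, x) = (gradient (fun y : Vec d => η ((t : ℝ), y)) (x : Vec d),
        deriv (fun s : ℝ => η (s, (x : Vec d))) (t : ℝ), η ((t : ℝ), (x : Vec d))) := by
  have hcoe : Continuous fun p : Cyl D => ((p.1 : ℝ), (p.2 : Vec d)) := by fun_prop
  have hfderiv := (hη.continuous_fderiv one_ne_zero).comp hcoe
  have hdiff := hη.differentiable one_ne_zero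
  refine ⟨⟨fun p => (gradient (fun y : Vec d => η ((p.1 : ℝ), y)) (p.2 : Vec d),
    deriv (fun s : ℝ => η (s, (p.2 : Vec d))) (p.1 : ℝ), η ((p.1 : ℝ), (p.2 : Vec d))),
    .prodMk ?_ (.prodMk ?_ (hη.continuous.comp hcoe))⟩, fun _ _ => rfl⟩
  · simp_rw [gradient_slice_eq hdiff]
    exact (InnerProductSpace.toDual ℝ (Vec d)).symm.continuous.comp
      (hfderiv.clm_comp continuous_const)
  · simp_rw [deriv_slice_eq hdiff]
    exact hfderiv.clm_apply continuous_const

variable [CompactSpace (Cl D)]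

/-- The pairing of a curve, at a fixed time, with test fields on the space-time cylinder. -/
def curvePairing (c : Curve D) (L : C(Cyl D, Coeff d)) (t : I) : ℝ :=
  pairing (c.mass t) (c.momentum t) (c.source t) (L.curry t)

variable {T' : Triple D} {c' : Curve D}

theorem IsDisintegration.integrable_curvePairing (h : IsDisintegration T' c')
    (L : C(Cyl D, Coeff d)) : Integrable (curvePairing c' L) :=
  ((h.integrable_inner (ContinuousMap.fst.comp L)).add
    (integrable_integral_mass h.continuous_mass
      (ContinuousMap.fst.comp (ContinuousMap.snd.comp L)))).add
    (h.integrable_source (ContinuousMap.snd.comp (ContinuousMap.snd.comp L)))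

theorem IsDisintegration.integral_curvePairing (h : IsDisintegration T' c')
    (L : C(Cyl D, Coeff d)) :
    ∫ t, curvePairing c' L t = ∑ i, ∫ᵛ p, (L p).1 i ∂•(fluxComponent T' (some i))
      + (∫ t : I, ∫ x, (L (t, x)).2.1 ∂(c'.mass t : Measure (Cl D)))
      + ∫ᵛ p, (L p).2.2 ∂•(fluxComponent T' none) := by
  let F : C(Cyl D, Vec d) := ContinuousMap.fst.comp L
  let H : C(Cyl D, ℝ) := ContinuousMap.fst.comp (ContinuousMap.snd.comp L)
  let G : C(Cyl D, ℝ) := ContinuousMap.snd.comp (ContinuousMap.snd.comp L)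
  have hF := h.setIntegral_inner MeasurableSet.univ F
  have hG := h.isSignedDisintegration_source.setIntegral_eq MeasurableSet.univ
    G.continuous.measurable G.norm_coe_le_norm
  simp only [univ_prod_univ, indicator_univ, setIntegral_univ] at hF hG
  have hFi := h.integrable_inner F
  have hHi := integrable_integral_mass (m := volume) h.continuous_mass H
  refine (integral_add (hFi.add hHi) (h.integrable_source G)).trans (congrArg₂ (· + ·) ?_ hG)
  exact (integral_add hFi hHi).trans (congrArg (· + _) hF)

variable {T : ℕ → Triple D} {c : ℕ → Curve D}

theorem ConvergesTo.tendsto_integral_curvePairing (hc : ConvergesTo T c T' c')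
    (hT : ∀ n, IsDisintegration (T n) (c n)) (hT' : IsDisintegration T' c') {M : NNReal}
    (hM : ∀ n t, ((c n).mass t).mass ≤ M) (L : C(Cyl D, Coeff d)) :
    Tendsto (fun n => ∫ t, curvePairing (c n) L t) atTop (𝓝 (∫ t, curvePairing c' L t)) := by
  let H : C(Cyl D, ℝ) := ContinuousMap.fst.comp (ContinuousMap.snd.comp L)
  have hmass : Tendsto (fun n => ∫ t : I, ∫ x, H (t, x) ∂((c n).mass t : Measure (Cl D))) atTop
      (𝓝 (∫ t : I, ∫ x, H (t, x) ∂(c'.mass t : Measure (Cl D)))) := by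
    refine tendsto_integral_of_dominated_convergence (fun _ => ‖H‖ * M)
      (fun n => (integrable_integral_mass (hT n).continuous_mass H).aestronglyMeasurable)
      (integrable_const _) (fun n => ae_of_all _ fun t => ?_) (ae_of_all _ fun t => ?_)
    · refine norm_integral_le_of_norm_le_const
        (ae_of_all _ fun x => H.norm_coe_le_norm (t, x)) |>.trans ?_
      gcongr
      exact hM n t
    · exact FiniteMeasure.tendsto_iff_forall_integral_tendsto.1 (hc.mass t)
        (BoundedContinuousFunction.mkOfCompact ⟨fun x : Cl D => H (t, x), by fun_prop⟩)
  simp_rw [fun n => (hT n).integral_curvePairing L, hT'.integral_curvePairing L]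
  exact ((tendsto_finsetSum _ fun i _ => hc.flux (some i) ⟨fun p => (L p).1 i, by fun_prop⟩).add
    hmass).add (hc.flux none (ContinuousMap.snd.comp (ContinuousMap.snd.comp L)))

theorem ConvergesTo.isWeakSolution {μA μB : FiniteMeasure (Cl D)} (hc : ConvergesTo T c T' c')
    (hT : ∀ n, IsWeakSolution μA μB (T n) (c n)) (hT' : IsDisintegration T' c') {M : NNReal}
    (hM : ∀ n t, ((c n).mass t).mass ≤ M) : IsWeakSolution μA μB T' c' := by
  refine ⟨hT', fun η hη => ?_⟩
  obtain ⟨L, hL⟩ := exists_coeff_eq_slices (D := D) hη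
  have hpairing : ∀ (c : Curve D) (t : I), curvePairing c L t =
      (∫ x : Cl D, deriv (fun s : ℝ => η (s, (x : Vec d))) (t : ℝ) ∂(c.mass t : Measure (Cl D)))
        + (∫ᵛ x : Cl D, gradient (fun y : Vec d => η ((t : ℝ), y)) (x : Vec d)
            ∂[innerSL ℝ; c.momentum t])
        + (∫ᵛ x : Cl D, η ((t : ℝ), (x : Vec d)) ∂•(c.source t)) := fun c t => by
    simp only [curvePairing, pairing_apply, ContinuousMap.curry_apply, hL]
    rw [add_comm (∫ x, _ ∂(c.mass t : Measure (Cl D)))]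
  simp_rw [← hpairing]
  refine tendsto_nhds_unique (tendsto_const_nhds.congr fun n => ?_)
    (((hc.tendsto_integral_curvePairing (fun n => (hT n).disintegration) hT' hM L).sub_const
      _).add_const _)
  simp_rw [hpairing]
  exact (hT n).equation η hη

end CurvePairing

section LowerSemicontinuity

variable {d : ℕ} {D : Set (Vec d)} [CompactSpace (Cl D)] {T : ℕ → Triple D} {c : ℕ → Curve D}
  {T' : Triple D} {c' : Curve D}

theorem curvePairing_smul (c : Curve D) (w : C(I, ℝ)) (L : C(Cl D, Coeff d)) (t : I) :
    curvePairing c ⟨fun p => w p.1 • L p.2, by fun_prop⟩ t =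
      w t * pairing (c.mass t) (c.momentum t) (c.source t) L :=
  map_smul (pairing _ _ _) (w t) L

theorem IsDisintegration.integrable_pairing (h : IsDisintegration T' c') (L : C(Cl D, Coeff d)) :
    Integrable fun t => pairing (c'.mass t) (c'.momentum t) (c'.source t) L :=
  h.integrable_curvePairing (L.comp ContinuousMap.snd)

theorem ConvergesTo.tendsto_integral_mul_pairing_sub (hc : ConvergesTo T c T' c')
    (hT : ∀ n, IsDisintegration (T n) (c n)) (hT' : IsDisintegration T' c') {M : NNReal}
    (hM : ∀ n t, ((c n).mass t).mass ≤ M) (w : C(I, ℝ)) (L : C(Cl D, Coeff d)) (q : ℝ) :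
    Tendsto (fun n => ∫ t, w t * (pairing ((c n).mass t) ((c n).momentum t) ((c n).source t) L - q))
      atTop (𝓝 (∫ t, w t * (pairing (c'.mass t) (c'.momentum t) (c'.source t) L - q))) := by
  let wL : C(Cyl D, Coeff d) := ⟨fun p => w p.1 • L p.2, by fun_prop⟩
  have hwq : Integrable fun t : I => w t * q :=
    integrable_continuousMap ⟨fun t => w t * q, by fun_prop⟩
  have hsub : ∀ {T : Triple D} {c : Curve D}, IsDisintegration T c →
      ∫ t, w t * (pairing (c.mass t) (c.momentum t) (c.source t) L - q) =
        (∫ t, curvePairing c wL t) - ∫ t : I, w t * q := fun {T c} h => by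
    rw [← integral_sub (h.integrable_curvePairing wL) hwq]
    simp_rw [mul_sub, ← curvePairing_smul]
    rfl
  simp_rw [fun n => hsub (hT n), hsub hT']
  exact (hc.tendsto_integral_curvePairing hT hT' hM wL).sub_const _

theorem ConvergesTo.lintegral_le_liminf_of_isAffineSup (hc : ConvergesTo T c T' c')
    (hT : ∀ n, IsDisintegration (T n) (c n)) (hT' : IsDisintegration T' c') {M : NNReal}
    (hM : ∀ n t, ((c n).mass t).mass ≤ M)
    {F : FiniteMeasure (Cl D) → VectorMeasure (Cl D) (Vec d) → SignedMeasure (Cl D) → ℝ≥0∞}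
    (hF : IsAffineSup F) :
    ∫⁻ t, F (c'.mass t) (c'.momentum t) (c'.source t) ≤
      liminf (fun n => ∫⁻ t, F ((c n).mass t) ((c n).momentum t) ((c n).source t)) atTop := by
  obtain ⟨L, q, -, hF⟩ := hF
  have hint : ∀ {T : Triple D} {c : Curve D}, IsDisintegration T c → ∀ k,
      Integrable fun t => pairing (c.mass t) (c.momentum t) (c.source t) (L k) - q k :=
    fun h k => (h.integrable_pairing (L k)).sub (integrable_const _)
  simp_rw [hF]
  refine lintegral_iSup_le_of_weights (hint hT') fun N w => ?_
  have hlim := ENNReal.tendsto_ofReal (tendsto_finsetSum Finset.univ fun (k : Fin N) _ =>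
    hc.tendsto_integral_mul_pairing_sub hT hT' hM (w.1 k) (L k) (q k))
  rw [← hlim.liminf_eq]
  exact liminf_le_liminf (Eventually.of_forall fun n => sum_integral_weights_le (hint (hT n)) w)

end LowerSemicontinuity

theorem mainTheorem2_general {d : ℕ} {D : Set (Vec d)} (hD : Bornology.IsBounded D)
    {r : ℝ → ℝ} (hr : IsCoercivePenalty r) {δ : ℝ} (hδ : 0 < δ) (μA μB : FiniteMeasure (Cl D))
    (T : ℕ → Triple D) (c : ℕ → Curve D) (hT : ∀ n, IsWeakSolution μA μB (T n) (c n))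
    (C : NNReal) (hC : ∀ n, pathEnergy δ r (c n) ≤ C) :
    ∃ (φ : ℕ → ℕ) (T' : Triple D) (c' : Curve D),
      StrictMono φ ∧
      IsWeakSolution μA μB T' c' ∧
      (∀ t : I, Tendsto (fun n => (c (φ n)).mass t) atTop (𝓝 (c'.mass t))) ∧
      (∀ f : C(Cyl D, Vec d),
        Tendsto (fun n => ∫ᵛ p, f p ∂[innerSL ℝ; (T (φ n)).momentum]) atTop
          (𝓝 (∫ᵛ p, f p ∂[innerSL ℝ; T'.momentum]))) ∧
      (∀ f : C(Cyl D, ℝ),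
        Tendsto (fun n => ∫ᵛ p, f p ∂•(T (φ n)).source) atTop
          (𝓝 (∫ᵛ p, f p ∂•T'.source))) ∧
      pathEnergy δ r c' ≤ liminf (fun n => pathEnergy δ r (c (φ n))) atTop := by
  have := compactSpace_of_isBounded hD
  have := isFiniteMeasure_leb hD
  have hdis := fun n => (hT n).disintegration
  obtain ⟨M, hM⟩ := exists_mass_le hr hδ hT hC
  obtain ⟨φ, T', c', hφ, hdis', hconv⟩ := exists_subseq_convergesTo hT hM fun
    | none => exists_hasTimeModulus_source hr hδ hdis hC
    | some i => exists_hasTimeModulus_component_momentum hdis hC hM i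
  have hMφ := fun n => hM (φ n)
  refine ⟨φ, T', c', hφ, hconv.isWeakSolution (fun n => hT (φ n)) hdis' hMφ, hconv.mass,
    fun f => ?_, hconv.flux none, hconv.lintegral_le_liminf_of_isAffineSup (fun n => hdis (φ n))
      hdis' hMφ (isAffineSup_energyDensity (leb D) d hr.convex hr.zero hδ.le)⟩
  simp_rw [integral_inner_eq_sum (integrable_continuousMap f)]
  exact tendsto_finsetSum _ fun i _ => hconv.flux (some i) ⟨fun p => f p i, by fun_prop⟩

end

end SourceTransport

open SourceTransport in
theorem mainTheorem2 {d : ℕ} {D : Set (Vec d)} (hD : IsBoundedConvexDomain D)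
    {r : ℝ → ℝ} (hr : IsSourcePenalty r) {δ : ℝ} (hδ : 0 < δ)
    (μA μB : FiniteMeasure (Cl D))
    (T : ℕ → Triple D) (c : ℕ → Curve D)
    (hT : ∀ n, IsWeakSolution μA μB (T n) (c n))
    (C : ℝ) (hC : ∀ n, pathEnergy δ r (c n) ≤ ENNReal.ofReal C) :
    ∃ (φ : ℕ → ℕ) (T' : Triple D) (c' : Curve D),
      StrictMono φ ∧
      IsWeakSolution μA μB T' c' ∧
      (∀ t : I, Tendsto (fun n => (c (φ n)).mass t) atTop (𝓝 (c'.mass t))) ∧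
      (∀ f : C(Cyl D, Vec d),
        Tendsto (fun n => ∫ᵛ p, f p ∂[innerSL ℝ; (T (φ n)).momentum]) atTop
          (𝓝 (∫ᵛ p, f p ∂[innerSL ℝ; T'.momentum]))) ∧
      (∀ f : C(Cyl D, ℝ),
        Tendsto (fun n => ∫ᵛ p, f p ∂•(T (φ n)).source) atTop
          (𝓝 (∫ᵛ p, f p ∂•T'.source))) ∧
      pathEnergy δ r c' ≤ liminf (fun n => pathEnergy δ r (c (φ n))) atTop :=
  mainTheorem2_general hD.isBounded hr.isCoercivePenalty hδ μA μB T c hT C.toNNReal hC
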